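/- Let $k$ be a field complete with respect to a nontrivial non-archimedean absolute value, let $n>r\ge 0$ be integers, let $U\subseteq k^n$ be open and let $f:U\to U$ be an analytic diffeomorphism (a bijection which, like its inverse, is locally given by convergent power series). Let $F=\{x\in U: f(x)=x\}$. For $d\le n$ let $F_d$ be the set of points of $F$ near which $F$ is a $d$-dimensional analytic submanifold. Assume that $F$ is $r$-dimensional, i.e. $F_r\neq\emptyset$ and $F_d=\emptyset$ for $d>r$, and that the tangent map $Df_q$ is semisimple at every $q\in F$. A set of general fixed points is a relatively open subset $G$ of $F$ which is contained in $F_r$ and dense in $F_r$. Let $G$ be such a set. 1. Suppose that $k$ has characteristic $0$ and that at every $q\in G$ exactly $n-r$ eigenvalues of $Df_q$ (with multiplicity) are distinct from $1$, and these are all equal to one element $\mu(q)\in k$ which is not a root of unity; that is, $\det(X-Df_q)=(X-1)^r(X-\mu(q))^{n-r}$. Then for every $q\in G$ there are analytic coordinates $x_1,\dots,x_n$ in a neighbourhood of $q$, centred at $q$, and functions $\lambda_1,\dots,\lambda_n$ of $r$ variables, analytic near the origin, with $\lambda_1=\dots=\lambda_r=1$ and $\lambda_{r+1}=\dots=\lambda_n$,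 such that in these coordinates $$f^{(i)}(x)=\lambda_i(x_1,\dots,x_r)\,x_i\qquad (1\le i\le n)$$ near $q$. 2. Suppose (in any characteristic) that the eigenvalues are constant on $G$: there are $\lambda_1=\dots=\lambda_r=1$ and $\lambda_{r+1},\dots,\lambda_n\in k$ with $\det(X-Df_q)=\prod_{i=1}^n(X-\lambda_i)$ for every $q\in G$; and that there are $C>0$ and $\beta\ge 0$ such that $$|\lambda_{r+1}^{i_{r+1}}\cdots\lambda_n^{i_n}-\lambda_j|\ge C\,(i_{r+1}+\dots+i_n)^{-\beta}$$ for all $r<j\le n$ and all integers $i_{r+1},\dots,i_n\ge 0$ with $i_{r+1}+\dots+i_n\ge 2$. Then for every $q\in G$ there are analytic coordinates $x_1,\dots,x_n$ in a neighbourhood of $q$, centred at $q$, in which $f^{(i)}(x)=\lambda_i x_i$ for $1\le i\le n$ near $q$. -/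

import Mathlib

/-- `φ` restricts to an analytic diffeomorphism from the open set `W ⊆ kⁿ` onto the open set
`V ⊆ kⁿ`: it is a bijection, locally given by convergent power series, and so is its inverse. -/
def IsAnalyticDiffeo (k : Type*) [NontriviallyNormedField k] {n : ℕ}
    (φ : (Fin n → k) → (Fin n → k)) (W V : Set (Fin n → k)) : Prop :=
  IsOpen W ∧ IsOpen V ∧ Set.BijOn φ W V ∧ AnalyticOnNhd k φ W ∧
    ∃ ψ : (Fin n → k) → (Fin n → k), Set.InvOn ψ φ W V ∧ AnalyticOnNhd k ψ V

/-- The fixed set, inside the domain `U`, of the map `f`. -/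
def fixedSet {α : Type*} (f : α → α) (U : Set α) : Set α :=
  {x | x ∈ U ∧ f x = x}

/-- The points of `F ⊆ kⁿ` near which `F` is a `d`-dimensional analytic submanifold: in suitable
analytic coordinates around the point, `F` is the zero locus of the last `n - d` coordinates. -/
def smoothLocus (k : Type*) [NontriviallyNormedField k] {n : ℕ} (d : ℕ)
    (F : Set (Fin n → k)) : Set (Fin n → k) :=
  {q | q ∈ F ∧ d ≤ n ∧ ∃ (W V : Set (Fin n → k)) (φ : (Fin n → k) → (Fin n → k)),
    IsAnalyticDiffeo k φ W V ∧ q ∈ W ∧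
      ∀ x ∈ W, (x ∈ F ↔ ∀ i : Fin n, d ≤ (i : ℕ) → φ x i = 0)}

/-- `F` is `r`-dimensional: `r` is the largest dimension of `F` at one of its smooth points. -/
def HasAnalyticDim (k : Type*) [NontriviallyNormedField k] {n : ℕ} (r : ℕ)
    (F : Set (Fin n → k)) : Prop :=
  (smoothLocus k r F).Nonempty ∧ ∀ d : ℕ, r < d → smoothLocus k d F = ∅

/-- `G` is a set of general points of the `r`-dimensional set `F`: a relatively open subset of `F`
that consists of smooth points at which `F` has dimension `r`, and is dense among these. -/
def IsGeneralSubset (k : Type*) [NontriviallyNormedField k] {n : ℕ} (r : ℕ)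
    (F G : Set (Fin n → k)) : Prop :=
  G ⊆ smoothLocus k r F ∧ (∃ O : Set (Fin n → k), IsOpen O ∧ G = O ∩ F) ∧
    smoothLocus k r F ⊆ closure G

/-- The map `f`, which fixes `q`, takes near `q` the form `x_i ↦ lam_i(x_1, …, x_r) x_i` in
suitable analytic coordinates `x = φ` centred at `q`, with `lam_i` analytic near the origin. -/
def IsLinearizedBy {k : Type*} [NontriviallyNormedField k] {n r : ℕ} (hr : r ≤ n)
    (f : (Fin n → k) → (Fin n → k)) (q : Fin n → k)
    (lam : Fin n → (Fin r → k) → k) : Prop :=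
  (∀ i, AnalyticAt k (lam i) 0) ∧
  ∃ (W V : Set (Fin n → k)) (φ : (Fin n → k) → (Fin n → k)),
    IsAnalyticDiffeo k φ W V ∧ q ∈ W ∧ φ q = 0 ∧
      ∃ W₀ : Set (Fin n → k), IsOpen W₀ ∧ q ∈ W₀ ∧ W₀ ⊆ W ∧ Set.MapsTo f W₀ W ∧
        ∀ x ∈ W₀, ∀ i : Fin n,
          φ (f x) i = lam i (fun j : Fin r => φ x (Fin.castLE hr j)) * φ x i

/-- The bad Diophantine approximation property
`|λ_{r+1}^{i_{r+1}} ⋯ λ_n^{i_n} - λ_j| ≥ C (i_{r+1} + ⋯ + i_n)^{-β}` for some `C > 0`, `β ≥ 0`. -/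
def IsBadlyApproximable {k : Type*} [NontriviallyNormedField k] {n : ℕ} (r : ℕ)
    (lam : Fin n → k) : Prop :=
  ∃ C β : ℝ, 0 < C ∧ 0 ≤ β ∧
    ∀ I : Fin n → ℕ, (∀ i : Fin n, (i : ℕ) < r → I i = 0) → 2 ≤ ∑ i, I i →
      ∀ j : Fin n, r ≤ (j : ℕ) →
        C * ((∑ i, I i : ℕ) : ℝ) ^ (-β) ≤ ‖(∏ i, lam i ^ I i) - lam j‖

/-! Near a general fixed point `q` the fixed set is, in suitable coordinates, the coordinate
subspace `S` of the first `r` variables, and `f` is the identity on `S`. Give the variables along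
`S` degree `0` and the transverse ones degree `1` (the grading `y`).

Diagonalization. Along `S` the distinct eigenvalues of `Df` are analytic functions, different from
each other at the centre. By semisimplicity the product of the distinct linear factors annihilates
`Df`, so Lagrange polynomials in `Df` yield left eigenvectors that vary analytically. A chart having
these as the rows of its derivative along `S` makes `Df` diagonal at every point of `S`
(`exists_diagonalizing_chart`). Then `f` is `x_i ↦ lam_i x_i + g_i`, where `lam_i` depends only on
the variables of degree `0` and `g_i` vanishes to second order along `S`.

Newton iteration. A change of coordinates `x_i + h_i` removes the terms of `g` of low order if `h`
solves the homological equation, whose solution divides the coefficients by `lam ^ I - lam_i`. One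
step (`newton_step`) doubles the order `m` of `g` and multiplies the transverse radii by `θ`; terms
of order `m` thereby gain `θ ^ m`, which pays for two divisions. As the divisors are bounded below
by a power of the degree, `θ_j = exp (-c (3/4) ^ j)` suffices at order `2 ^ j`, and the product of
the `θ_j` is positive (`exists_normal_form`). The ultrametric inequality bounds sums and differences
of substitutions without any loss, so no derivatives are estimated and the relative size `ε` of the
error stays fixed while its order grows.

Small divisors. For constant eigenvalues they are controlled by the hypothesis. For a single varying
eigenvalue in characteristic `0`, `‖μ ^ s - 1‖` is at least a multiple of `‖s‖`, hence of a power of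
`1 / s`. On a sufficiently small polydisc, independent of `s`, the series `F ^ s - 1` is dominated
by its constant term `μ ^ s - 1`, so its inverse is controlled as well
(`exists_smallDivisorBound_pow`).

`exists_linearizing_germ` passes from formal to analytic conjugacies, and
`isLinearizedBy_of_smallDivisorBound` composes the charts. -/

section GaussBounds

/-! ### Weighted Gauss norms of power series and their behaviour under substitution. -/

open MvPowerSeries Finsupp

variable {σ : Type*} [Fintype σ] {k : Type*} [NontriviallyNormedField k]

/-- The weighted monomial `w ^ I = ∏ i, w i ^ I i`. -/
noncomputable def weightPow (w : σ → ℝ) (I : σ →₀ ℕ) : ℝ := ∏ i, w i ^ I i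

lemma weightPow_add (w : σ → ℝ) (I J : σ →₀ ℕ) :
    weightPow w (I + J) = weightPow w I * weightPow w J := by
  simp [weightPow, pow_add, Finset.prod_mul_distrib]

lemma weightPow_zero (w : σ → ℝ) : weightPow w 0 = 1 := by simp [weightPow]

lemma weightPow_nonneg {w : σ → ℝ} (hw : ∀ i, 0 < w i) (I : σ →₀ ℕ) : 0 ≤ weightPow w I :=
  Finset.prod_nonneg fun i _ => pow_nonneg (hw i).le _

lemma weightPow_pos {w : σ → ℝ} (hw : ∀ i, 0 < w i) (I : σ →₀ ℕ) : 0 < weightPow w I :=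
  Finset.prod_pos fun i _ => pow_pos (hw i) _

lemma weightPow_single [DecidableEq σ] (w : σ → ℝ) (i : σ) :
    weightPow w (single i 1) = w i := by
  simp [weightPow, Finsupp.single_apply, Finset.prod_ite_eq, pow_ite]

lemma weightPow_mul (v w : σ → ℝ) (I : σ →₀ ℕ) :
    weightPow (fun i => v i * w i) I = weightPow v I * weightPow w I := by
  simp [weightPow, mul_pow, Finset.prod_mul_distrib]

lemma weight_eq_sum_mul (y : σ → ℕ) (I : σ →₀ ℕ) : weight y I = ∑ i, I i * y i := by
  simp [Finsupp.weight_eq_sum]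

lemma weightPow_scale (w : σ → ℝ) (y : σ → ℕ) (θ : ℝ) (I : σ →₀ ℕ) :
    weightPow (fun i => w i * θ ^ y i) I = weightPow w I * θ ^ weight y I := by
  rw [weightPow_mul, weight_eq_sum_mul, ← Finset.prod_pow_eq_pow_sum]
  simp only [weightPow, ← pow_mul, mul_comm]

/-- `F` has order at least `m` with respect to the grading `y`, and its Gauss norm with respect to
the polyradius `w` is at most `M`. -/
def GaussLE (y : σ → ℕ) (w : σ → ℝ) (M : ℝ) (m : ℕ) (F : MvPowerSeries σ k) : Prop :=
  ∀ I, (weight y I < m → coeff I F = 0) ∧ ‖coeff I F‖ * weightPow w I ≤ M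

namespace GaussLE

variable {y : σ → ℕ} {w v : σ → ℝ} {M M' : ℝ} {m m' : ℕ} {F H : MvPowerSeries σ k}

lemma nonneg (hw : ∀ i, 0 < w i) (h : GaussLE y w M m F) : 0 ≤ M :=
  le_trans (mul_nonneg (norm_nonneg _) (weightPow_nonneg hw 0)) (h 0).2

lemma mono (h : GaussLE y w M m F) (hM : M ≤ M') (hm : m' ≤ m) : GaussLE y w M' m' F :=
  fun I => ⟨fun hI => (h I).1 (hI.trans_le hm), (h I).2.trans hM⟩

lemma zero (hM : 0 ≤ M) : GaussLE y w M m (0 : MvPowerSeries σ k) := fun I => by simp [hM]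

lemma neg (h : GaussLE y w M m F) : GaussLE y w M m (-F) := fun I => by
  simpa using h I

/-- Only the variables of positive degree are shrunk, and a monomial of weight at least `m` gains at
least `θ ^ m`. This gain is what compensates the small divisors. -/
lemma scale (hw : ∀ i, 0 < w i) (h : GaussLE y w M m F) {θ : ℝ} (h0 : 0 < θ) (h1 : θ ≤ 1) :
    GaussLE y (fun i => w i * θ ^ y i) (θ ^ m * M) m F := by
  intro I
  refine ⟨(h I).1, ?_⟩
  rw [weightPow_scale]
  have hM := h.nonneg hw
  by_cases hI : weight y I < m
  · rw [(h I).1 hI]; simp; positivity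
  · have h2 : θ ^ weight y I ≤ θ ^ m := pow_le_pow_of_le_one h0.le h1 (not_lt.mp hI)
    calc ‖coeff I F‖ * (weightPow w I * θ ^ weight y I)
        = θ ^ weight y I * (‖coeff I F‖ * weightPow w I) := by ring
      _ ≤ θ ^ m * M := mul_le_mul h2 (h I).2
          (mul_nonneg (norm_nonneg _) (weightPow_nonneg hw I)) (by positivity)

lemma one : GaussLE y w 1 0 (1 : MvPowerSeries σ k) := by
  classical
  intro I
  refine ⟨fun h => by simp at h, ?_⟩
  rw [coeff_one]
  split_ifs with h
  · simp [h, weightPow_zero]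
  · simp

lemma X (hw : ∀ i, 0 < w i) (i : σ) : GaussLE y w (w i) (y i) (X i : MvPowerSeries σ k) := by
  classical
  intro I
  rw [coeff_X]
  split_ifs with h
  · subst h
    refine ⟨fun h => ?_, by simp [weightPow_single]⟩
    simp [Finsupp.weight_single] at h
  · simp [(hw i).le]

variable [IsUltrametricDist k]

lemma add (h : GaussLE y w M m F) (h' : GaussLE y w M m H) (hw : ∀ i, 0 < w i) :
    GaussLE y w M m (F + H) := by
  intro I
  refine ⟨fun hI => by simp [(h I).1 hI, (h' I).1 hI], ?_⟩
  rw [map_add]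
  rcases le_max_iff.mp (IsUltrametricDist.norm_add_le_max (coeff I F) (coeff I H)) with h1 | h1
  · exact (mul_le_mul_of_nonneg_right h1 (weightPow_nonneg hw I)).trans (h I).2
  · exact (mul_le_mul_of_nonneg_right h1 (weightPow_nonneg hw I)).trans (h' I).2

lemma sub (h : GaussLE y w M m F) (h' : GaussLE y w M m H) (hw : ∀ i, 0 < w i) :
    GaussLE y w M m (F - H) := by
  rw [sub_eq_add_neg]; exact h.add h'.neg hw

lemma sum {ι : Type*} {s : Finset ι} {f : ι → MvPowerSeries σ k} (hw : ∀ i, 0 < w i)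
    (hM : 0 ≤ M) (h : ∀ i ∈ s, GaussLE y w M m (f i)) : GaussLE y w M m (∑ i ∈ s, f i) := by
  classical
  induction s using Finset.induction_on with
  | empty => simpa using zero hM
  | insert a s ha ih =>
    rw [Finset.sum_insert ha]
    exact (h _ (by simp)).add (ih fun i hi => h i (by simp [hi])) hw

omit [Fintype σ] in
lemma norm_coeff_mul_le [DecidableEq σ] {F H : MvPowerSeries σ k} {I : σ →₀ ℕ} {c : ℝ} (hc : 0 ≤ c)
    (h : ∀ a b, a + b = I → ‖coeff a F * coeff b H‖ ≤ c) : ‖coeff I (F * H)‖ ≤ c := by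
  rw [coeff_mul]
  refine IsUltrametricDist.norm_sum_le_of_forall_le_of_nonneg hc fun p hp => ?_
  exact h _ _ (Finset.HasAntidiagonal.mem_antidiagonal.mp hp)

lemma mul (hw : ∀ i, 0 < w i) (h : GaussLE y w M m F) (h' : GaussLE y w M' m' H) :
    GaussLE y w (M * M') (m + m') (F * H) := by
  classical
  intro I
  constructor
  · intro hI
    rw [coeff_mul]
    refine Finset.sum_eq_zero fun p hp => ?_
    have hp := Finset.HasAntidiagonal.mem_antidiagonal.mp hp
    rw [← hp, map_add] at hI
    by_cases h1 : weight y p.1 < m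
    · rw [(h _).1 h1, zero_mul]
    · rw [(h' p.2).1 (by omega), mul_zero]
  · have hpos := weightPow_pos hw I
    have := h.nonneg hw
    have := h'.nonneg hw
    rw [← le_div_iff₀ hpos]
    refine norm_coeff_mul_le (by positivity) fun a b hab => ?_
    rw [le_div_iff₀ hpos, ← hab, weightPow_add, norm_mul]
    calc _ = (‖coeff a F‖ * weightPow w a) * (‖coeff b H‖ * weightPow w b) := by ring
      _ ≤ _ := mul_le_mul (h a).2 (h' b).2
          (mul_nonneg (norm_nonneg _) (weightPow_nonneg hw b)) (by positivity)

omit [IsUltrametricDist k] in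
lemma C_mul (c : k) (h : GaussLE y w M m F) : GaussLE y w (‖c‖ * M) m (C c * F) := by
  intro I
  refine ⟨fun hI => by simp [(h I).1 hI], ?_⟩
  simp only [coeff_C_mul, norm_mul, mul_assoc]
  exact mul_le_mul_of_nonneg_left (h I).2 (norm_nonneg _)

end GaussLE

/-- `p` and `q` obey the same Gauss bound `P` and order bound `m`, and their difference is smaller
by the factor `ε` and of order larger by `s`. -/
structure GaussClose (y : σ → ℕ) (w : σ → ℝ) (P ε : ℝ) (m s : ℕ) (p q : MvPowerSeries σ k) :
    Prop where
  left : GaussLE y w P m p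
  right : GaussLE y w P m q
  diff : GaussLE y w (ε * P) (m + s) (p - q)

namespace GaussClose

variable [IsUltrametricDist k] {y : σ → ℕ} {w v : σ → ℝ} {P P' ε : ℝ} {m m' s : ℕ}
  {p q p' q' : MvPowerSeries σ k}

omit [IsUltrametricDist k] in
lemma one (hε : 0 ≤ ε) : GaussClose y w 1 ε 0 s
    (1 : MvPowerSeries σ k) 1 :=
  ⟨.one, .one, by rw [sub_self]; exact .zero (by positivity)⟩

/-- From `p p' - q q' = p (p' - q') + (p - q) q'`. The ultrametric inequality keeps the same factor
`ε`, so it does not deteriorate with the number of factors. -/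
lemma mul (hw : ∀ i, 0 < w i) (h : GaussClose y w P ε m s p q)
    (h' : GaussClose y w P' ε m' s p' q') :
    GaussClose y w (P * P') ε (m + m') s (p * p') (q * q') := by
  refine ⟨h.left.mul hw h'.left, h.right.mul hw h'.right, ?_⟩
  have e : p * p' - q * q' = p * (p' - q') + (p - q) * q' := by ring
  rw [e]
  refine GaussLE.add ((h.left.mul hw h'.diff).mono ?_ ?_) ((h.diff.mul hw h'.right).mono ?_ ?_) hw
  · exact le_of_eq (by ring)
  · omega
  · exact le_of_eq (by ring)
  · omega

lemma pow (hw : ∀ i, 0 < w i) (hε : 0 ≤ ε) (h : GaussClose y w P ε m s p q) (n : ℕ) :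
    GaussClose y w (P ^ n) ε (n * m) s (p ^ n) (q ^ n) := by
  induction n with
  | zero => simpa using one hε
  | succ n ih =>
    have := ih.mul hw h
    rwa [← pow_succ, ← pow_succ, ← pow_succ, ← Nat.succ_mul] at this

lemma prod (hw : ∀ i, 0 < w i) (hε : 0 ≤ ε) {ι : Type*} (t : Finset ι) {P : ι → ℝ} {m : ι → ℕ}
    {p q : ι → MvPowerSeries σ k} (h : ∀ i ∈ t, GaussClose y w (P i) ε (m i) s (p i) (q i)) :
    GaussClose y w (∏ i ∈ t, P i) ε (∑ i ∈ t, m i) s (∏ i ∈ t, p i) (∏ i ∈ t, q i) := by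
  classical
  induction t using Finset.induction_on with
  | empty => simpa using one hε
  | insert a t ha ih =>
    rw [Finset.prod_insert ha, Finset.prod_insert ha, Finset.prod_insert ha, Finset.sum_insert ha]
    exact (h _ (by simp)).mul hw (ih fun i hi => h i (by simp [hi]))

lemma finsuppProd (hw : ∀ i, 0 < w i) (hε : 0 ≤ ε) {a b : σ → MvPowerSeries σ k}
    (h : ∀ i, GaussClose y w (v i) ε (y i) s (a i) (b i)) (I : σ →₀ ℕ) :
    GaussClose y w (weightPow v I) ε (weight y I) s
      (I.prod fun i e => a i ^ e) (I.prod fun i e => b i ^ e) := by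
  have e (c : σ → MvPowerSeries σ k) : (I.prod fun i e => c i ^ e) = ∏ i, c i ^ I i :=
    Finsupp.prod_fintype _ _ (by simp)
  rw [e, e, weight_eq_sum_mul, weightPow]
  exact prod hw hε _ fun i _ => (h i).pow hw hε (I i)

/-- All monomials in `a` and `b` are close with one and the same `ε`, and an ultrametric sum over
the monomials of `F` preserves this. -/
lemma subst (hw : ∀ i, 0 < w i) (hε : 0 ≤ ε) {a b : σ → MvPowerSeries σ k}
    (ha : HasSubst a) (hb : HasSubst b)
    (h : ∀ i, GaussClose y w (v i) ε (y i) s (a i) (b i)) {M : ℝ} {F : MvPowerSeries σ k}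
    (hM : 0 ≤ M) (hF : GaussLE y v M m F) :
    GaussClose y w M ε m s (subst a F) (subst b F) := by
  -- One estimate for three uses: `ε' = 1`, `s' = 0` for each of the two substitutions, `ε' = ε`,
  -- `s' = s` for their difference.
  have key : ∀ {c : (σ →₀ ℕ) → MvPowerSeries σ k} {ε' : ℝ} {s' : ℕ}, 0 ≤ ε' →
      (∀ I, GaussLE y w (ε' * weightPow v I) (weight y I + s') (c I)) → ∀ e,
      (weight y e < m + s' → ∑ᶠ d, coeff d F • coeff e (c d) = 0) ∧
        ‖∑ᶠ d, coeff d F • coeff e (c d)‖ * weightPow w e ≤ ε' * M := by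
    intro c ε' s' hε' hc e
    constructor
    · intro he
      refine finsum_eq_zero_of_forall_eq_zero fun d => ?_
      by_cases hd : weight y d < m
      · simp [(hF d).1 hd]
      · simp [(hc d e).1 (by omega)]
    · refine finsum_induction (fun z : k => ‖z‖ * weightPow w e ≤ ε' * M)
        (by simp; positivity) ?_ ?_
      · intro z z' hz hz'
        rcases le_max_iff.mp (IsUltrametricDist.norm_add_le_max z z') with h1 | h1
        · exact (mul_le_mul_of_nonneg_right h1 (weightPow_nonneg hw _)).trans hz
        · exact (mul_le_mul_of_nonneg_right h1 (weightPow_nonneg hw _)).trans hz'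
      · intro d
        rw [smul_eq_mul, norm_mul, mul_assoc]
        calc ‖coeff d F‖ * (‖coeff e (c d)‖ * weightPow w e)
            ≤ ‖coeff d F‖ * (ε' * weightPow v d) :=
              mul_le_mul_of_nonneg_left (hc d e).2 (norm_nonneg _)
          _ = ε' * (‖coeff d F‖ * weightPow v d) := by ring
          _ ≤ ε' * M := mul_le_mul_of_nonneg_left (hF d).2 hε'
  have hp := finsuppProd hw hε h
  refine ⟨fun e => ?_, fun e => ?_, fun e => ?_⟩
  · rw [coeff_subst ha]
    simpa using key (s' := 0) zero_le_one (fun I => by simpa using (hp I).left) e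
  · rw [coeff_subst hb]
    simpa using key (s' := 0) zero_le_one (fun I => by simpa using (hp I).right) e
  · rw [map_sub, coeff_subst ha, coeff_subst hb,
      ← finsum_sub_distrib (coeff_subst_finite ha F e) (coeff_subst_finite hb F e)]
    simpa only [map_sub, smul_sub] using key hε (fun I => (hp I).diff) e

end GaussClose

variable [IsUltrametricDist k] {y : σ → ℕ} {w v : σ → ℝ} {M : ℝ} {m : ℕ}

lemma GaussLE.subst (hw : ∀ i, 0 < w i) {a : σ → MvPowerSeries σ k} (ha : HasSubst a)
    (h : ∀ i, GaussLE y w (v i) (y i) (a i)) {F : MvPowerSeries σ k} (hM : 0 ≤ M)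
    (hF : GaussLE y v M m F) : GaussLE y w M m (subst a F) :=
  (GaussClose.subst (ε := 0) (s := 0) hw le_rfl ha ha
    (fun i => ⟨h i, h i, by rw [sub_self]; exact .zero (by simp)⟩) hM hF).left

/-- Plays the role of the mean value inequality: `F` is Lipschitz with respect to relative
perturbations of its arguments, with no loss of radius. -/
lemma GaussLE.subst_sub (hw : ∀ i, 0 < w i) {ε : ℝ} (hε : 0 ≤ ε) {s : ℕ}
    {a b : σ → MvPowerSeries σ k} (ha : HasSubst a) (hb : HasSubst b)
    (h : ∀ i, GaussLE y w (v i) (y i) (a i)) (h' : ∀ i, GaussLE y w (v i) (y i) (b i))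
    (hd : ∀ i, GaussLE y w (ε * v i) (y i + s) (a i - b i)) {F : MvPowerSeries σ k} (hM : 0 ≤ M)
    (hF : GaussLE y v M m F) :
    GaussLE y w (ε * M) (m + s) (MvPowerSeries.subst a F - MvPowerSeries.subst b F) :=
  (GaussClose.subst hw hε ha hb (fun i => ⟨h i, h' i, hd i⟩) hM hF).diff

/-- A substitution that differs from the identity by terms of larger order is surjective, with
control of the Gauss norm. -/
lemma exists_subst_X_add_eq (hw : ∀ i, 0 < w i) {h : σ → MvPowerSeries σ k} {s : ℕ} (hs : 1 ≤ s)
    (hh : ∀ i, GaussLE y w (w i) (y i + s) (h i)) (h0 : ∀ i, constantCoeff (h i) = 0)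
    {e : MvPowerSeries σ k} (he : GaussLE y w M m e) :
    ∃ g : MvPowerSeries σ k, GaussLE y w M m g ∧ subst (fun i => X i + h i) g = e := by
  have hM := he.nonneg hw
  have hS : HasSubst (fun i => X i + h i) :=
    hasSubst_of_constantCoeff_zero fun i => by simp [h0 i]
  have hXh : ∀ i, GaussLE y w (w i) (y i) (X i + h i) := fun i =>
    (GaussLE.X hw i).add ((hh i).mono le_rfl (by omega)) hw
  -- Neumann series: `u j` is the `j`-th iterate of the identity minus the substitution, applied to
  -- `e`. Each iteration raises the order by at least `1`.
  let u : ℕ → MvPowerSeries σ k := fun j => Nat.rec e (fun _ f => f - subst (fun i => X i + h i) f) j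
  have u_succ : ∀ j, u (j + 1) = u j - subst (fun i => X i + h i) (u j) := fun j => rfl
  have hu : ∀ j, GaussLE y w M (m + j) (u j) := by
    intro j
    induction j with
    | zero => exact he
    | succ j ih =>
      rw [u_succ]
      have := GaussLE.subst_sub (s := s) (ε := 1) hw zero_le_one HasSubst.X hS (GaussLE.X hw) hXh
        (fun i => by simpa using (hh i).neg) hM ih
      rw [subst_self, id, one_mul] at this
      exact this.mono le_rfl (by omega)
  -- The sum of all `u j`; those with `j > weight y I` have order too large to contribute to the
  -- coefficient at `I`.
  let g : MvPowerSeries σ k := fun I => coeff I (∑ j ∈ Finset.range (weight y I + 1), u j)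
  have hg : ∀ I, coeff I g = coeff I (∑ j ∈ Finset.range (weight y I + 1), u j) := fun I => rfl
  have hpart : ∀ N, GaussLE y w M m (∑ j ∈ Finset.range N, u j) := fun N =>
    GaussLE.sum hw hM fun j _ => (hu j).mono le_rfl (by omega)
  have hgle : GaussLE y w M m g := fun I => by
    rw [hg]; exact hpart _ I
  have hgN : ∀ N, GaussLE y w M N (g - ∑ j ∈ Finset.range N, u j) := by
    intro N I
    refine ⟨fun hI => ?_, ((hgle.sub (hpart N) hw) I).2⟩
    rw [map_sub, hg, sub_eq_zero]
    have hsplit := Finset.sum_range_add_sum_Ico u (show weight y I + 1 ≤ N by omega)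
    rw [← hsplit, map_add, left_eq_add, map_sum]
    refine Finset.sum_eq_zero fun j hj => ((hu j) I).1 ?_
    have := (Finset.mem_Ico.mp hj).1
    omega
  refine ⟨g, hgle, ?_⟩
  have htel : ∀ N, subst (fun i => X i + h i) (∑ j ∈ Finset.range N, u j) = e - u N := by
    intro N
    have e1 : subst (fun i => X i + h i) (∑ j ∈ Finset.range N, u j)
        = ∑ j ∈ Finset.range N, (u j - u (j + 1)) := by
      rw [← coe_substAlgHom hS, map_sum]
      refine Finset.sum_congr rfl fun j _ => ?_
      rw [u_succ, coe_substAlgHom]; ring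
    exact e1.trans (Finset.sum_range_sub' u N)
  ext I
  have h1 := GaussLE.subst hw hS hXh hM (hgN (weight y I + 1))
  rw [subst_sub hS, htel] at h1
  have h2 := (h1 I).1 (Nat.lt_succ_self _)
  have h3 := (hu (weight y I + 1) I).1 (by omega)
  rw [map_sub, map_sub, h3, sub_zero, sub_eq_zero] at h2
  exact h2

end GaussBounds

/-! ### The homological equation and one step of the Newton iteration. -/

section Newton

open MvPowerSeries Finsupp

variable {σ : Type*} [Fintype σ] {k : Type*} [NontriviallyNormedField k]

/-- The power series that only involve the variables of degree `0` for the grading `y`. -/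
def paramSubring (k : Type*) [NontriviallyNormedField k] (y : σ → ℕ) :
    Subring (MvPowerSeries σ k) where
  carrier := {F | ∀ I, weight y I ≠ 0 → coeff I F = 0}
  mul_mem' := by
    classical
    intro F H hF hH I hI
    rw [coeff_mul]
    refine Finset.sum_eq_zero fun p hp => ?_
    rw [← Finset.HasAntidiagonal.mem_antidiagonal.mp hp, map_add] at hI
    by_cases h1 : weight y p.1 = 0
    · rw [hH p.2 (by omega), mul_zero]
    · rw [hF p.1 h1, zero_mul]
  one_mem' := by
    classical
    intro I hI
    rw [coeff_one, if_neg]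
    rintro rfl
    simp at hI
  add_mem' := fun hF hH I hI => by rw [map_add, hF I hI, hH I hI, add_zero]
  zero_mem' := fun I _ => by simp
  neg_mem' := fun hF I hI => by rw [map_neg, hF I hI, neg_zero]

variable {y : σ → ℕ}

omit [Fintype σ] in
lemma mem_paramSubring {F : MvPowerSeries σ k} :
    F ∈ paramSubring k y ↔ ∀ I, weight y I ≠ 0 → coeff I F = 0 := Iff.rfl

omit [Fintype σ] in
lemma eq_of_add_eq_of_weight_eq_zero {a b e : σ →₀ ℕ} (h : a + b = e) (ha : weight y a = 0)
    {i : σ} (hi : y i ≠ 0) : b i = e i := by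
  have h1 : a i ≤ weight y a := Finsupp.le_weight y hi a
  rw [← h, Finsupp.add_apply]
  omega

lemma weight_congr {b e : σ →₀ ℕ} (h : ∀ i, y i ≠ 0 → b i = e i) : weight y b = weight y e := by
  rw [weight_eq_sum_mul, weight_eq_sum_mul]
  refine Finset.sum_congr rfl fun i _ => ?_
  by_cases hi : y i = 0
  · simp [hi]
  · rw [h i hi]

omit [Fintype σ] in
/-- Multiplication by a series in the variables of degree `0` is local in the other variables. -/
lemma coeff_param_mul_congr {A h h' : MvPowerSeries σ k} (hA : A ∈ paramSubring k y)
    {e : σ →₀ ℕ} (hh : ∀ b, (∀ i, y i ≠ 0 → b i = e i) → coeff b h = coeff b h') :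
    coeff e (A * h) = coeff e (A * h') := by
  classical
  rw [coeff_mul, coeff_mul]
  refine Finset.sum_congr rfl fun p hp => ?_
  have hp := Finset.HasAntidiagonal.mem_antidiagonal.mp hp
  by_cases h1 : weight y p.1 = 0
  · rw [hh p.2 fun i hi => eq_of_add_eq_of_weight_eq_zero hp h1 hi]
  · rw [hA _ h1, zero_mul, zero_mul]

/-- The product `lam ^ I`. -/
noncomputable def lamPow (lam : σ → MvPowerSeries σ k) (I : σ →₀ ℕ) : MvPowerSeries σ k :=
  ∏ i, lam i ^ I i

lemma lamPow_mem {lam : σ → MvPowerSeries σ k} (hlam : ∀ i, lam i ∈ paramSubring k y)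
    (I : σ →₀ ℕ) : lamPow lam I ∈ paramSubring k y :=
  Subring.prod_mem _ fun i _ => Subring.pow_mem _ (hlam i) _

lemma lamPow_congr {lam : σ → MvPowerSeries σ k} (hone : ∀ i, y i = 0 → lam i = 1)
    {b e : σ →₀ ℕ} (h : ∀ i, y i ≠ 0 → b i = e i) : lamPow lam b = lamPow lam e := by
  refine Finset.prod_congr rfl fun i _ => ?_
  by_cases hi : y i = 0
  · rw [hone i hi, one_pow, one_pow]
  · rw [h i hi]

omit [Fintype σ] in
-- Puts a product into the shape of the formula for coefficients of a substitution, so that the two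
-- can be compared term by term.
lemma coeff_mul_eq_finsum [DecidableEq σ] (P h : MvPowerSeries σ k) (e : σ →₀ ℕ) :
    coeff e (P * h) = ∑ᶠ d, coeff d h • coeff e (P * monomial d 1) := by
  have hs : (Function.support fun d => coeff d h • coeff e (P * monomial d (1 : k))) ⊆
      ↑(Finset.Iic e) := by
    intro d hd
    simp only [Function.mem_support, coeff_mul_monomial, smul_eq_mul] at hd
    by_contra hde
    simp only [Finset.coe_Iic, Set.mem_Iic] at hde
    simp [hde] at hd
  rw [finsum_eq_sum_of_support_subset _ hs, coeff_mul]
  refine Finset.sum_bij' (fun p _ => p.2) (fun d _ => (e - d, d)) ?_ ?_ ?_ ?_ ?_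
  · intro p hp
    rw [Finset.mem_Iic, ← Finset.HasAntidiagonal.mem_antidiagonal.mp hp]
    exact le_add_self
  · intro d hd
    rw [Finset.HasAntidiagonal.mem_antidiagonal]
    exact tsub_add_cancel_of_le (Finset.mem_Iic.mp hd)
  · intro p hp
    rw [← Finset.HasAntidiagonal.mem_antidiagonal.mp hp]
    simp
  · intro d hd; rfl
  · intro p hp
    have hp := Finset.HasAntidiagonal.mem_antidiagonal.mp hp
    rw [coeff_mul_monomial, if_pos (by rw [← hp]; exact le_add_self), ← hp]
    simp [mul_comm]

lemma hasSubst_lam_mul_X (lam : σ → MvPowerSeries σ k) : HasSubst fun i => lam i * X i :=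
  hasSubst_of_constantCoeff_zero fun i => by simp

/-- The substitution `x_i ↦ lam_i x_i` acts on monomials as multiplication by `lam ^ I`. -/
lemma coeff_subst_lam_mul_X {lam : σ → MvPowerSeries σ k} (hlam : ∀ i, lam i ∈ paramSubring k y)
    (hone : ∀ i, y i = 0 → lam i = 1) (h : MvPowerSeries σ k) (e : σ →₀ ℕ) :
    coeff e (subst (fun i => lam i * X i) h) = coeff e (lamPow lam e * h) := by
  classical
  rw [coeff_subst (hasSubst_lam_mul_X lam), coeff_mul_eq_finsum]
  refine finsum_congr fun d => ?_
  have e1 : (d.prod fun i n => (lam i * X i) ^ n) = lamPow lam d * monomial d (1 : k) := by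
    rw [monomial_one_eq, Finsupp.prod_fintype _ _ (by simp), Finsupp.prod_fintype _ _ (by simp),
      lamPow, ← Finset.prod_mul_distrib]
    simp [mul_pow]
  rw [e1, coeff_mul_monomial, coeff_mul_monomial]
  split_ifs with hde
  -- The term at `d` involves the coefficient of `lam ^ d` at `e - d`. It vanishes unless `e - d`
  -- has weight zero, in which case `d` and `e` have the same transverse exponents and `lam ^ d =
  -- lam ^ e`.
  · by_cases h0 : weight y (e - d) = 0
    · rw [lamPow_congr hone fun i hi =>
        eq_of_add_eq_of_weight_eq_zero (tsub_add_cancel_of_le hde) h0 hi]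
    · rw [lamPow_mem hlam _ _ h0, lamPow_mem hlam _ _ h0]
  · rfl

omit [Fintype σ] in
-- Monomials with nonzero coefficient contain only variables of degree `0`. Hence a change of
-- coordinates affects `lam` only through its components of degree `0`.
lemma subst_congr_of_mem_paramSubring {F : MvPowerSeries σ k} (hF : F ∈ paramSubring k y)
    {a b : σ → MvPowerSeries σ k} (ha : HasSubst a) (hb : HasSubst b)
    (hab : ∀ i, y i = 0 → a i = b i) : subst a F = subst b F := by
  ext e
  rw [coeff_subst ha, coeff_subst hb]
  refine finsum_congr fun d => ?_
  by_cases hd : weight y d = 0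
  · congr 2
    refine Finsupp.prod_congr fun i hi => ?_
    rw [hab i]
    by_contra h
    have := Finsupp.le_weight y h d
    have := Finsupp.mem_support_iff.mp hi
    omega
  · rw [hF d hd, zero_smul, zero_smul]

/-- The solution of the homological equation for the multiplier `c`, in the degrees from `lo` to
`hi - 1`. -/
noncomputable def homologicalSol (y : σ → ℕ) (lam : σ → MvPowerSeries σ k) (c : MvPowerSeries σ k)
    (lo hi : ℕ) (F : MvPowerSeries σ k) : MvPowerSeries σ k :=
  fun e => if lo ≤ weight y e ∧ weight y e < hi then -coeff e ((lamPow lam e - c)⁻¹ * F) else 0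

lemma coeff_homologicalSol (lam : σ → MvPowerSeries σ k) (c : MvPowerSeries σ k)
    (lo hi : ℕ) (F : MvPowerSeries σ k) (e : σ →₀ ℕ) :
    coeff e (homologicalSol y lam c lo hi F) =
      if lo ≤ weight y e ∧ weight y e < hi then -coeff e ((lamPow lam e - c)⁻¹ * F) else 0 := rfl

/-- The divisor `lam ^ e - c` depends on `e` only through the transverse exponents, which
multiplication by series in the parameters preserves. The equation thus splits into blocks with
fixed transverse exponents, each solved by inverting a single series. -/
lemma coeff_homological_eq {lam : σ → MvPowerSeries σ k} (hlam : ∀ i, lam i ∈ paramSubring k y)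
    (hone : ∀ i, y i = 0 → lam i = 1) {c : MvPowerSeries σ k} (hc : c ∈ paramSubring k y)
    {lo hi : ℕ} (hdiv : ∀ I, lo ≤ weight y I → constantCoeff (lamPow lam I - c) ≠ 0)
    (F : MvPowerSeries σ k) (e : σ →₀ ℕ) :
    coeff e (subst (fun i => lam i * X i) (homologicalSol y lam c lo hi F)
      - c * homologicalSol y lam c lo hi F) =
        if lo ≤ weight y e ∧ weight y e < hi then -coeff e F else 0 := by
  have hmem : lamPow lam e - c ∈ paramSubring k y := Subring.sub_mem _ (lamPow_mem hlam e) hc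
  rw [map_sub, coeff_subst_lam_mul_X hlam hone, ← map_sub, ← sub_mul]
  split_ifs with h
  · have e1 : coeff e ((lamPow lam e - c) * homologicalSol y lam c lo hi F) =
        coeff e ((lamPow lam e - c) * -((lamPow lam e - c)⁻¹ * F)) := by
      refine coeff_param_mul_congr hmem fun b hb => ?_
      rw [coeff_homologicalSol, weight_congr hb, if_pos h, lamPow_congr hone hb, map_neg]
    rw [e1, mul_neg, ← mul_assoc, MvPowerSeries.mul_inv_cancel _ (hdiv e h.1), one_mul, map_neg]
  · have e1 : coeff e ((lamPow lam e - c) * homologicalSol y lam c lo hi F) =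
        coeff e ((lamPow lam e - c) * 0) := by
      refine coeff_param_mul_congr hmem fun b hb => ?_
      rw [coeff_homologicalSol, weight_congr hb, if_neg h, map_zero]
    rw [e1, mul_zero, map_zero]

variable [IsUltrametricDist k]

/-- The small divisor condition: the divisors `lam ^ I - lam_i` are invertible for
`|I| > y i`, with inverses bounded by `B |I|`, also after multiplication by `L ^ I`. -/
def SmallDivisorBound (y : σ → ℕ) (w L : σ → ℝ) (lam : σ → MvPowerSeries σ k) (B : ℕ → ℝ) : Prop :=
  ∀ i I, y i + 1 ≤ weight y I → constantCoeff (lamPow lam I - lam i) ≠ 0 ∧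
    ∀ e, ‖coeff e (lamPow lam I - lam i)⁻¹‖ * weightPow w e * max 1 (weightPow L I)
      ≤ B (weight y I)

omit [IsUltrametricDist k] in
lemma SmallDivisorBound.scale {w L : σ → ℝ} {lam : σ → MvPowerSeries σ k} {B : ℕ → ℝ}
    (hw : ∀ i, 0 < w i) (h : SmallDivisorBound y w L lam B) {θ : ℝ} (h0 : 0 < θ) (h1 : θ ≤ 1) :
    SmallDivisorBound y (fun i => w i * θ ^ y i) L lam B := by
  refine fun i I hI => ⟨(h i I hI).1, fun e => le_trans ?_ ((h i I hI).2 e)⟩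
  rw [weightPow_scale]
  have := weightPow_pos hw e
  have h2 : weightPow w e * θ ^ weight y e ≤ weightPow w e :=
    mul_le_of_le_one_right this.le (pow_le_one₀ h0.le h1)
  gcongr

/-- The second bound, on the polyradius `L w`, is the purpose of the factor `max 1 (L ^ I)` in
`SmallDivisorBound`: the solution is later evaluated at `lam_j x_j`, of Gauss norm up to `L_j w_j`,
and `L_j` may exceed `1`. -/
lemma GaussLE.homologicalSol {w L : σ → ℝ} {lam : σ → MvPowerSeries σ k} {B : ℕ → ℝ}
    (hw : ∀ i, 0 < w i) (hdiv : SmallDivisorBound y w L lam B) {i : σ}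
    {lo hi : ℕ} (hlo : y i + 1 ≤ lo) {b M : ℝ} (hb0 : 0 ≤ b) (hb : ∀ s < hi, B s ≤ b)
    {F : MvPowerSeries σ k} (hF : GaussLE y w M lo F) :
    GaussLE y w (b * M) lo (homologicalSol y lam (lam i) lo hi F) ∧
      GaussLE y (fun j => L j * w j) (b * M) lo (_root_.homologicalSol y lam (lam i) lo hi F) := by
  classical
  have hM := hF.nonneg hw
  have key : ∀ e, (weight y e < lo → coeff e (_root_.homologicalSol y lam (lam i) lo hi F) = 0) ∧
      ‖coeff e (_root_.homologicalSol y lam (lam i) lo hi F)‖ * weightPow w e *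
        max 1 (weightPow L e) ≤ b * M := by
    intro e
    rw [coeff_homologicalSol]
    refine ⟨fun he => if_neg (by omega), ?_⟩
    split_ifs with h
    · have hmax : 0 < max 1 (weightPow L e) := by positivity
      have hwe := weightPow_pos hw e
      rw [norm_neg, mul_assoc, ← le_div_iff₀ (by positivity)]
      refine GaussLE.norm_coeff_mul_le (by positivity) fun a c hac => ?_
      rw [le_div_iff₀ (by positivity), norm_mul, ← hac, weightPow_add]
      calc _ = (‖coeff a (lamPow lam e - lam i)⁻¹‖ * weightPow w a * max 1 (weightPow L e)) *
              (‖coeff c F‖ * weightPow w c) := by rw [hac]; ring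
        _ ≤ b * M := mul_le_mul (((hdiv i e (hlo.trans h.1)).2 a).trans (hb _ h.2)) (hF c).2
            (mul_nonneg (norm_nonneg _) (weightPow_nonneg hw c)) hb0
    · simp; positivity
  refine ⟨fun e => ⟨(key e).1, le_trans ?_ (key e).2⟩, fun e => ⟨(key e).1, le_trans ?_ (key e).2⟩⟩
  · exact le_mul_of_one_le_right (mul_nonneg (norm_nonneg _) (weightPow_nonneg hw e))
      (le_max_left _ _)
  · rw [weightPow_mul, mul_comm (weightPow L e), ← mul_assoc]
    exact mul_le_mul_of_nonneg_left (le_max_right _ _)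
      (mul_nonneg (norm_nonneg _) (weightPow_nonneg hw e))

omit [IsUltrametricDist k] in
lemma GaussLE.constantCoeff_eq_zero {w : σ → ℝ} {M : ℝ} {m : ℕ} {F : MvPowerSeries σ k}
    (h : GaussLE y w M m F) (hm : 1 ≤ m) : constantCoeff F = 0 := by
  rw [← coeff_zero_eq_constantCoeff_apply]
  exact (h 0).1 (by rw [map_zero]; exact hm)

/-- One step of the Newton iteration: the order of the deviation `g` from the normal form
`x_i ↦ lam_i x_i` is doubled, at the cost of shrinking the polyradius by `θ`. -/
theorem newton_step {w L : σ → ℝ} {lam g : σ → MvPowerSeries σ k} {B : ℕ → ℝ}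
    (hw : ∀ i, 0 < w i) (hL : ∀ i, 0 < L i) (hlam : ∀ i, lam i ∈ paramSubring k y)
    (hone : ∀ i, y i = 0 → lam i = 1) (hlamL : ∀ i, GaussLE y w (L i) 0 (lam i))
    (hdiv : SmallDivisorBound y w L lam B) {ε Λ θ b : ℝ} {m : ℕ} (hm : 1 ≤ m)
    (hε : 0 < ε) (hε1 : ε ≤ 1) (hΛ : 1 ≤ Λ) (hLΛ : ∀ i, L i ≤ Λ) (hεL : ∀ i, ε ≤ L i)
    (hεΛ : ε * Λ ≤ 1) (hθ : 0 < θ) (hθ1 : θ ≤ 1) (hb1 : 1 ≤ b)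
    (hb : ∀ i, ∀ s < y i + 2 * m, B s ≤ b) (hbθ : b * b * Λ * θ ^ m ≤ 1)
    (hg : ∀ i, GaussLE y w (ε * w i) (y i + m) (g i)) :
    ∃ h g' : σ → MvPowerSeries σ k,
      (∀ i, GaussLE y (fun j => w j * θ ^ y j) (ε * (w i * θ ^ y i)) (y i + m) (h i)) ∧
      (∀ i, GaussLE y (fun j => w j * θ ^ y j) (ε * (w i * θ ^ y i)) (y i + 2 * m) (g' i)) ∧
      ∀ i, subst (fun j => lam j * X j + g j) (X i + h i) =
        subst (fun j => X j + h j) (lam i * X i + g' i) := by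
  set w' : σ → ℝ := fun j => w j * θ ^ y j with hw'_def
  have hw' : ∀ i, 0 < w' i := fun i => mul_pos (hw i) (pow_pos hθ _)
  have hlamL' : ∀ i, GaussLE y w' (L i) 0 (lam i) := fun i => by
    simpa using (hlamL i).scale hw hθ hθ1
  have hdiv' : SmallDivisorBound y w' L lam B := hdiv.scale hw hθ hθ1
  have hb0 : 0 ≤ b := zero_le_one.trans hb1
  -- The size of a solution with right-hand side `g`: a factor `θ ^ m` from shrinking, a factor `b`
  -- from the divisors.
  set κ : ℝ := b * (θ ^ m * ε) with hκ
  have hθm : 0 < θ ^ m := pow_pos hθ m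
  have hκ0 : 0 < κ := by positivity
  have hΛ0 : 0 < Λ := by positivity
  -- The correction is obtained by two successive divisions, the first for the shift of `lam` and
  -- the second for `h`. This explains the square of `b` in `hbθ`.
  have hbκ : b * κ * Λ ≤ ε := by
    calc b * κ * Λ = (b * b * Λ * θ ^ m) * ε := by rw [hκ]; ring
      _ ≤ ε := mul_le_of_le_one_left hε.le hbθ
  have hκΛ : κ * Λ ≤ ε := le_trans (by nlinarith [mul_pos hκ0 hΛ0]) hbκ
  have hκε : κ ≤ ε := le_trans (by nlinarith) hκΛ
  have hg' : ∀ i, GaussLE y w' (θ ^ m * ε * w' i) (y i + m) (g i) := fun i =>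
    ((hg i).scale hw hθ hθ1).mono (le_of_eq (by rw [hw'_def]; ring)) le_rfl
  have hdivc : ∀ i I, y i + m ≤ weight y I → constantCoeff (lamPow lam I - lam i) ≠ 0 :=
    fun i I hI => (hdiv i I (by omega)).1
  -- the correction in the directions of degree zero
  classical
  let h0 : σ → MvPowerSeries σ k := fun i =>
    if y i = 0 then homologicalSol y lam (lam i) (y i + m) (y i + 2 * m) (g i) else 0
  have hh0 : ∀ i, GaussLE y w' (κ * w' i) (y i + m) (h0 i) := by
    intro i
    simp only [h0]
    split_ifs with hi
    · exact (GaussLE.homologicalSol hw' hdiv' (by omega) hb0 (hb i) (hg' i)).1.mono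
        (le_of_eq (by rw [hκ]; ring)) le_rfl
    · exact .zero (mul_pos hκ0 (hw' i)).le
  have hσ0 : HasSubst fun j => X j + h0 j :=
    hasSubst_of_constantCoeff_zero fun i => by
      simp [(hh0 i).constantCoeff_eq_zero (by omega)]
  have hX0 : ∀ j, GaussLE y w' (w' j) (y j) (X j + h0 j) := fun j =>
    (GaussLE.X hw' j).add ((hh0 j).mono
      (mul_le_of_le_one_left (hw' j).le (hκε.trans hε1)) (by omega)) hw'
  have hdl : ∀ i, GaussLE y w' (κ * L i) m (subst (fun j => X j + h0 j) (lam i) - lam i) := by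
    intro i
    have := GaussLE.subst_sub (s := m) hw' hκ0.le hσ0 HasSubst.X hX0 (GaussLE.X hw')
      (fun j => by simpa using hh0 j) (hL i).le (hlamL' i)
    rw [subst_self, id] at this
    exact this.mono le_rfl (by omega)
  -- The eigenvalue `lam_i` is itself moved by the change of coordinates, which contributes a term
  -- linear in `X i`. It depends on `h0` alone, so it is known before the transverse components of
  -- `h` are chosen.
  let gt : σ → MvPowerSeries σ k := fun i =>
    g i - (subst (fun j => X j + h0 j) (lam i) - lam i) * X i
  have hgt : ∀ i, GaussLE y w' (κ * Λ * w' i) (y i + m) (gt i) := by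
    intro i
    refine ((hg' i).mono ?_ le_rfl).sub (((hdl i).mul hw' (GaussLE.X hw' i)).mono ?_ ?_) hw'
    · have h1 : θ ^ m * ε ≤ κ := le_mul_of_one_le_left (by positivity) hb1
      have h2 : κ ≤ κ * Λ := le_mul_of_one_le_right hκ0.le hΛ
      exact mul_le_mul_of_nonneg_right (h1.trans h2) (hw' i).le
    · exact mul_le_mul_of_nonneg_right (mul_le_mul_of_nonneg_left (hLΛ i) hκ0.le) (hw' i).le
    · omega
  let h : σ → MvPowerSeries σ k := fun i =>
    homologicalSol y lam (lam i) (y i + m) (y i + 2 * m) (gt i)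
  have hh2 := fun i =>
    GaussLE.homologicalSol hw' hdiv' (show y i + 1 ≤ y i + m by omega) hb0 (hb i) (hgt i)
  have hble : ∀ i, b * (κ * Λ * w' i) ≤ ε * w' i := fun i => by
    calc b * (κ * Λ * w' i) = b * κ * Λ * w' i := by ring
      _ ≤ ε * w' i := mul_le_mul_of_nonneg_right hbκ (hw' i).le
  have hh : ∀ i, GaussLE y w' (ε * w' i) (y i + m) (h i) := fun i => (hh2 i).1.mono (hble i) le_rfl
  have hhL : ∀ i, GaussLE y (fun j => L j * w' j) (ε * w' i) (y i + m) (h i) := fun i =>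
    (hh2 i).2.mono (hble i) le_rfl
  -- In the directions of degree `0` one has `lam i = 1`, so `gt i = g i` and no circularity arises.
  have hh0eq : ∀ i, y i = 0 → h i = h0 i := by
    intro i hi
    have e1 : subst (fun j => X j + h0 j) (lam i) = lam i := by
      rw [hone i hi, ← coe_substAlgHom hσ0, map_one]
    simp only [h, h0, gt, if_pos hi, e1, sub_self, zero_mul, sub_zero]
  have hσ : HasSubst fun j => X j + h j :=
    hasSubst_of_constantCoeff_zero fun i => by
      simp [(hh i).constantCoeff_eq_zero (by omega)]
  have hσlam : ∀ i, subst (fun j => X j + h j) (lam i) = subst (fun j => X j + h0 j) (lam i) :=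
    fun i => subst_congr_of_mem_paramSubring (hlam i) hσ hσ0 fun j hj => by rw [hh0eq j hj]
  have hT : HasSubst fun j => lam j * X j + g j :=
    hasSubst_of_constantCoeff_zero fun i => by
      simp [(hg i).constantCoeff_eq_zero (by omega)]
  -- the error of the linearized equation
  let e : σ → MvPowerSeries σ k := fun i =>
    (gt i + (subst (fun j => lam j * X j) (h i) - lam i * h i)) +
      (subst (fun j => lam j * X j + g j) (h i) - subst (fun j => lam j * X j) (h i)) -
        (subst (fun j => X j + h0 j) (lam i) - lam i) * h i
  have he : ∀ i, GaussLE y w' (ε * w' i) (y i + 2 * m) (e i) := by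
    intro i
    have hwi := hw' i
    -- Three errors of order `y i + 2 * m`: the tail of `gt` left by truncation, the effect of `g`
    -- inside `h`, and the product of the shift of `lam` with `h`. The order doubles while the
    -- factor `ε` is kept.
    refine GaussLE.sub (GaussLE.add ?_ ?_ hw') ?_ hw'
    · intro I
      rw [map_add, coeff_homological_eq hlam hone (hlam i) (hdivc i)]
      have h3 : κ * Λ * w' i ≤ ε * w' i := mul_le_mul_of_nonneg_right hκΛ hwi.le
      split_ifs with hI
      · simp; positivity
      · rw [add_zero]
        refine ⟨fun hI2 => (hgt i I).1 (by omega), ((hgt i I).2).trans h3⟩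
    · have hlX : ∀ j, GaussLE y w' (L j * w' j) (y j) (lam j * X j) := fun j =>
        ((hlamL' j).mul hw' (GaussLE.X hw' j)).mono le_rfl (by omega)
      have hgj : ∀ j, GaussLE y w' (L j * w' j) (y j + m) (g j) := fun j =>
        (hg' j).mono (mul_le_mul_of_nonneg_right
          ((mul_le_of_le_one_left hε.le (pow_le_one₀ hθ.le hθ1)).trans (hεL j)) (hw' j).le) le_rfl
      have := GaussLE.subst_sub (ε := 1) (s := m) hw' zero_le_one hT (hasSubst_lam_mul_X lam)
        (fun j => (hlX j).add ((hgj j).mono le_rfl (by omega)) hw') hlX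
        (fun j => by simpa using hgj j) (by positivity) (hhL i)
      exact this.mono (by rw [one_mul]) (by omega)
    · refine ((hdl i).mul hw' (hh i)).mono ?_ (by omega)
      have h4 : κ * L i ≤ 1 := by
        calc κ * L i ≤ ε * Λ := mul_le_mul hκε (hLΛ i) (hL i).le hε.le
          _ ≤ 1 := hεΛ
      exact mul_le_of_le_one_left (by positivity) h4
  -- The error `e` is written in the old variables; inverting the substitution `X + h` on it gives
  -- the new deviation.
  have hex : ∀ i, ∃ g'' : MvPowerSeries σ k, GaussLE y w' (ε * w' i) (y i + 2 * m) g'' ∧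
      subst (fun j => X j + h j) g'' = e i := fun i =>
    exists_subst_X_add_eq hw' hm
      (fun j => (hh j).mono (mul_le_of_le_one_left (hw' j).le hε1) le_rfl)
      (fun j => (hh j).constantCoeff_eq_zero (by omega)) (he i)
  choose g'' hg''1 hg''2 using hex
  refine ⟨h, g'', hh, hg''1, fun i => ?_⟩
  rw [subst_add hT, subst_X hT, subst_add hσ, subst_mul hσ, subst_X hσ, hg''2, hσlam]
  simp only [e, gt]
  ring

end Newton

/-! ### Convergence of the Newton iteration. -/

section Iteration

open MvPowerSeries Finsupp Filter Topology

variable {σ : Type*} [Fintype σ] {k : Type*} [NontriviallyNormedField k] {y : σ → ℕ}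

omit [Fintype σ] in
-- A statement about orders alone: it is applied to the map `f`, which may enlarge the polyradius,
-- so that no Gauss bound for the substituted series is at hand.
lemma coeff_subst_eq_zero_of_weight_lt [Finite σ] {a : σ → MvPowerSeries σ k} (ha : HasSubst a)
    (hord : ∀ i I, weight y I < y i → coeff I (a i) = 0) {F : MvPowerSeries σ k} {m : ℕ}
    (hF : ∀ I, weight y I < m → coeff I F = 0) {I : σ →₀ ℕ} (hI : weight y I < m) :
    coeff I (subst a F) = 0 := by
  have := Fintype.ofFinite σ
  apply coeff_eq_zero_of_lt_weightedOrder y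
  refine lt_of_lt_of_le (b := (m : ℕ∞)) (by exact_mod_cast hI) ?_
  refine le_trans (le_iInf₂ fun d hd => ?_) (le_weightedOrder_subst y ha F)
  have h1 : m ≤ weight y d := by
    by_contra h
    exact hd (hF d (not_le.mp h))
  refine le_trans (Nat.cast_le.mpr h1) ?_
  rw [Finsupp.weight_eq_sum, Finsupp.weight_eq_sum, Nat.cast_sum]
  refine Finset.sum_le_sum fun i _ => ?_
  rw [smul_eq_mul, Nat.cast_mul, nsmul_eq_mul]
  exact mul_le_mul_right (nat_le_weightedOrder y fun I hI => hord i I hI) _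

variable [IsUltrametricDist k]

/-- The left side is the exponential of at most `A (j + 1) - c (3/2) ^ j`. With `c = 2 A`,
Bernoulli's inequality `(3/2) ^ j ≥ 1 + j / 2` makes this nonpositive. The ratio `3/4` lies above
`1/2`, so the factor beats the divisors, and below `1`, so the total shrinking is finite. -/
lemma exists_step_factor {K Λ β : ℝ} (hK : 1 ≤ K) (hΛ : 1 ≤ Λ) (hβ : 0 ≤ β) :
    ∃ c : ℝ, 0 ≤ c ∧ ∀ j : ℕ,
      (K * ((2 : ℝ) ^ (j + 1)) ^ β) * (K * ((2 : ℝ) ^ (j + 1)) ^ β) * Λ *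
        Real.exp (-(c * (3 / 4) ^ j)) ^ 2 ^ j ≤ 1 := by
  set A := 2 * Real.log K + Real.log Λ + 2 * β * Real.log 2 with hA
  have hlK := Real.log_nonneg hK
  have hlΛ := Real.log_nonneg hΛ
  have hl2 : 0 ≤ Real.log 2 := Real.log_nonneg (by norm_num)
  have hA0 : 0 ≤ A := by positivity
  refine ⟨2 * A, by positivity, fun j => ?_⟩
  have hKe : K = Real.exp (Real.log K) := (Real.exp_log (by linarith)).symm
  have hΛe : Λ = Real.exp (Real.log Λ) := (Real.exp_log (by linarith)).symm
  have h2e : ((2 : ℝ) ^ (j + 1)) ^ β = Real.exp (β * ((j + 1 : ℕ) * Real.log 2)) := by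
    rw [Real.rpow_def_of_pos (by positivity), Real.log_pow, mul_comm]
  rw [h2e, ← Real.exp_nat_mul]
  nth_rewrite 1 [hKe]
  nth_rewrite 2 [hKe]
  rw [hΛe, ← Real.exp_add, ← Real.exp_add, ← Real.exp_add, ← Real.exp_add, ← Real.exp_zero,
    Real.exp_le_exp]
  have hbern : (1 : ℝ) + j * (1 / 2) ≤ (3 / 2) ^ j := by
    have := one_add_mul_le_pow (a := (1 / 2 : ℝ)) (by norm_num) j
    norm_num at this ⊢
    linarith
  have e2 : ((2 ^ j : ℕ) : ℝ) * -(2 * A * (3 / 4) ^ j) = -(2 * A * (3 / 2) ^ j) := by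
    have : ((3 : ℝ) / 2) ^ j = 2 ^ j * (3 / 4) ^ j := by rw [← mul_pow]; norm_num
    rw [this]; push_cast; ring
  rw [e2]
  push_cast
  have hj : (0 : ℝ) ≤ j := Nat.cast_nonneg j
  have h3 : 2 * A * (1 + j * (1 / 2)) ≤ 2 * A * (3 / 2) ^ j :=
    mul_le_mul_of_nonneg_left hbern (by positivity)
  have h4 : Real.log K + β * ((j + 1) * Real.log 2) + (Real.log K + β * ((j + 1) * Real.log 2))
      + Real.log Λ ≤ A * (j + 1) := by
    rw [hA]
    nlinarith [mul_nonneg hlK hj, mul_nonneg hlΛ hj]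
  nlinarith [mul_nonneg hA0 hj]

/-- The data reached after finitely many steps of the Newton iteration: the coordinates `p.1`
conjugate the substitution `f` to `x_i ↦ lam_i x_i + p.2 i`. -/
structure IsPartialNormalForm (y : σ → ℕ) (w : σ → ℝ) (ε : ℝ) (m : ℕ)
    (f lam : σ → MvPowerSeries σ k) (p : (σ → MvPowerSeries σ k) × (σ → MvPowerSeries σ k)) :
    Prop where
  coord : ∀ i, GaussLE y w (w i) (y i + 1) (p.1 i - X i)
  error : ∀ i, GaussLE y w (ε * w i) (y i + m) (p.2 i)
  conj : ∀ i, subst f (p.1 i) = subst p.1 (lam i * X i + p.2 i)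

namespace IsPartialNormalForm

variable {w : σ → ℝ} {ε : ℝ} {m : ℕ} {f lam : σ → MvPowerSeries σ k}
  {p : (σ → MvPowerSeries σ k) × (σ → MvPowerSeries σ k)}

lemma gaussLE (hw : ∀ i, 0 < w i) (hp : IsPartialNormalForm y w ε m f lam p) (i : σ) :
    GaussLE y w (w i) (y i) (p.1 i) := by
  have := ((hp.coord i).mono le_rfl (Nat.le_succ _)).add (GaussLE.X hw i) hw
  rwa [sub_add_cancel] at this

omit [IsUltrametricDist k] in
lemma constantCoeff_eq_zero (hp : IsPartialNormalForm y w ε m f lam p) (i : σ) :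
    constantCoeff (p.1 i) = 0 := by
  simpa using (hp.coord i).constantCoeff_eq_zero (by omega)

omit [IsUltrametricDist k] in
lemma hasSubst (hp : IsPartialNormalForm y w ε m f lam p) : HasSubst p.1 :=
  hasSubst_of_constantCoeff_zero hp.constantCoeff_eq_zero

end IsPartialNormalForm

omit [IsUltrametricDist k] in
lemma GaussLE.scale_weight {w : σ → ℝ} (hw : ∀ i, 0 < w i) {i : σ} {m : ℕ} {c : ℝ}
    {F : MvPowerSeries σ k} (h : GaussLE y w (c * w i) (y i + m) F) {θ : ℝ} (h0 : 0 < θ)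
    (h1 : θ ≤ 1) : GaussLE y (fun j => w j * θ ^ y j) (c * (w i * θ ^ y i)) (y i + m) F := by
  have hc := h.nonneg hw
  refine (h.scale hw h0 h1).mono ?_ le_rfl
  calc θ ^ (y i + m) * (c * w i) ≤ θ ^ y i * (c * w i) :=
        mul_le_mul_of_nonneg_right (pow_le_pow_of_le_one h0.le h1 (Nat.le_add_right _ _)) hc
    _ = c * (w i * θ ^ y i) := by ring

/-- The Newton correction is substituted after the coordinates already found: the new ones are `p.1
i + h i (p.1)`. The polyradius bound on `p.1` ensures that this substitution costs nothing. -/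
lemma IsPartialNormalForm.exists_next {w L : σ → ℝ} {f lam : σ → MvPowerSeries σ k} {B : ℕ → ℝ}
    (hf : HasSubst f) (hw : ∀ i, 0 < w i) (hL : ∀ i, 0 < L i)
    (hlam : ∀ i, lam i ∈ paramSubring k y)
    (hone : ∀ i, y i = 0 → lam i = 1) (hlamL : ∀ i, GaussLE y w (L i) 0 (lam i))
    (hdiv : SmallDivisorBound y w L lam B) {ε Λ θ b : ℝ} {m : ℕ} (hm : 1 ≤ m)
    (hε : 0 < ε) (hε1 : ε ≤ 1) (hΛ : 1 ≤ Λ) (hLΛ : ∀ i, L i ≤ Λ) (hεL : ∀ i, ε ≤ L i)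
    (hεΛ : ε * Λ ≤ 1) (hθ : 0 < θ) (hθ1 : θ ≤ 1) (hb1 : 1 ≤ b)
    (hb : ∀ i, ∀ s < y i + 2 * m, B s ≤ b) (hbθ : b * b * Λ * θ ^ m ≤ 1)
    {p : (σ → MvPowerSeries σ k) × (σ → MvPowerSeries σ k)}
    (hp : IsPartialNormalForm y w ε m f lam p) :
    ∃ p' : (σ → MvPowerSeries σ k) × (σ → MvPowerSeries σ k),
      IsPartialNormalForm y (fun j => w j * θ ^ y j) ε (2 * m) f lam p' ∧
      ∀ i, GaussLE y (fun j => w j * θ ^ y j) (w i * θ ^ y i) (y i + m) (p'.1 i - p.1 i) := by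
  obtain ⟨h, g', hh, hg', heq⟩ := newton_step hw hL hlam hone hlamL hdiv hm hε hε1 hΛ hLΛ hεL hεΛ
    hθ hθ1 hb1 hb hbθ hp.error
  set w' : σ → ℝ := fun j => w j * θ ^ y j with hw'_def
  have hw' : ∀ i, 0 < w' i := fun i => mul_pos (hw i) (pow_pos hθ _)
  have hΦ := hp.hasSubst
  have hX : ∀ i, GaussLE y w' (w' i) (y i + 1) (p.1 i - X i) := fun i => by
    have := (show GaussLE y w (1 * w i) _ _ by rw [one_mul]; exact hp.coord i).scale_weight hw hθ hθ1
    rwa [one_mul] at this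
  have hΦw : ∀ i, GaussLE y w' (w' i) (y i) (p.1 i) := fun i => by
    have := ((hX i).mono le_rfl (Nat.le_succ _)).add (GaussLE.X hw' i) hw'
    rwa [sub_add_cancel] at this
  have hσ : HasSubst fun j => X j + h j :=
    hasSubst_of_constantCoeff_zero fun i => by
      simp [(hh i).constantCoeff_eq_zero (by omega)]
  have hfg : HasSubst fun j => lam j * X j + p.2 j :=
    hasSubst_of_constantCoeff_zero fun i => by
      simp [(hp.error i).constantCoeff_eq_zero (by omega)]
  have hd : ∀ i, GaussLE y w' (w' i) (y i + m) (subst p.1 (h i)) := fun i =>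
    (GaussLE.subst hw' hΦ hΦw (mul_pos hε (hw' i)).le (hh i)).mono
      (mul_le_of_le_one_left (hw' i).le hε1) le_rfl
  have he : ∀ i, subst p.1 (X i + h i) = p.1 i + subst p.1 (h i) := fun i => by
    rw [subst_add hΦ, subst_X hΦ]
  refine ⟨(fun i => subst p.1 (X i + h i), g'), ⟨fun i => ?_, hg', fun i => ?_⟩, fun i => ?_⟩
  · simp only [he]
    have e1 : p.1 i + subst p.1 (h i) - X i = (p.1 i - X i) + subst p.1 (h i) := by ring
    rw [e1]
    exact (hX i).add ((hd i).mono le_rfl (by omega)) hw'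
  · simp only
    rw [subst_comp_subst_apply hΦ hf, ← subst_comp_subst_apply hσ hΦ, ← heq,
      subst_comp_subst_apply hfg hΦ]
    congr 1
    exact funext hp.conj
  · simp only [he, add_sub_cancel_left]
    exact hd i

/-- The coefficientwise limit of a sequence of coordinates that agree to increasing order. -/
lemma exists_coordinate_limit {w : σ → ℝ} (hw : ∀ i, 0 < w i) {Φ : ℕ → σ → MvPowerSeries σ k}
    (hΦ : ∀ j i, GaussLE y w (w i) (y i + j + 1) (Φ (j + 1) i - Φ j i)) :
    ∃ Ψ : σ → MvPowerSeries σ k, ∀ N i, GaussLE y w (w i) (y i + N) (Ψ i - Φ N i) := by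
  have htel : ∀ d N i, GaussLE y w (w i) (y i + N + 1) (Φ (N + d) i - Φ N i) := by
    intro d N i
    induction d with
    | zero => rw [add_zero, sub_self]; exact .zero (hw i).le
    | succ d ih =>
      have := ((hΦ (N + d) i).mono (m' := y i + N + 1) le_rfl (by omega)).add ih hw
      rwa [sub_add_sub_cancel] at this
  -- From the index `weight y e` on, the coefficient at `e` no longer changes.
  let Ψ : σ → MvPowerSeries σ k := fun i e => coeff e (Φ (weight y e) i)
  refine ⟨Ψ, fun N i e => ?_⟩
  have e1 : coeff e (Ψ i) = coeff e (Φ (weight y e) i) := rfl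
  rw [map_sub, e1, ← map_sub]
  rcases le_total N (weight y e) with h | h
  · obtain ⟨d, hd⟩ := Nat.exists_eq_add_of_le h
    have := htel d N i e
    rw [hd] at this ⊢
    exact ⟨fun h' => this.1 (by omega), this.2⟩
  · obtain ⟨d, hd⟩ := Nat.exists_eq_add_of_le h
    have := (htel d (weight y e) i).neg e
    rw [neg_sub, ← hd] at this
    rw [this.1 (by omega)]
    simp [(hw i).le]

/-- Formal normal form with convergence: if the divisors `lam ^ I - lam_i` are not too small, then
`x_i ↦ lam_i x_i + g_i` is conjugate to `x_i ↦ lam_i x_i` by a series with finite Gauss norm. -/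
theorem exists_normal_form (hy : ∀ i, y i ≤ 1) {w L : σ → ℝ} {lam g : σ → MvPowerSeries σ k}
    (hw : ∀ i, 0 < w i) (hL : ∀ i, 0 < L i) (hlam : ∀ i, lam i ∈ paramSubring k y)
    (hone : ∀ i, y i = 0 → lam i = 1) (hlamL : ∀ i, GaussLE y w (L i) 0 (lam i))
    {K β : ℝ} (hK : 1 ≤ K) (hβ : 0 ≤ β)
    (hdiv : SmallDivisorBound y w L lam fun s => K * (s : ℝ) ^ β)
    {M : ℝ} (hg : ∀ i, GaussLE y w M 2 (g i)) :
    ∃ (τ : ℝ) (Φ : σ → MvPowerSeries σ k), 0 < τ ∧ τ ≤ 1 ∧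
      (∀ i, GaussLE y (fun j => w j * τ ^ y j) (w i * τ ^ y i) (y i + 1) (Φ i - X i)) ∧
      ∀ i, subst (fun j => lam j * X j + g j) (Φ i) = subst Φ (lam i * X i) := by
  classical
  set Λ : ℝ := 1 + ∑ i, L i with hΛ_def
  have hΛ : 1 ≤ Λ := le_add_of_nonneg_right (Finset.sum_nonneg fun i _ => (hL i).le)
  have hLΛ : ∀ i, L i ≤ Λ := fun i =>
    (Finset.single_le_sum (f := L) (fun j _ => (hL j).le) (Finset.mem_univ i)).trans
      (le_add_of_nonneg_left zero_le_one)
  have hΛ0 : 0 < Λ := by linarith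
  -- `ε ≤ L i` lets `g_i` obey the same bound `L_i w_i` as `lam_i X_i`, and `ε Λ ≤ 1` controls the
  -- product term of the error.
  obtain ⟨ε, ⟨⟨hε1, hεL⟩, hεΛ⟩, hε⟩ : ∃ ε : ℝ, ((ε ≤ 1 ∧ ∀ i, ε ≤ L i) ∧ ε * Λ ≤ 1) ∧ 0 < ε := by
    have h1 : ∀ c : ℝ, 0 < c → ∀ᶠ ε : ℝ in 𝓝[>] 0, ε ≤ c := fun c hc =>
      eventually_nhdsWithin_of_eventually_nhds (eventually_le_nhds hc)
    have h2 := ((h1 1 one_pos).and (eventually_all.mpr fun i => h1 (L i) (hL i))).and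
      (h1 (1 / Λ) (by positivity))
    obtain ⟨ε, h3, h4⟩ := (h2.and self_mem_nhdsWithin).exists
    exact ⟨ε, ⟨h3.1, (le_div_iff₀ hΛ0).mp h3.2⟩, h4⟩
  -- An initial shrinking makes `g` relatively small: order `2` gains `τ₀ ^ 2`, while the coordinate
  -- scale loses at most one factor `τ₀` because `y i ≤ 1`.
  obtain ⟨τ₀, ⟨hτ₀1, hτ₀g⟩, hτ₀⟩ : ∃ τ : ℝ, (τ ≤ 1 ∧ ∀ i, τ * M ≤ ε * w i) ∧ 0 < τ := by
    have h1 : ∀ c : ℝ, 0 < c → ∀ᶠ ε : ℝ in 𝓝[>] 0, ε ≤ c := fun c hc =>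
      eventually_nhdsWithin_of_eventually_nhds (eventually_le_nhds hc)
    have h2 := (h1 1 one_pos).and
      (eventually_all.mpr fun i => h1 (ε * w i / (|M| + 1)) (by have := hw i; positivity))
    obtain ⟨τ, h3, h4⟩ := (h2.and self_mem_nhdsWithin).exists
    refine ⟨τ, ⟨h3.1, fun i => ?_⟩, h4⟩
    have h5 := (le_div_iff₀ (by positivity)).mp (h3.2 i)
    have h4' : 0 < τ := h4
    have h6 : τ * M ≤ τ * (|M| + 1) :=
      mul_le_mul_of_nonneg_left ((le_abs_self M).trans (by linarith)) h4'.le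
    linarith
  obtain ⟨c, hc0, hc⟩ := exists_step_factor hK hΛ hβ
  -- `τ₀` times the product of the first `j` step factors; the exponents sum to `4 c (1 - (3/4) ^
  -- j)`, so the limit `τ₀ exp (-4 c)` is positive.
  let ρ : ℕ → ℝ := fun j => τ₀ * Real.exp (-(4 * c) * (1 - (3 / 4) ^ j))
  have hρ_succ : ∀ j, ρ (j + 1) = ρ j * Real.exp (-(c * (3 / 4) ^ j)) := by
    intro j
    simp only [ρ]
    rw [mul_assoc, ← Real.exp_add]
    congr 2
    ring
  have hρ0 : ∀ j, 0 < ρ j := fun j => by simp only [ρ]; positivity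
  have h34 : ∀ j : ℕ, (0 : ℝ) ≤ (3 / 4) ^ j := fun j => by positivity
  have hρ1 : ∀ j, ρ j ≤ 1 := fun j => by
    refine mul_le_one₀ hτ₀1 (Real.exp_pos _).le (Real.exp_le_one_iff.mpr ?_)
    have : (3 / 4 : ℝ) ^ j ≤ 1 := pow_le_one₀ (by norm_num) (by norm_num)
    nlinarith
  let W : ℕ → σ → ℝ := fun j i => w i * ρ j ^ y i
  have hW : ∀ j i, 0 < W j i := fun j i => mul_pos (hw i) (pow_pos (hρ0 j) _)
  have hW_succ : ∀ j, W (j + 1) = fun i => W j i * Real.exp (-(c * (3 / 4) ^ j)) ^ y i := by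
    intro j; funext i
    simp only [W, hρ_succ, mul_pow, mul_assoc]
  let f : σ → MvPowerSeries σ k := fun j => lam j * X j + g j
  have hg0 : ∀ i, constantCoeff (g i) = 0 := fun i => (hg i).constantCoeff_eq_zero (by omega)
  have hf : HasSubst f := hasSubst_of_constantCoeff_zero fun i => by simp [f, hg0]
  have h00 : IsPartialNormalForm y (W 0) ε (2 ^ 0) f lam (X, g) := by
    refine ⟨fun i => ?_, fun i => ?_, fun i => ?_⟩
    · rw [sub_self]; exact .zero (hW 0 i).le
    · have e1 : W 0 = fun j => w j * τ₀ ^ y j := by funext i; simp [W, ρ]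
      rw [e1]
      have hM := (hg i).nonneg hw
      refine ((hg i).scale hw hτ₀ hτ₀1).mono ?_ (by have := hy i; omega)
      have h2 : τ₀ ≤ τ₀ ^ y i := by
        simpa using pow_le_pow_of_le_one hτ₀.le hτ₀1 (hy i)
      calc τ₀ ^ 2 * M = τ₀ * (τ₀ * M) := by ring
        _ ≤ τ₀ ^ y i * (ε * w i) := mul_le_mul h2 (hτ₀g i) (by positivity) (by positivity)
        _ = ε * (w i * τ₀ ^ y i) := by ring
    · simp only [subst_X hf, subst_self, id, f]
  have hstep : ∀ (j : ℕ) (p : (σ → MvPowerSeries σ k) × (σ → MvPowerSeries σ k)),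
      IsPartialNormalForm y (W j) ε (2 ^ j) f lam p →
      ∃ p' : (σ → MvPowerSeries σ k) × (σ → MvPowerSeries σ k),
        IsPartialNormalForm y (W (j + 1)) ε (2 ^ (j + 1)) f lam p' ∧
        ∀ i, GaussLE y (W (j + 1)) (W (j + 1) i) (y i + 2 ^ j) (p'.1 i - p.1 i) := by
    intro j p hp
    have hpow1 : (1 : ℝ) ≤ ((2 : ℝ) ^ (j + 1)) ^ β :=
      Real.one_le_rpow (one_le_pow₀ (by norm_num)) hβ
    have := hp.exists_next (θ := Real.exp (-(c * (3 / 4) ^ j)))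
      (b := K * ((2 : ℝ) ^ (j + 1)) ^ β) hf (hW j) hL hlam hone
      (fun i => by simpa using (hlamL i).scale hw (hρ0 j) (hρ1 j))
      (hdiv.scale hw (hρ0 j) (hρ1 j)) Nat.one_le_two_pow hε hε1 hΛ hLΛ hεL hεΛ
      (Real.exp_pos _) (Real.exp_le_one_iff.mpr (neg_nonpos.mpr (mul_nonneg hc0 (h34 j))))
      (by nlinarith) ?_ (hc j)
    · rw [hW_succ, pow_succ, mul_comm (2 ^ j) 2]
      exact this
    · intro i s hs
      refine mul_le_mul_of_nonneg_left (Real.rpow_le_rpow (Nat.cast_nonneg _) ?_ hβ) (by linarith)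
      -- `y i ≤ 1` turns `s < y i + 2 * 2 ^ j` into `s ≤ 2 ^ (j + 1)`.
      have := hy i
      have h2 : s ≤ 2 ^ (j + 1) := by rw [pow_succ]; omega
      exact_mod_cast h2
  choose! nxt hnxt using hstep
  let sq : ℕ → (σ → MvPowerSeries σ k) × (σ → MvPowerSeries σ k) :=
    fun j => Nat.rec (X, g) (fun j p => nxt j p) j
  have hsq : ∀ j, IsPartialNormalForm y (W j) ε (2 ^ j) f lam (sq j) := by
    intro j
    induction j with
    | zero => exact h00
    | succ j ih => exact (hnxt j _ ih).1
  have hsqd : ∀ j i, GaussLE y (W (j + 1)) (W (j + 1) i) (y i + 2 ^ j)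
      ((sq (j + 1)).1 i - (sq j).1 i) := fun j => (hnxt j _ (hsq j)).2
  set τ : ℝ := τ₀ * Real.exp (-(4 * c)) with hτ_def
  have hτ : 0 < τ := by positivity
  have hτ1 : τ ≤ 1 := mul_le_one₀ hτ₀1 (Real.exp_pos _).le
    (Real.exp_le_one_iff.mpr (by linarith))
  let Wi : σ → ℝ := fun i => w i * τ ^ y i
  have hWi : ∀ i, 0 < Wi i := fun i => mul_pos (hw i) (pow_pos hτ _)
  have hWW : ∀ j, Wi = fun i => W j i * Real.exp (-(4 * c * (3 / 4) ^ j)) ^ y i := by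
    intro j; funext i
    have : τ = ρ j * Real.exp (-(4 * c * (3 / 4) ^ j)) := by
      simp only [ρ, hτ_def]
      rw [mul_assoc, ← Real.exp_add]
      congr 2
      ring
    simp only [Wi, W, this, mul_pow, mul_assoc]
  have hscale : ∀ j i c' m (F : MvPowerSeries σ k), GaussLE y (W j) (c' * W j i) (y i + m) F →
      GaussLE y Wi (c' * Wi i) (y i + m) F := by
    intro j i c' m F hF
    have := hF.scale_weight (hW j) (Real.exp_pos (-(4 * c * (3 / 4) ^ j)))
      (Real.exp_le_one_iff.mpr (neg_nonpos.mpr (mul_nonneg (by positivity) (h34 j))))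
    rw [hWW j]
    exact this
  have hscale1 : ∀ j i m (F : MvPowerSeries σ k), GaussLE y (W j) (W j i) (y i + m) F →
      GaussLE y Wi (Wi i) (y i + m) F := by
    intro j i m F hF
    have := hscale j i 1 m F (by rwa [one_mul])
    rwa [one_mul] at this
  obtain ⟨Ψ, hΨ⟩ := exists_coordinate_limit (Φ := fun j => (sq j).1) hWi fun j i =>
    (hscale1 (j + 1) i _ _ (hsqd j i)).mono le_rfl
      (by have := Nat.lt_two_pow_self (n := j); omega)
  have hΨX : ∀ i, GaussLE y Wi (Wi i) (y i + 1) (Ψ i - X i) := by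
    intro i
    have := (hΨ 1 i).add (hscale1 1 i _ _ ((hsq 1).coord i)) hWi
    rwa [sub_add_sub_cancel] at this
  have hΨw : ∀ i, GaussLE y Wi (Wi i) (y i) (Ψ i) := fun i => by
    have := ((hΨX i).mono le_rfl (Nat.le_succ _)).add (GaussLE.X hWi i) hWi
    rwa [sub_add_cancel] at this
  have hsw : ∀ j i, GaussLE y Wi (Wi i) (y i) ((sq j).1 i) := fun j i =>
    hscale1 j i 0 _ ((hsq j).gaussLE (hW j) i)
  have hΨs : HasSubst Ψ := hasSubst_of_constantCoeff_zero fun i => by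
    simpa using (hΨX i).constantCoeff_eq_zero (by omega)
  refine ⟨τ, Ψ, hτ, hτ1, hΨX, fun i => ?_⟩
  ext e
  -- At stage `N` the limit, its substitution and the remaining error all differ from the exact
  -- relation only in weights above that of `e`, so the conjugacy can be checked on the coefficient
  -- at `e`.
  set N := weight y e + 1 with hN
  have h1 : coeff e (subst f (Ψ i - (sq N).1 i)) = 0 := by
    refine coeff_subst_eq_zero_of_weight_lt (y := y) (m := N) (I := e) hf ?_ (fun I hI => ?_) (by omega)
    · intro j I hI
      have h2 := ((hlamL j).mul hw (GaussLE.X hw j) I).1 (by omega)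
      have h3 := (hg j I).1 (by have := hy j; omega)
      simp only [f, map_add, h2, h3, add_zero]
    · exact (hΨ N i I).1 (by omega)
  have hlX : GaussLE y Wi (L i * Wi i) (y i) (lam i * X i) := by
    have h2 : GaussLE y Wi (L i) 0 (lam i) := by simpa using (hlamL i).scale hw hτ hτ1
    simpa using h2.mul hWi (GaussLE.X hWi i)
  have h2 : coeff e (subst Ψ (lam i * X i) - subst (sq N).1 (lam i * X i)) = 0 := by
    have := GaussLE.subst_sub (s := N) (ε := 1) hWi zero_le_one hΨs (hsq N).hasSubst hΨw (hsw N)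
      (fun j => by rw [one_mul]; exact hΨ N j) (mul_pos (hL i) (hWi i)).le hlX
    exact (this e).1 (by omega)
  have h3 : coeff e (subst (sq N).1 ((sq N).2 i)) = 0 := by
    have := GaussLE.subst hWi (hsq N).hasSubst (hsw N) (mul_pos hε (hWi i)).le
      (hscale N i _ _ _ ((hsq N).error i))
    refine (this e).1 ?_
    have := Nat.lt_two_pow_self (n := N)
    omega
  have h4 := (hsq N).conj i
  rw [subst_add (hsq N).hasSubst] at h4
  rw [subst_sub hf, h4, map_sub, map_add, h3, add_zero, sub_eq_zero] at h1
  rw [map_sub, sub_eq_zero] at h2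
  exact h1.trans h2.symm

end Iteration

/-! ### Convergent power series and the functions they define. -/

section Evaluation

open MvPowerSeries Finsupp Filter Topology

variable {σ : Type*} [Fintype σ] {k : Type*} [NontriviallyNormedField k]

/-- The monomial `x ^ I`. -/
def monomialEval (x : σ → k) (I : σ →₀ ℕ) : k := ∏ i, x i ^ I i

lemma monomialEval_zero (x : σ → k) : monomialEval x 0 = 1 := by simp [monomialEval]

lemma monomialEval_add (x : σ → k) (I J : σ →₀ ℕ) :
    monomialEval x (I + J) = monomialEval x I * monomialEval x J := by
  simp [monomialEval, pow_add, Finset.prod_mul_distrib]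

lemma monomialEval_single [DecidableEq σ] (x : σ → k) (i : σ) :
    monomialEval x (single i 1) = x i := by
  simp [monomialEval, Finsupp.single_apply, pow_ite]

lemma norm_monomialEval_le (x : σ → k) (I : σ →₀ ℕ) : ‖monomialEval x I‖ ≤ ‖x‖ ^ I.degree := by
  rw [monomialEval, norm_prod, Finsupp.degree_eq_sum, ← Finset.prod_pow_eq_pow_sum]
  refine Finset.prod_le_prod (fun i _ => norm_nonneg _) fun i _ => ?_
  rw [norm_pow]
  exact pow_le_pow_left₀ (norm_nonneg _) (norm_le_pi_norm x i) _

/-- The coefficients of `F` satisfy `‖F_I‖ R ^ |I| ≤ M`. -/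
def CoeffBound (R M : ℝ) (F : MvPowerSeries σ k) : Prop :=
  ∀ I, ‖coeff I F‖ * R ^ I.degree ≤ M

/-- The value at `x` of the power series `F`. -/
noncomputable def evalSeries (F : MvPowerSeries σ k) (x : σ → k) : k :=
  ∑' I, coeff I F * monomialEval x I

variable {R M : ℝ} {F H : MvPowerSeries σ k}

omit [Fintype σ] in
lemma CoeffBound.nonneg (h : CoeffBound R M F) : 0 ≤ M :=
  le_trans (by simp) (h 0)

lemma weightPow_const (R : ℝ) (I : σ →₀ ℕ) : weightPow (fun _ => R) I = R ^ I.degree := by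
  rw [weightPow, Finsupp.degree_eq_sum, ← Finset.prod_pow_eq_pow_sum]

lemma coeffBound_iff_gaussLE : CoeffBound R M F ↔ GaussLE 0 (fun _ => R) M 0 F := by
  simp [CoeffBound, GaussLE, weightPow_const]

lemma GaussLE.coeffBound {y : σ → ℕ} {w : σ → ℝ} {m : ℕ} (hR : 0 < R) (hw : ∀ i, R ≤ w i)
    (h : GaussLE y w M m F) : CoeffBound R M F := by
  intro I
  refine le_trans (mul_le_mul_of_nonneg_left ?_ (norm_nonneg _)) (h I).2
  rw [← weightPow_const]
  exact Finset.prod_le_prod (fun i _ => pow_nonneg hR.le _)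
    fun i _ => pow_le_pow_left₀ hR.le (hw i) _

omit [Fintype σ] in
lemma CoeffBound.anti {R' : ℝ} (h : CoeffBound R M F) (h0 : 0 ≤ R') (hR : R' ≤ R) :
    CoeffBound R' M F := fun I =>
  le_trans (mul_le_mul_of_nonneg_left (pow_le_pow_left₀ h0 hR _) (norm_nonneg _)) (h I)

lemma CoeffBound.norm_term_le (hR : 0 < R) (h : CoeffBound R M F) (x : σ → k) (I : σ →₀ ℕ) :
    ‖coeff I F * monomialEval x I‖ ≤ M * (‖x‖ / R) ^ I.degree := by
  rw [norm_mul, div_pow]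
  have hp : 0 < R ^ I.degree := by positivity
  calc ‖coeff I F‖ * ‖monomialEval x I‖ ≤ ‖coeff I F‖ * ‖x‖ ^ I.degree :=
        mul_le_mul_of_nonneg_left (norm_monomialEval_le x I) (norm_nonneg _)
    _ = (‖coeff I F‖ * R ^ I.degree) * (‖x‖ ^ I.degree / R ^ I.degree) := by field_simp
    _ ≤ M * (‖x‖ ^ I.degree / R ^ I.degree) :=
        mul_le_mul_of_nonneg_right (h I) (by positivity)

variable [IsUltrametricDist k] [CompleteSpace k]

omit [Fintype σ] in
/-- A family of elements is summable if its terms decay geometrically with respect to a degree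
function with finite sublevel sets. -/
lemma summable_of_norm_le_geometric {ι : Type*} {d : ι → ℕ} (hd : ∀ N, {i | d i < N}.Finite)
    {f : ι → k} {M q : ℝ} (hq0 : 0 ≤ q) (hq : q < 1) (hf : ∀ i, ‖f i‖ ≤ M * q ^ d i) :
    Summable f := by
  apply NonarchimedeanAddGroup.summable_of_tendsto_cofinite_zero
  rw [Metric.tendsto_nhds]
  intro ε hε
  have h1 : Tendsto (fun n : ℕ => M * q ^ n) atTop (𝓝 0) := by
    simpa using (tendsto_pow_atTop_nhds_zero_of_lt_one hq0 hq).const_mul M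
  obtain ⟨N, hN⟩ := (h1.eventually (eventually_lt_nhds hε)).exists_forall_of_atTop
  refine Filter.eventually_cofinite.mpr ((hd N).subset fun i hi => ?_)
  by_contra h
  simp only [Set.mem_ofPred_eq, not_lt] at h
  simp only [Set.mem_ofPred_eq, dist_zero_right, not_lt] at hi
  exact absurd (hi.trans (hf i)) (not_le.mpr (hN _ h))

lemma CoeffBound.summable (hR : 0 < R) (h : CoeffBound R M F) {x : σ → k} (hx : ‖x‖ < R) :
    Summable fun I => coeff I F * monomialEval x I :=
  summable_of_norm_le_geometric (fun N => Finsupp.finite_of_degree_lt N) (by positivity)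
    ((div_lt_one hR).mpr hx) (h.norm_term_le hR x)

lemma CoeffBound.hasSum (hR : 0 < R) (h : CoeffBound R M F) {x : σ → k} (hx : ‖x‖ < R) :
    HasSum (fun I => coeff I F * monomialEval x I) (evalSeries F x) :=
  (h.summable hR hx).hasSum

lemma evalSeries_mul (hR : 0 < R) {M' : ℝ} (hF : CoeffBound R M F) (hH : CoeffBound R M' H)
    {x : σ → k} (hx : ‖x‖ < R) : evalSeries (F * H) x = evalSeries F x * evalSeries H x := by
  classical
  have hxR : ‖x‖ / R < 1 := (div_lt_one hR).mpr hx
  have hMn := hF.nonneg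
  rw [evalSeries, evalSeries, evalSeries, Summable.tsum_mul_tsum_eq_tsum_sum_antidiagonal
    (hF.summable hR hx) (hH.summable hR hx)]
  · refine tsum_congr fun I => ?_
    rw [coeff_mul, Finset.sum_mul]
    refine Finset.sum_congr rfl fun p hp => ?_
    rw [← Finset.HasAntidiagonal.mem_antidiagonal.mp hp, monomialEval_add]
    ring
  · refine summable_of_norm_le_geometric (d := fun p : (σ →₀ ℕ) × (σ →₀ ℕ) =>
      p.1.degree + p.2.degree) (M := M * M') (q := ‖x‖ / R) (fun N => ?_) (by positivity) hxR
      fun p => ?_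
    · refine ((Finsupp.finite_of_degree_lt N).prod (Finsupp.finite_of_degree_lt N)).subset ?_
      rintro ⟨a, b⟩ h
      simp only [Set.mem_ofPred_eq] at h
      exact ⟨show a.degree < N by omega, show b.degree < N by omega⟩
    · rw [norm_mul, pow_add]
      calc _ ≤ (M * (‖x‖ / R) ^ p.1.degree) * (M' * (‖x‖ / R) ^ p.2.degree) :=
            mul_le_mul (hF.norm_term_le hR x _) (hH.norm_term_le hR x _) (norm_nonneg _)
              (by positivity)
        _ = _ := by ring

lemma evalSeries_add (hR : 0 < R) {M' : ℝ} (hF : CoeffBound R M F) (hH : CoeffBound R M' H)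
    {x : σ → k} (hx : ‖x‖ < R) : evalSeries (F + H) x = evalSeries F x + evalSeries H x := by
  rw [evalSeries, evalSeries, evalSeries,
    ← (hF.summable hR hx).tsum_add (hH.summable hR hx)]
  exact tsum_congr fun I => by rw [map_add, add_mul]

omit [IsUltrametricDist k] [CompleteSpace k] in
lemma evalSeries_monomial (I : σ →₀ ℕ) (c : k) (x : σ → k) :
    evalSeries (monomial I c) x = c * monomialEval x I := by
  classical
  rw [evalSeries, tsum_eq_single I]
  · rw [coeff_monomial_same]
  · intro J hJ
    rw [coeff_monomial, if_neg hJ, zero_mul]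

omit [IsUltrametricDist k] [CompleteSpace k] in
lemma evalSeries_X (i : σ) (x : σ → k) : evalSeries (X i) x = x i := by
  classical
  rw [X, evalSeries_monomial, one_mul, monomialEval_single]

omit [IsUltrametricDist k] [CompleteSpace k] in
lemma evalSeries_C (c : k) (x : σ → k) : evalSeries (C c : MvPowerSeries σ k) x = c := by
  rw [← monomial_zero_eq_C_apply, evalSeries_monomial, monomialEval_zero, mul_one]

/-! ### Power series and formal multilinear series -/

omit [Fintype σ] [IsUltrametricDist k] [CompleteSpace k] in
-- A monomial of degree `n`, written as a product of `n` variables, is the diagonal value of an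
-- `n`-linear form.
lemma exists_enumeration (n : ℕ) (I : σ →₀ ℕ) (hI : I.degree = n) :
    ∃ j : Fin n → σ, ∑ t, single (j t) 1 = I := by
  classical
  induction n generalizing I with
  | zero => exact ⟨Fin.elim0, by simpa using ((Finsupp.degree_eq_zero_iff I).mp hI).symm⟩
  | succ n ih =>
    have hne : I ≠ 0 := by rintro rfl; simp at hI
    obtain ⟨i, hi⟩ := Finsupp.ne_iff.mp hne
    have hle : single i 1 ≤ I := Finsupp.single_le_iff.mpr (Nat.one_le_iff_ne_zero.mpr hi)
    obtain ⟨J, hJ⟩ := exists_add_of_le hle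
    obtain ⟨j, hj⟩ := ih J (by rw [hJ, map_add, Finsupp.degree_single] at hI; omega)
    exact ⟨Fin.cons i j, by simp [Fin.sum_univ_succ, hj, hJ]⟩

omit [IsUltrametricDist k] [CompleteSpace k] in
lemma monomialEval_sum_single {n : ℕ} (j : Fin n → σ) (x : σ → k) :
    monomialEval x (∑ t, single (j t) 1) = ∏ t, x (j t) := by
  classical
  induction n with
  | zero => simp [monomialEval_zero]
  | succ n ih =>
    rw [Fin.sum_univ_succ, Fin.prod_univ_succ, monomialEval_add, monomialEval_single,
      ih fun t => j t.succ]

omit [Fintype σ] [IsUltrametricDist k] [CompleteSpace k] in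
lemma degree_sum_single {n : ℕ} (j : Fin n → σ) :
    (∑ t, single (j t) 1 : σ →₀ ℕ).degree = n := by
  simp [map_sum]

noncomputable instance fintypeDegreeEq (n : ℕ) : Fintype {I : σ →₀ ℕ // I.degree = n} :=
  (Finsupp.finite_of_degree_eq n).fintype

/-- The formal multilinear series attached to a power series. -/
noncomputable def toFormal (F : MvPowerSeries σ k) : FormalMultilinearSeries k (σ → k) k :=
  fun n => ∑ I : {I : σ →₀ ℕ // I.degree = n}, coeff I.1 F •
    (ContinuousMultilinearMap.mkPiAlgebra k (Fin n) k).compContinuousLinearMap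
      fun t => ContinuousLinearMap.proj ((exists_enumeration n I.1 I.2).choose t)

omit [IsUltrametricDist k] [CompleteSpace k] in
lemma toFormal_apply_diag (F : MvPowerSeries σ k) (n : ℕ) (x : σ → k) :
    (toFormal F n fun _ => x) =
      ∑ I : {I : σ →₀ ℕ // I.degree = n}, coeff I.1 F * monomialEval x I.1 := by
  rw [toFormal, _root_.sum_apply]
  refine Finset.sum_congr rfl fun I _ => ?_
  have h := (exists_enumeration n I.1 I.2).choose_spec
  conv_rhs => rw [← h, monomialEval_sum_single]
  rw [h]
  simp

omit [CompleteSpace k] in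
-- The ultrametric inequality makes the number of monomials of degree `n` irrelevant, so the same
-- radius serves for the multilinear series.
lemma norm_toFormal_le (hR : 0 < R) (h : CoeffBound R M F) (n : ℕ) :
    ‖toFormal F n‖ * R ^ n ≤ M := by
  have hM := h.nonneg
  rw [← le_div_iff₀ (by positivity)]
  refine ContinuousMultilinearMap.opNorm_le_bound (by positivity) fun v => ?_
  rw [toFormal, _root_.sum_apply]
  refine IsUltrametricDist.norm_sum_le_of_forall_le_of_nonneg (by positivity) fun I _ => ?_
  simp only [_root_.smul_apply, smul_eq_mul, norm_mul,
    ContinuousMultilinearMap.compContinuousLinearMap_apply,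
    ContinuousMultilinearMap.mkPiAlgebra_apply, ContinuousLinearMap.proj_apply, norm_prod]
  refine mul_le_mul ?_ (Finset.prod_le_prod (fun _ _ => norm_nonneg _)
    fun t _ => norm_le_pi_norm _ _) (Finset.prod_nonneg fun _ _ => norm_nonneg _) (by positivity)
  rw [le_div_iff₀ (by positivity)]
  simpa [I.2] using h I.1

lemma CoeffBound.hasFPowerSeriesAt (hR : 0 < R) (h : CoeffBound R M F) :
    HasFPowerSeriesAt (evalSeries F) (toFormal F) 0 := by
  lift R to NNReal using hR.le
  refine ⟨R, ?_, by exact_mod_cast hR, fun {x} hx => ?_⟩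
  · exact FormalMultilinearSeries.le_radius_of_bound _ M (norm_toFormal_le hR h)
  · have hx' : ‖x‖ < R := by simpa [enorm_eq_nnnorm] using hx
    rw [zero_add]
    have h1 := (Equiv.sigmaFiberEquiv (fun I : σ →₀ ℕ => I.degree)).hasSum_iff.mpr
      (h.hasSum hR hx')
    refine h1.sigma fun n => ?_
    rw [toFormal_apply_diag]
    exact hasSum_fintype _

lemma CoeffBound.analyticAt (hR : 0 < R) (h : CoeffBound R M F) :
    AnalyticAt k (evalSeries F) 0 := ⟨_, h.hasFPowerSeriesAt hR⟩

/-- The coefficients of the power series attached to a formal multilinear series. -/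
noncomputable def ofFormal [DecidableEq σ] (p : FormalMultilinearSeries k (σ → k) k) :
    MvPowerSeries σ k := fun I =>
  ∑ j : Fin I.degree → σ with ∑ t, single (j t) 1 = I, p I.degree fun t => Pi.single (j t) 1

omit [IsUltrametricDist k] [CompleteSpace k] in
lemma coeff_ofFormal [DecidableEq σ] (p : FormalMultilinearSeries k (σ → k) k) {n : ℕ}
    (I : {I : σ →₀ ℕ // I.degree = n}) : coeff I.1 (ofFormal p) =
      ∑ j : Fin n → σ with ∑ t, single (j t) 1 = I.1, p n fun t => Pi.single (j t) 1 := by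
  obtain ⟨I, rfl⟩ := I
  rfl

omit [IsUltrametricDist k] [CompleteSpace k] in
-- Expand `x` in the standard basis and group the index sequences by the exponent they produce.
lemma sum_ofFormal [DecidableEq σ] (p : FormalMultilinearSeries k (σ → k) k) (n : ℕ) (x : σ → k) :
    ∑ I : {I : σ →₀ ℕ // I.degree = n}, coeff I.1 (ofFormal p) * monomialEval x I.1 =
      p n fun _ => x := by
  have hx : (fun _ : Fin n => x) = fun _ => ∑ i, x i • (Pi.single i (1 : k) : σ → k) := by
    funext _
    conv_lhs => rw [← Finset.univ_sum_single x]
    refine Finset.sum_congr rfl fun i _ => ?_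
    rw [← Pi.single_smul, smul_eq_mul, mul_one]
  rw [hx, ContinuousMultilinearMap.map_sum]
  rw [← Finset.sum_fiberwise_of_maps_to (s := Finset.univ) (t := Finset.univ)
    (g := fun j : Fin n → σ => (⟨∑ t, single (j t) 1, degree_sum_single j⟩ :
      {I : σ →₀ ℕ // I.degree = n})) (fun _ _ => Finset.mem_univ _)]
  refine Finset.sum_congr rfl fun I _ => ?_
  rw [coeff_ofFormal, Finset.sum_mul]
  refine Finset.sum_congr (Finset.filter_congr fun j _ => by rw [Subtype.ext_iff]) fun j hj => ?_
  have hj' := congrArg Subtype.val (Finset.mem_filter.mp hj).2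
  rw [ContinuousMultilinearMap.map_smul_univ, smul_eq_mul, ← hj', monomialEval_sum_single,
    mul_comm]

omit [CompleteSpace k] in
lemma coeffBound_ofFormal [DecidableEq σ] {p : FormalMultilinearSeries k (σ → k) k} (hR : 0 < R)
    (hM : 0 ≤ M) (h : ∀ n, ‖p n‖ * R ^ n ≤ M) : CoeffBound R M (ofFormal p) := by
  intro I
  rw [← le_div_iff₀ (by positivity)]
  refine IsUltrametricDist.norm_sum_le_of_forall_le_of_nonneg (by positivity) fun j _ => ?_
  rw [le_div_iff₀ (by positivity)]
  refine le_trans (mul_le_mul_of_nonneg_right ?_ (by positivity)) (h I.degree)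
  refine (ContinuousMultilinearMap.le_opNorm _ _).trans ?_
  refine mul_le_of_le_one_right (norm_nonneg _) (Finset.prod_le_one (fun _ _ => norm_nonneg _) ?_)
  intro t _
  rw [Pi.norm_single, norm_one]

/-- An analytic function is locally the sum of a power series in the coordinates. -/
lemma AnalyticAt.exists_evalSeries {g : (σ → k) → k} (hg : AnalyticAt k g 0) :
    ∃ (F : MvPowerSeries σ k) (R M : ℝ), 0 < R ∧ CoeffBound R M F ∧
      g =ᶠ[𝓝 0] evalSeries F := by
  classical
  obtain ⟨p, r, hp⟩ := hg
  obtain ⟨R, hR0, hR⟩ := ENNReal.lt_iff_exists_nnreal_btwn.mp hp.r_pos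
  have hR0' : (0 : ℝ) < R := by exact_mod_cast hR0
  obtain ⟨M, hM, hpM⟩ := p.norm_mul_pow_le_of_lt_radius (hR.trans_le hp.r_le)
  have hb := coeffBound_ofFormal hR0' hM.le hpM
  refine ⟨ofFormal p, R, M, hR0', hb, ?_⟩
  filter_upwards [Metric.ball_mem_nhds (0 : σ → k) hR0'] with x hx
  have hx' : ‖x‖ < R := by simpa using hx
  have h1 := hp.hasSum (y := x) (by
    refine Metric.mem_eball.mpr (lt_trans ?_ hR)
    rw [edist_zero_right, enorm_eq_nnnorm]
    exact_mod_cast hx')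
  rw [zero_add] at h1
  have h2 := (Equiv.sigmaFiberEquiv (fun I : σ →₀ ℕ => I.degree)).hasSum_iff.mpr
      (hb.hasSum hR0' hx')
  have h3 := h2.sigma (g := fun n => p n fun _ => x) fun n => by
    rw [← sum_ofFormal]
    exact hasSum_fintype _
  exact h1.unique h3

/-- Identity theorem: a convergent power series that vanishes near the origin is zero. -/
lemma CoeffBound.eq_zero (hR : 0 < R) (h : CoeffBound R M F)
    (h0 : ∀ᶠ x in 𝓝 0, evalSeries F x = 0) : F = 0 := by
  classical
  have h1 : HasFPowerSeriesAt (0 : (σ → k) → k) (toFormal F) 0 :=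
    (h.hasFPowerSeriesAt hR).congr h0
  ext I
  -- Each homogeneous part is a polynomial vanishing at all points; since `k` is infinite, it is
  -- zero.
  have h2 : ∑ J : {J : σ →₀ ℕ // J.degree = I.degree},
      MvPolynomial.monomial J.1 (coeff J.1 F) = 0 := by
    apply MvPolynomial.funext
    intro x
    have h3 := h1.apply_eq_zero I.degree x
    rw [toFormal_apply_diag] at h3
    rw [map_sum, map_zero, ← h3]
    refine Finset.sum_congr rfl fun J _ => ?_
    rw [MvPolynomial.eval_monomial, Finsupp.prod_fintype _ _ (by simp)]
    rfl
  have h4 := congrArg (MvPolynomial.coeff I) h2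
  rw [MvPolynomial.coeff_sum, Fintype.sum_eq_single ⟨I, rfl⟩] at h4
  · simpa using h4
  · intro J hJ
    rw [MvPolynomial.coeff_monomial, if_neg]
    exact fun h => hJ (Subtype.ext h)

end Evaluation

/-! ### Composition of convergent series and vanishing along a coordinate subspace. -/

section Composition

open MvPowerSeries Finsupp Filter Topology

variable {σ : Type*} [Fintype σ] {k : Type*} [NontriviallyNormedField k] {R M : ℝ}
  {F : MvPowerSeries σ k}

lemma exists_pos_forall_le {ι : Type*} [Finite ι] {c : ι → ℝ} (hc : ∀ i, 0 < c i) :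
    ∃ δ : ℝ, 0 < δ ∧ ∀ i, δ ≤ c i := by
  have h2 : ∀ᶠ δ : ℝ in 𝓝[>] 0, ∀ i, δ ≤ c i := eventually_all.mpr fun i =>
    eventually_nhdsWithin_of_eventually_nhds (eventually_le_nhds (hc i))
  obtain ⟨δ, h3, h4⟩ := (h2.and self_mem_nhdsWithin).exists
  exact ⟨δ, h4, h3⟩

omit [Fintype σ] in
lemma CoeffBound.mono {M' : ℝ} (h : CoeffBound R M F) (hM : M ≤ M') : CoeffBound R M' F :=
  fun I => (h I).trans hM

omit [Fintype σ] in
-- Every monomial present has degree at least `1`, hence gains at least one factor `s`.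
lemma CoeffBound.shrink (h : CoeffBound R M F) (h0 : constantCoeff F = 0) {s : ℝ}
    (hs : 0 < s) (hs1 : s ≤ 1) : CoeffBound (R * s) (M * s) F := by
  intro I
  by_cases hI : I = 0
  · subst hI
    rw [coeff_zero_eq_constantCoeff_apply, h0, norm_zero, zero_mul]
    exact mul_nonneg h.nonneg hs.le
  · have hd : I.degree ≠ 0 := by rwa [Ne, Finsupp.degree_eq_zero_iff]
    rw [mul_pow, ← mul_assoc]
    exact mul_le_mul (h I) (pow_le_of_le_one hs.le hs1 hd) (by positivity) h.nonneg

lemma evalSeries_zero_right (F : MvPowerSeries σ k) : evalSeries F 0 = constantCoeff F := by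
  rw [evalSeries, tsum_eq_single 0]
  · rw [monomialEval_zero, mul_one, coeff_zero_eq_constantCoeff_apply]
  · intro I hI
    have hd : I.degree ≠ 0 := by rwa [Ne, Finsupp.degree_eq_zero_iff]
    have h1 := norm_monomialEval_le (0 : σ → k) I
    rw [norm_zero, zero_pow hd] at h1
    rw [norm_le_zero_iff.mp h1, mul_zero]

variable [IsUltrametricDist k]

lemma CoeffBound.mul {M' : ℝ} {H : MvPowerSeries σ k} (hR : 0 < R) (hF : CoeffBound R M F)
    (hH : CoeffBound R M' H) : CoeffBound R (M * M') (F * H) := by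
  rw [coeffBound_iff_gaussLE] at *
  exact hF.mul (fun _ => hR) hH

lemma CoeffBound.add {H : MvPowerSeries σ k} (hR : 0 < R) (hF : CoeffBound R M F)
    (hH : CoeffBound R M H) : CoeffBound R M (F + H) := by
  rw [coeffBound_iff_gaussLE] at *
  exact hF.add hH (fun _ => hR)

omit [IsUltrametricDist k] in
lemma coeffBound_one : CoeffBound R 1 (1 : MvPowerSeries σ k) := by
  rw [coeffBound_iff_gaussLE]
  exact GaussLE.one

omit [IsUltrametricDist k] in
lemma coeffBound_X (hR : 0 < R) (i : σ) : CoeffBound R R (X i : MvPowerSeries σ k) := by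
  rw [coeffBound_iff_gaussLE]
  exact GaussLE.X (fun _ => hR) i

lemma coeffBound_finsuppProd {ρ : ℝ} (hR : 0 < R) {a : σ → MvPowerSeries σ k}
    (ha : ∀ i, CoeffBound R ρ (a i)) (I : σ →₀ ℕ) :
    CoeffBound R (ρ ^ I.degree) (I.prod fun i e => a i ^ e) := by
  have h := (GaussClose.finsuppProd (y := 0) (w := fun _ => R) (v := fun _ => ρ) (ε := 0) (s := 0)
    (a := a) (b := a) (fun _ => hR) le_rfl (fun i => ⟨coeffBound_iff_gaussLE.mp (ha i),
      coeffBound_iff_gaussLE.mp (ha i), by rw [sub_self]; exact .zero (by simp)⟩) I).left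
  rw [weightPow_const] at h
  exact coeffBound_iff_gaussLE.mpr (h.mono le_rfl (Nat.zero_le _))

variable [CompleteSpace k]

lemma evalSeries_pow (hR : 0 < R) (hF : CoeffBound R M F) {x : σ → k} (hx : ‖x‖ < R) (n : ℕ) :
    CoeffBound R (M ^ n) (F ^ n) ∧ evalSeries (F ^ n) x = evalSeries F x ^ n := by
  induction n with
  | zero =>
    refine ⟨by simpa using coeffBound_one, ?_⟩
    simpa using evalSeries_C (1 : k) x
  | succ n ih =>
    rw [pow_succ, pow_succ, pow_succ]
    exact ⟨ih.1.mul hR hF, by rw [evalSeries_mul hR ih.1 hF hx, ih.2]⟩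

lemma evalSeries_finsuppProd {ρ : ℝ} (hR : 0 < R) {a : σ → MvPowerSeries σ k}
    (ha : ∀ i, CoeffBound R ρ (a i)) {x : σ → k} (hx : ‖x‖ < R) (I : σ →₀ ℕ) :
    evalSeries (I.prod fun i e => a i ^ e) x = monomialEval (fun i => evalSeries (a i) x) I := by
  classical
  rw [Finsupp.prod_fintype _ _ (by simp), monomialEval]
  have key : ∀ s : Finset σ, (∃ M', CoeffBound R M' (∏ i ∈ s, a i ^ I i)) ∧
      evalSeries (∏ i ∈ s, a i ^ I i) x = ∏ i ∈ s, evalSeries (a i) x ^ I i := by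
    intro s
    induction s using Finset.induction_on with
    | empty => exact ⟨⟨1, by simpa using coeffBound_one⟩, by simpa using evalSeries_C (1 : k) x⟩
    | insert i s hi ih =>
      obtain ⟨⟨M', hM'⟩, h2⟩ := ih
      have h3 := evalSeries_pow hR (ha i) hx (I i)
      rw [Finset.prod_insert hi, Finset.prod_insert hi]
      exact ⟨⟨_, h3.1.mul hR hM'⟩, by rw [evalSeries_mul hR h3.1 hM' hx, h2, h3.2]⟩
  exact (key Finset.univ).2

/-- Near the origin, substitution of power series corresponds to composition of functions. -/
lemma evalSeries_subst {a : σ → MvPowerSeries σ k} {Ma R' : ℝ} (hR : 0 < R)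
    (ha : ∀ i, CoeffBound R Ma (a i)) (ha0 : ∀ i, constantCoeff (a i) = 0) (hR' : 0 < R')
    (hF : CoeffBound R' M F) :
    ∀ᶠ x in 𝓝 0, evalSeries (subst a F) x = evalSeries F fun i => evalSeries (a i) x := by
  classical
  have hsub : HasSubst a := hasSubst_of_constantCoeff_zero ha0
  -- Chosen so that each `a i` has Gauss norm at most `R' / 2` on the radius `R * s`; the factor `1
  -- / 2` gives geometric decay in the degree of the monomials of `F`.
  set s : ℝ := min 1 (R' / (2 * (|Ma| + 1))) with hs_def
  have hs : 0 < s := by positivity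
  have hs1 : s ≤ 1 := min_le_left _ _
  have hMs : Ma * s ≤ R' / 2 := by
    have h1 : Ma * s ≤ (|Ma| + 1) * s :=
      mul_le_mul_of_nonneg_right ((le_abs_self _).trans (by linarith)) hs.le
    have h2 : (|Ma| + 1) * s ≤ (|Ma| + 1) * (R' / (2 * (|Ma| + 1))) :=
      mul_le_mul_of_nonneg_left (min_le_right _ _) (by positivity)
    have h3 : (|Ma| + 1) * (R' / (2 * (|Ma| + 1))) = R' / 2 := by field_simp
    linarith
  set R₁ := R * s
  have hR₁ : 0 < R₁ := by positivity
  have ha1 : ∀ i, CoeffBound R₁ (R' / 2) (a i) := fun i => ((ha i).shrink (ha0 i) hs hs1).mono hMs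
  have hprod := coeffBound_finsuppProd hR₁ ha1
  have hMF := hF.nonneg
  filter_upwards [Metric.ball_mem_nhds (0 : σ → k) hR₁] with x hx
  have hx' : ‖x‖ < R₁ := by simpa using hx
  have hxq : ‖x‖ / R₁ < 1 := (div_lt_one hR₁).mpr hx'
  set q : ℝ := max (1 / 2) (‖x‖ / R₁) with hq_def
  have hq0 : 0 ≤ q := le_max_of_le_left (by norm_num)
  have hq1 : q < 1 := max_lt (by norm_num) hxq
  -- Summability of the double series, over exponents of `F` and of the substituted monomials,
  -- justifies exchanging the two summations.
  have hsum : Summable fun p : (σ →₀ ℕ) × (σ →₀ ℕ) =>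
      coeff p.1 F * (coeff p.2 (p.1.prod fun i e => a i ^ e) * monomialEval x p.2) := by
    refine summable_of_norm_le_geometric (d := fun p => p.1.degree + p.2.degree) (M := M)
      (q := q) (fun N => ?_) hq0 hq1 fun p => ?_
    · refine ((Finsupp.finite_of_degree_lt N).prod (Finsupp.finite_of_degree_lt N)).subset ?_
      rintro ⟨a, b⟩ h
      simp only [Set.mem_ofPred_eq] at h
      exact ⟨show a.degree < N by omega, show b.degree < N by omega⟩
    · have h1 := (hprod p.1).norm_term_le hR₁ x p.2
      have h2 : R' / 2 = R' * (1 / 2) := by ring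
      rw [norm_mul, pow_add]
      calc _ ≤ ‖coeff p.1 F‖ * ((R' / 2) ^ p.1.degree * (‖x‖ / R₁) ^ p.2.degree) :=
            mul_le_mul_of_nonneg_left h1 (norm_nonneg _)
        _ = (‖coeff p.1 F‖ * R' ^ p.1.degree) * ((1 / 2) ^ p.1.degree *
              (‖x‖ / R₁) ^ p.2.degree) := by rw [h2, mul_pow]; ring
        _ ≤ M * (q ^ p.1.degree * q ^ p.2.degree) := by
            refine mul_le_mul (hF p.1) (mul_le_mul ?_ ?_ (by positivity) (by positivity))
              (by positivity) hMF
            · exact pow_le_pow_left₀ (by norm_num) (le_max_left _ _) _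
            · exact pow_le_pow_left₀ (by positivity) (le_max_right _ _) _
  have e1 : ∀ e, coeff e (subst a F) * monomialEval x e =
      ∑' d, coeff d F * (coeff e (d.prod fun i e => a i ^ e) * monomialEval x e) := by
    intro e
    rw [coeff_subst hsub, ← tsum_eq_finsum (L := .unconditional _) (coeff_subst_finite hsub F e), ← tsum_mul_right]
    exact tsum_congr fun d => by rw [smul_eq_mul, mul_assoc]
  have e2 : ∀ d, coeff d F * monomialEval (fun i => evalSeries (a i) x) d =
      ∑' e, coeff d F * (coeff e (d.prod fun i e => a i ^ e) * monomialEval x e) := by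
    intro d
    rw [← evalSeries_finsuppProd hR₁ ha1 hx', tsum_mul_left, evalSeries]
  rw [evalSeries, evalSeries, tsum_congr e1, tsum_congr e2]
  exact Summable.tsum_comm (f := fun d e =>
    coeff d F * (coeff e (d.prod fun i e => a i ^ e) * monomialEval x e)) hsum

lemma CoeffBound.fderiv_single [DecidableEq σ] (hR : 0 < R) (h : CoeffBound R M F) (j : σ) :
    fderiv k (evalSeries F) 0 (Pi.single j 1) = coeff (single j 1) F := by
  rw [(h.hasFPowerSeriesAt hR).fderiv_eq, continuousMultilinearCurryFin1_apply]
  have e1 : (Fin.snoc 0 (Pi.single j 1) : Fin 1 → σ → k) = fun _ => Pi.single j 1 := by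
    funext t
    fin_cases t
    rfl
  rw [e1, toFormal_apply_diag, Fintype.sum_eq_single ⟨single j 1, by simp⟩]
  · rw [monomialEval_single, Pi.single_eq_same, mul_one]
  · rintro ⟨I, hI⟩ hne
    obtain ⟨t, ht⟩ := exists_enumeration 1 I hI
    rw [Fin.sum_univ_one] at ht
    subst ht
    rw [monomialEval_single, Pi.single_eq_of_ne, mul_zero]
    rintro h0
    exact hne (Subtype.ext (congrArg (fun i => single i 1) h0))

/-! ### Vanishing along the zero set of the graded coordinates -/

/-- The action of scalars given by the grading `y`. -/
def gradedScale (y : σ → ℕ) (z : k) (x : σ → k) : σ → k := fun i => z ^ y i * x i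

omit [IsUltrametricDist k] [CompleteSpace k] in
lemma monomialEval_gradedScale (y : σ → ℕ) (z : k) (x : σ → k) (I : σ →₀ ℕ) :
    monomialEval (gradedScale y z x) I = z ^ weight y I * monomialEval x I := by
  rw [weight_eq_sum_mul, ← Finset.prod_pow_eq_pow_sum, monomialEval, monomialEval,
    ← Finset.prod_mul_distrib]
  refine Finset.prod_congr rfl fun i _ => ?_
  rw [gradedScale, mul_pow, ← pow_mul, mul_comm (y i)]

omit [IsUltrametricDist k] [CompleteSpace k] in
lemma norm_gradedScale_le (y : σ → ℕ) {z : k} (hz : ‖z‖ ≤ 1) (x : σ → k) :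
    ‖gradedScale y z x‖ ≤ ‖x‖ := by
  refine (pi_norm_le_iff_of_nonneg (norm_nonneg _)).mpr fun i => ?_
  rw [gradedScale, norm_mul, norm_pow]
  exact (mul_le_of_le_one_left (norm_nonneg _) (pow_le_one₀ (norm_nonneg _) hz)).trans
    (norm_le_pi_norm x i)

/-- The part of `F` of weight `s`. -/
noncomputable def weightPart (y : σ → ℕ) (s : ℕ) (F : MvPowerSeries σ k) : MvPowerSeries σ k :=
  fun I => if weight y I = s then coeff I F else 0

omit [Fintype σ] [IsUltrametricDist k] [CompleteSpace k] in
lemma coeff_weightPart (y : σ → ℕ) (s : ℕ) (F : MvPowerSeries σ k) (I : σ →₀ ℕ) :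
    coeff I (weightPart y s F) = if weight y I = s then coeff I F else 0 := rfl

omit [Fintype σ] [IsUltrametricDist k] [CompleteSpace k] in
lemma CoeffBound.weightPart (h : CoeffBound R M F) (y : σ → ℕ) (s : ℕ) :
    CoeffBound R M (weightPart y s F) := by
  intro I
  rw [coeff_weightPart]
  split_ifs
  · exact h I
  · simpa using h.nonneg

omit [IsUltrametricDist k] [CompleteSpace k] in
lemma evalSeries_gradedScale_zero (y : σ → ℕ) (F : MvPowerSeries σ k) (x : σ → k) :
    evalSeries F (gradedScale y 0 x) = evalSeries (weightPart y 0 F) x := by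
  refine tsum_congr fun I => ?_
  rw [monomialEval_gradedScale, coeff_weightPart]
  split_ifs with h
  · rw [h, pow_zero, one_mul]
  · rw [zero_pow h]; ring

omit [Fintype σ] [CompleteSpace k] [IsUltrametricDist k] in
lemma tendsto_gradedScale_zero (y : σ → ℕ) :
    Tendsto (fun p : k × (σ → k) => gradedScale y p.1 p.2) (𝓝 (0, 0)) (𝓝 0) := by
  have h : Continuous fun p : k × (σ → k) => gradedScale y p.1 p.2 := by
    unfold gradedScale; fun_prop
  have := h.tendsto (0, 0)
  convert! this using 2
  funext i; simp [gradedScale]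

/-- The part of weight `s` scales by `z ^ s`. With no part of weight `0`, what remains after
removing `z` times the part of weight `1` is `O(z ^ 2)`, uniformly over the terms. -/
lemma hasDerivAt_evalSeries_gradedScale {y : σ → ℕ} (hR : 0 < R) (h : CoeffBound R M F)
    (h0 : weightPart y 0 F = 0) {x : σ → k} (hx : ‖x‖ < R) :
    HasDerivAt (fun z : k => evalSeries F (gradedScale y z x)) (evalSeries (weightPart y 1 F) x)
      0 := by
  have hMn := h.nonneg
  have hxR : ‖x‖ / R ≤ 1 := ((div_lt_one hR).mpr hx).le
  have hF0 : ∀ I, weight y I = 0 → coeff I F = 0 := fun I hI => by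
    have := congrArg (coeff I) h0
    rwa [coeff_weightPart, if_pos hI, map_zero] at this
  have hrem : ∀ z : k, ‖z‖ ≤ 1 →
      ‖evalSeries F (gradedScale y z x) - z * evalSeries (weightPart y 1 F) x‖ ≤ ‖z‖ ^ 2 * M := by
    intro z hz
    rw [evalSeries, evalSeries, ← tsum_mul_left, ← Summable.tsum_sub
      (h.summable hR ((norm_gradedScale_le y hz x).trans_lt hx))
      (((h.weightPart y 1).summable hR hx).mul_left z)]
    refine IsUltrametricDist.norm_tsum_le_of_forall_le_of_nonneg (by positivity) fun I => ?_
    rw [monomialEval_gradedScale, coeff_weightPart]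
    have hterm : ‖coeff I F * monomialEval x I‖ ≤ M :=
      (h.norm_term_le hR x I).trans (mul_le_of_le_one_right hMn (pow_le_one₀ (by positivity) hxR))
    rcases Nat.lt_or_ge (weight y I) 2 with hI | hI
    · have : weight y I = 0 ∨ weight y I = 1 := by omega
      rcases this with hI | hI
      · rw [hF0 I hI]; simp; positivity
      · rw [if_pos hI, hI, pow_one, sub_eq_zero.mpr (by ring), norm_zero]; positivity
    · rw [if_neg (by omega), zero_mul, mul_zero, sub_zero, mul_left_comm, norm_mul, norm_pow]
      exact mul_le_mul (pow_le_pow_of_le_one (norm_nonneg _) hz hI) hterm (norm_nonneg _)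
        (by positivity)
  have hO : (fun z : k => evalSeries F (gradedScale y z x) -
      z * evalSeries (weightPart y 1 F) x) =O[𝓝 0] fun z => ‖z - 0‖ ^ 2 := by
    refine Asymptotics.IsBigO.of_bound M ?_
    filter_upwards [Metric.closedBall_mem_nhds (0 : k) one_pos] with z hz
    have hz' : ‖z‖ ≤ 1 := by simpa using hz
    rw [sub_zero, norm_pow, norm_norm, mul_comm M]
    exact hrem z hz'
  have h1 : HasDerivAt (fun z : k => evalSeries F (gradedScale y z x) -
      z * evalSeries (weightPart y 1 F) x) 0 0 := by
    have := (hO.hasFDerivAt (𝕜 := k) one_lt_two).hasDerivAt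
    simpa using this
  have h2 := h1.add ((hasDerivAt_id (0 : k)).mul_const (evalSeries (weightPart y 1 F) x))
  simp only [zero_add, one_mul] at h2
  refine h2.congr_of_eventuallyEq (Eventually.of_forall fun z => ?_)
  simp

/-- If a function vanishes to second order along the zero set of the coordinates of positive
degree, then its power series has order at least `2`. -/
lemma coeff_eq_zero_of_vanish {y : σ → ℕ} {G : (σ → k) → k} (hR : 0 < R)
    (h : CoeffBound R M F) (hG : G =ᶠ[𝓝 0] evalSeries F)
    (h0 : ∀ᶠ x in 𝓝 0, G (gradedScale y 0 x) = 0)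
    (h1 : ∀ᶠ x in 𝓝 0, HasFDerivAt G (0 : (σ → k) →L[k] k) (gradedScale y 0 x))
    {I : σ →₀ ℕ} (hI : weight y I < 2) : coeff I F = 0 := by
  have hG2 : ∀ᶠ p : k × (σ → k) in 𝓝 (0, 0),
      G (gradedScale y p.1 p.2) = evalSeries F (gradedScale y p.1 p.2) :=
    (tendsto_gradedScale_zero y).eventually hG
  obtain ⟨pz, hpz, px, hpx, hpzx⟩ := eventually_prod_iff.mp (by rwa [nhds_prod_eq] at hG2)
  have e0 : weightPart y 0 F = 0 := by
    refine (h.weightPart y 0).eq_zero hR ?_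
    filter_upwards [h0, hpx] with x hx hx2
    rw [← evalSeries_gradedScale_zero, ← hpzx hpz.self_of_nhds hx2, hx]
  -- Differentiating along the curve `z ↦ gradedScale y z x` at `z = 0` computes the part of weight
  -- `1`; the chain rule and the vanishing derivative of `G` show that it is zero.
  have e1 : weightPart y 1 F = 0 := by
    refine (h.weightPart y 1).eq_zero hR ?_
    filter_upwards [h1, hpx, Metric.ball_mem_nhds (0 : σ → k) hR] with x hx hx2 hx3
    have d1 := hasDerivAt_evalSeries_gradedScale (y := y) hR h e0 (by simpa using hx3)
    have hdiff : DifferentiableAt k (fun z : k => gradedScale y z x) 0 := by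
      unfold gradedScale; fun_prop
    have d2 := hx.comp_hasDerivAt (0 : k) hdiff.hasDerivAt
    rw [_root_.zero_apply] at d2
    refine d1.unique (d2.congr_of_eventuallyEq ?_)
    filter_upwards [hpz] with z hz
    exact (hpzx hz hx2).symm
  rcases (show weight y I = 0 ∨ weight y I = 1 by omega) with hI | hI
  · have := congrArg (coeff I) e0
    rwa [coeff_weightPart, if_pos hI, map_zero] at this
  · have := congrArg (coeff I) e1
    rwa [coeff_weightPart, if_pos hI, map_zero] at this

end Composition

/-! ### From formal to analytic linearization. -/

section Germ

open MvPowerSeries Finsupp Filter Topology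

variable {σ : Type*} [Fintype σ] {k : Type*} [NontriviallyNormedField k]

lemma weightPow_le_weightPow {v w : σ → ℝ} (hv : ∀ i, 0 < v i) (hvw : ∀ i, v i ≤ w i)
    (I : σ →₀ ℕ) : weightPow v I ≤ weightPow w I :=
  Finset.prod_le_prod (fun i _ => pow_nonneg (hv i).le _)
    fun i _ => pow_le_pow_left₀ (hv i).le (hvw i) _

lemma SmallDivisorBound.anti {y : σ → ℕ} {v w L : σ → ℝ} {lam : σ → MvPowerSeries σ k} {B : ℕ → ℝ}
    (hv : ∀ i, 0 < v i) (hvw : ∀ i, v i ≤ w i) (h : SmallDivisorBound y w L lam B) :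
    SmallDivisorBound y v L lam B := by
  refine fun i I hI => ⟨(h i I hI).1, fun e => le_trans ?_ ((h i I hI).2 e)⟩
  have := weightPow_le_weightPow hv hvw e
  gcongr

variable [IsUltrametricDist k] [CompleteSpace k]

/-- The deviation of the germ `f` from its normal form vanishes to second order. -/
lemma exists_deviation_series {y : σ → ℕ} {lam : σ → MvPowerSeries σ k} {R : ℝ} {L : σ → ℝ}
    (hR : 0 < R) (hone : ∀ i, y i = 0 → lam i = 1) (hlamL : ∀ i, CoeffBound R (L i) (lam i))
    {f : (σ → k) → σ → k} (hf : AnalyticAt k f 0)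
    (hf0 : ∀ᶠ x in 𝓝 (0 : σ → k), f (gradedScale y 0 x) = gradedScale y 0 x)
    (hfd : ∀ᶠ x in 𝓝 (0 : σ → k), HasFDerivAt f (ContinuousLinearMap.pi fun i =>
      evalSeries (lam i) (gradedScale y 0 x) • ContinuousLinearMap.proj (R := k) (φ := fun _ => k) i)
      (gradedScale y 0 x)) (i : σ) :
    ∃ (g : MvPowerSeries σ k) (R' M : ℝ), 0 < R' ∧ CoeffBound R' M g ∧
      (∀ I, weight y I < 2 → coeff I g = 0) ∧
      ∀ᶠ x in 𝓝 0, f x i = evalSeries (lam i) x * x i + evalSeries g x := by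
  have hlam := (hlamL i).analyticAt hR
  have hG : AnalyticAt k (fun x => f x i - evalSeries (lam i) x * x i) 0 :=
    (analyticAt_pi_iff.mp hf i).sub
      (hlam.mul ((ContinuousLinearMap.proj (R := k) (φ := fun _ : σ => k) i).analyticAt 0))
  have hev1 : y i = 0 → ∀ x, evalSeries (lam i) x = 1 := fun hi x => by
    rw [hone i hi]; exact evalSeries_C 1 x
  have hy0 : y i ≠ 0 → ∀ x : σ → k, gradedScale y 0 x i = 0 := fun hi x => by
    simp [gradedScale, hi]
  obtain ⟨g, R', M, hR', hg, hGg⟩ := hG.exists_evalSeries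
  have htend : Tendsto (fun x : σ → k => gradedScale y 0 x) (𝓝 0) (𝓝 0) :=
    (tendsto_gradedScale_zero y).comp ((Continuous.prodMk_right (0 : k)).tendsto (0 : σ → k))
  refine ⟨g, R', M, hR', hg, fun I hI => ?_, ?_⟩
  · refine coeff_eq_zero_of_vanish hR' hg hGg ?_ ?_ hI
    · filter_upwards [hf0] with x hx
      rw [hx]
      by_cases hi : y i = 0
      · rw [hev1 hi, one_mul, sub_self]
      · rw [hy0 hi, mul_zero, sub_self]
    · filter_upwards [hfd, htend.eventually hlam.eventually_analyticAt] with x hx hx2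
      have d1 := hasFDerivAt_pi'.mp hx i
      have d2 := hx2.differentiableAt.hasFDerivAt
      have d3 : HasFDerivAt (fun x : σ → k => x i)
          (ContinuousLinearMap.proj (R := k) (φ := fun _ : σ => k) i) (gradedScale y 0 x) :=
        (ContinuousLinearMap.proj (R := k) (φ := fun _ : σ => k) i).hasFDerivAt
      refine (d1.sub (d2.mul d3)).congr_fderiv ?_
      rw [ContinuousLinearMap.proj_pi]
      -- The product rule leaves the extra term `x_i d(lam_i)`. It vanishes since either `lam_i` is
      -- constant or `x_i = 0` on the subspace.
      by_cases hi : y i = 0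
      · have : evalSeries (lam i) = fun _ => (1 : k) := funext (hev1 hi)
        rw [this]
        simp
      · rw [hy0 hi, zero_smul, add_zero, sub_self]
  · filter_upwards [hGg] with x hx
    rw [← hx]; ring

/-- Linearization of an analytic germ that is tangent to its normal form along a submanifold of
fixed points, under a small divisor condition. -/
theorem exists_linearizing_germ {y : σ → ℕ} (hy : ∀ i, y i ≤ 1) {R : ℝ} (hR : 0 < R) {L : σ → ℝ}
    {lam : σ → MvPowerSeries σ k} (hL : ∀ i, 0 < L i) (hlam : ∀ i, lam i ∈ paramSubring k y)
    (hone : ∀ i, y i = 0 → lam i = 1) (hlamL : ∀ i, CoeffBound R (L i) (lam i))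
    {K β : ℝ} (hK : 1 ≤ K) (hβ : 0 ≤ β)
    (hdiv : SmallDivisorBound y (fun _ => R) L lam fun s => K * (s : ℝ) ^ β)
    {f : (σ → k) → σ → k} (hf : AnalyticAt k f 0)
    (hf0 : ∀ᶠ x in 𝓝 (0 : σ → k), f (gradedScale y 0 x) = gradedScale y 0 x)
    (hfd : ∀ᶠ x in 𝓝 (0 : σ → k), HasFDerivAt f (ContinuousLinearMap.pi fun i =>
      evalSeries (lam i) (gradedScale y 0 x) • ContinuousLinearMap.proj (R := k) (φ := fun _ => k) i)
      (gradedScale y 0 x)) :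
    ∃ Φ : (σ → k) → σ → k, AnalyticAt k Φ 0 ∧ Φ 0 = 0 ∧ Function.Injective (fderiv k Φ 0) ∧
      ∀ᶠ x in 𝓝 0, ∀ i, Φ (f x) i = evalSeries (lam i) (Φ x) * Φ x i := by
  classical
  choose g Rg Mg hRg hg hgord hgf using exists_deviation_series hR hone hlamL hf hf0 hfd
  obtain ⟨R₀, hR₀, hR₀g⟩ := exists_pos_forall_le hRg
  set R' := min R R₀ with hR'_def
  have hR' : 0 < R' := lt_min hR hR₀
  have hR'R : R' ≤ R := min_le_left _ _
  set M := ∑ i, Mg i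
  have hMg : ∀ i, Mg i ≤ M := fun i =>
    Finset.single_le_sum (f := Mg) (fun j _ => (hg j).nonneg) (Finset.mem_univ i)
  have hg' : ∀ i, CoeffBound R' M (g i) := fun i =>
    ((hg i).anti hR'.le ((min_le_right _ _).trans (hR₀g i))).mono (hMg i)
  have hgG : ∀ i, GaussLE y (fun _ => R') M 2 (g i) := fun i I => by
    rw [weightPow_const]
    exact ⟨hgord i I, hg' i I⟩
  have hlamL' : ∀ i, CoeffBound R' (L i) (lam i) := fun i => (hlamL i).anti hR'.le hR'R
  have hlamG : ∀ i, GaussLE y (fun _ => R') (L i) 0 (lam i) := fun i I => by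
    rw [weightPow_const]
    exact ⟨fun h => absurd h (Nat.not_lt_zero _), hlamL' i I⟩
  obtain ⟨τ, Φ, hτ, hτ1, hΦ, hconj⟩ := exists_normal_form hy (fun _ => hR') hL hlam hone hlamG hK hβ
    (hdiv.anti (fun _ => hR') fun _ => hR'R) hgG
  have hw : ∀ j, 0 < R' * τ ^ y j := fun j => by positivity
  have hρ : 0 < R' * τ := by positivity
  have hρw : ∀ j, R' * τ ≤ R' * τ ^ y j := fun j =>
    mul_le_mul_of_nonneg_left (by simpa using pow_le_pow_of_le_one hτ.le hτ1 (hy j)) hR'.le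
  have hΦb : ∀ i, CoeffBound (R' * τ) R' (Φ i) := by
    intro i
    have h1 := ((hΦ i).mono le_rfl (Nat.le_succ _)).add (GaussLE.X hw i) hw
    rw [sub_add_cancel] at h1
    exact (h1.coeffBound hρ hρw).mono (mul_le_of_le_one_right hR'.le (pow_le_one₀ hτ.le hτ1))
  have hΦ0 : ∀ i, constantCoeff (Φ i) = 0 := fun i => by
    simpa using (hΦ i).constantCoeff_eq_zero (by omega)
  set ff : σ → MvPowerSeries σ k := fun i => lam i * X i + g i with hff
  have hlX : ∀ i, CoeffBound R' (L i * R') (lam i * X i) := fun i =>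
    (hlamL' i).mul hR' (coeffBound_X hR' i)
  set Mf := ∑ i, L i * R' + M
  have hffb : ∀ i, CoeffBound R' Mf (ff i) := by
    intro i
    have h1 : L i * R' ≤ ∑ i, L i * R' :=
      Finset.single_le_sum (f := fun i => L i * R') (fun j _ => (mul_pos (hL j) hR').le)
        (Finset.mem_univ i)
    have h2 : 0 ≤ L i * R' := (mul_pos (hL i) hR').le
    have h3 := (hg' i).nonneg
    exact ((hlX i).mono (by linarith)).add hR' ((hg' i).mono (by linarith))
  have hff0 : ∀ i, constantCoeff (ff i) = 0 := fun i => by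
    simp [hff, (hgG i).constantCoeff_eq_zero (by omega)]
  have hffe : ∀ᶠ x in 𝓝 (0 : σ → k), f x = fun i => evalSeries (ff i) x := by
    filter_upwards [eventually_all.mpr hgf, Metric.ball_mem_nhds (0 : σ → k) hR'] with x hx hx2
    have hx' : ‖x‖ < R' := by simpa using hx2
    funext i
    rw [hx i, hff, evalSeries_add hR' (hlX i) (hg' i) hx',
      evalSeries_mul hR' (hlamL' i) (coeffBound_X hR' i) hx', evalSeries_X]
  have hΦan : AnalyticAt k (fun x i => evalSeries (Φ i) x) 0 :=
    analyticAt_pi_iff.mpr fun i => (hΦb i).analyticAt hρ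
  have hΦz : (fun i => evalSeries (Φ i) 0) = 0 := funext fun i => by
    rw [evalSeries_zero_right, hΦ0, Pi.zero_apply]
  refine ⟨fun x i => evalSeries (Φ i) x, hΦan, hΦz, ?_, ?_⟩
  · have hD : ∀ (v : σ → k) i, fderiv k (fun x i => evalSeries (Φ i) x) 0 v i =
        ∑ j, v j * coeff (single j 1) (Φ i) := by
      intro v i
      have h1 : (fderiv k (fun x i => evalSeries (Φ i) x) 0).comp
          (ContinuousLinearMap.id k (σ → k)) v i = fderiv k (evalSeries (Φ i)) 0 v := by
        rw [fderiv_pi fun i => ((hΦb i).analyticAt hρ).differentiableAt]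
        rfl
      rw [ContinuousLinearMap.comp_id] at h1
      rw [h1, ← Finset.univ_sum_single v, map_sum]
      refine Finset.sum_congr rfl fun j _ => ?_
      have h2 : (Pi.single j (v j) : σ → k) = v j • Pi.single j (1 : k) := by
        rw [← Pi.single_smul, smul_eq_mul, mul_one]
      rw [h2, map_smul, (hΦb i).fderiv_single hρ, smul_eq_mul]
      simp
    -- The linear part of `Φ` is block triangular and unipotent: only a row of degree `0` may
    -- contain additional entries, and these belong to variables of degree `1`.
    have hc : ∀ i j, (y j ≤ y i) → coeff (single j 1) (Φ i) = if j = i then 1 else 0 := by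
      intro i j hij
      have h1 := (hΦ i (single j 1)).1 (by rw [Finsupp.weight_single]; simp; omega)
      rw [map_sub, sub_eq_zero] at h1
      rw [h1, coeff_X]
      simp [Finsupp.single_left_inj]
    rw [injective_iff_map_eq_zero]
    intro v hv
    have hv' : ∀ i, ∑ j, v j * coeff (single j 1) (Φ i) = 0 := fun i => by
      rw [← hD v i, hv, Pi.zero_apply]
    have hv1 : ∀ i, y i ≠ 0 → v i = 0 := by
      intro i hi
      have h1 := hv' i
      rw [Finset.sum_eq_single i] at h1
      · rwa [hc i i le_rfl, if_pos rfl, mul_one] at h1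
      · intro j _ hj
        rw [hc i j (by have := hy j; omega), if_neg hj, mul_zero]
      · simp
    funext i
    by_cases hi : y i = 0
    · have h1 := hv' i
      rw [Finset.sum_eq_single i] at h1
      · rwa [hc i i le_rfl, if_pos rfl, mul_one] at h1
      · intro j _ hj
        by_cases hj0 : y j = 0
        · rw [hc i j (by omega), if_neg hj, mul_zero]
        · rw [hv1 j hj0, zero_mul]
      · simp
    · exact hv1 i hi
  · have hleft : ∀ i, ∀ᶠ x in 𝓝 (0 : σ → k), evalSeries (subst ff (Φ i)) x =
        evalSeries (Φ i) fun i => evalSeries (ff i) x := fun i =>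
      evalSeries_subst hR' hffb hff0 hρ (hΦb i)
    have hright : ∀ i, ∀ᶠ x in 𝓝 (0 : σ → k), evalSeries (subst Φ (lam i * X i)) x =
        evalSeries (lam i * X i) fun i => evalSeries (Φ i) x := fun i =>
      evalSeries_subst hρ hΦb hΦ0 hR' (hlX i)
    have hcont : Tendsto (fun (x : σ → k) i => evalSeries (Φ i) x) (𝓝 0) (𝓝 0) := by
      have := hΦan.continuousAt.tendsto
      rwa [hΦz] at this
    filter_upwards [hffe, eventually_all.mpr hleft, eventually_all.mpr hright,
      hcont (Metric.ball_mem_nhds (0 : σ → k) hR')] with x h1 h2 h3 h4 i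
    have h4' : ‖fun i => evalSeries (Φ i) x‖ < R' := by simpa using h4
    simp only [h1]
    rw [← h2 i, hconj, h3 i, evalSeries_mul hR' (hlamL' i) (coeffBound_X hR' i) h4', evalSeries_X]

end Germ

/-! ### Lower bounds for integers and for powers minus one in an ultrametric field. -/

section FieldEstimates

open MvPowerSeries Finsupp Filter Topology

variable {k : Type*} [NontriviallyNormedField k] [IsUltrametricDist k]

/-- In characteristic zero, the norm of an integer is bounded below by a power. -/
lemma exists_norm_natCast_ge [CharZero k] :
    ∃ β : ℝ, 0 ≤ β ∧ ∀ j : ℕ, 1 ≤ j → (j : ℝ) ^ (-β) ≤ ‖(j : k)‖ := by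
  by_cases h : ∃ p : ℕ, p.Prime ∧ ‖(p : k)‖ < 1
  · obtain ⟨p, hp, hp1⟩ := h
    have hp0 : 0 < ‖(p : k)‖ := norm_pos_iff.mpr (Nat.cast_ne_zero.mpr hp.ne_zero)
    have hlp : 0 < Real.log p := Real.log_pos (by exact_mod_cast hp.one_lt)
    have hpR : (0 : ℝ) < p := by exact_mod_cast hp.pos
    -- The exponent for which `p ^ (-β) = ‖p‖`.
    set β := -Real.log ‖(p : k)‖ / Real.log p with hβ
    have hβ0 : 0 ≤ β := div_nonneg (neg_nonneg.mpr (Real.log_nonpos hp0.le hp1.le)) hlp.le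
    have hpβ : (p : ℝ) ^ (-β) = ‖(p : k)‖ := by
      rw [Real.rpow_def_of_pos hpR, hβ]
      have : Real.log p * -(-Real.log ‖(p : k)‖ / Real.log p) = Real.log ‖(p : k)‖ := by
        field_simp
      rw [this, Real.exp_log hp0]
    refine ⟨β, hβ0, fun j hj => ?_⟩
    -- With `j = p ^ v m` and `m` prime to `p`, Bézout gives `‖m‖ = 1`, so `‖j‖ = ‖p‖ ^ v`, and `p ^
    -- v ≤ j`.
    obtain ⟨v, m, hm, hjm⟩ := Nat.exists_eq_pow_mul_and_not_dvd (Nat.one_le_iff_ne_zero.mp hj) p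
      hp.ne_one
    have hm0 : m ≠ 0 := by rintro rfl; simp at hm
    have hm1 : ‖(m : k)‖ = 1 := by
      refine le_antisymm (IsUltrametricDist.norm_natCast_le_one k m) (not_lt.mp fun hlt => ?_)
      have hcop : Nat.Coprime p m := (Nat.Prime.coprime_iff_not_dvd hp).mpr hm
      have hbez := Nat.gcd_eq_gcd_ab p m
      rw [hcop.gcd_eq_one] at hbez
      have hbk : (1 : k) = p * (p.gcdA m : k) + m * (p.gcdB m : k) := by
        have h2 := congrArg (Int.cast (R := k)) hbez
        push_cast at h2
        exact h2
      have h1 : ‖(1 : k)‖ < 1 := by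
        rw [hbk]
        refine (IsUltrametricDist.norm_add_le_max _ _).trans_lt (max_lt ?_ ?_)
        · rw [norm_mul]
          exact (mul_le_of_le_one_right (norm_nonneg _)
            (IsUltrametricDist.norm_intCast_le_one k _)).trans_lt hp1
        · rw [norm_mul]
          exact (mul_le_of_le_one_right (norm_nonneg _)
            (IsUltrametricDist.norm_intCast_le_one k _)).trans_lt hlt
      simp at h1
    have hle : ((p ^ v : ℕ) : ℝ) ≤ j := by
      exact_mod_cast (hjm ▸ Nat.le_mul_of_pos_right _ (Nat.pos_of_ne_zero hm0))
    calc (j : ℝ) ^ (-β) ≤ ((p ^ v : ℕ) : ℝ) ^ (-β) :=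
          Real.rpow_le_rpow_of_nonpos (by exact_mod_cast pow_pos hp.pos v) hle (by linarith)
      _ = ‖(p : k)‖ ^ v := by
          rw [Nat.cast_pow, ← hpβ, ← Real.rpow_natCast, ← Real.rpow_natCast, ← Real.rpow_mul hpR.le,
            ← Real.rpow_mul hpR.le, mul_comm]
      _ = ‖(j : k)‖ := by rw [hjm, Nat.cast_mul, Nat.cast_pow, norm_mul, hm1, norm_pow, mul_one]
  -- No prime has norm below `1`, so factorization gives every positive integer norm at least `1`.
  · push Not at h
    refine ⟨0, le_rfl, fun j hj => ?_⟩
    rw [neg_zero, Real.rpow_zero]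
    induction j using Nat.strong_induction_on with
    | _ j ih =>
      rcases Nat.lt_or_ge 1 j with h1 | h1
      · obtain ⟨p, hp, m, rfl⟩ := Nat.exists_prime_and_dvd h1.ne'
        have hm : 1 ≤ m := by
          rcases Nat.eq_zero_or_pos m with rfl | hm
          · simp at hj
          · exact hm
        rw [Nat.cast_mul, norm_mul]
        exact one_le_mul_of_one_le_of_one_le (h p hp)
          (ih m (lt_mul_of_one_lt_left hm hp.one_lt) hm)
      · rw [show j = 1 by omega]; simp

/-- In characteristic zero, the norms of the integers decay at most geometrically. -/
lemma exists_pow_le_norm_natCast [CharZero k] :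
    ∃ δ : ℝ, 0 < δ ∧ δ ≤ 1 ∧ ∀ j : ℕ, δ ^ j ≤ ‖((j + 1 : ℕ) : k)‖ := by
  obtain ⟨β, hβ, h⟩ := exists_norm_natCast_ge (k := k)
  refine ⟨(2 : ℝ) ^ (-β), by positivity,
    Real.rpow_le_one_of_one_le_of_nonpos one_le_two (by linarith), fun j => ?_⟩
  refine le_trans ?_ (h (j + 1) (by omega))
  rw [← Real.rpow_natCast, ← Real.rpow_mul zero_le_two, mul_comm, Real.rpow_mul zero_le_two,
    Real.rpow_natCast]
  refine Real.rpow_le_rpow_of_nonpos (by positivity) ?_ (by linarith)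
  have : j + 1 ≤ 2 ^ j := Nat.lt_two_pow_self
  exact_mod_cast this

/-- From `(j + 1) choose(s, j + 1) = s choose(s - 1, j)`: the binomial coefficient is divisible by
`s` up to the denominator `j + 1`, which `δ ^ j` absorbs. This bound is uniform in `s`. -/
lemma norm_choose_mul_le {s j : ℕ} {δ : ℝ} (h : ∀ j : ℕ, δ ^ j ≤ ‖((j + 1 : ℕ) : k)‖) :
    ‖(s.choose (j + 1) : k)‖ * δ ^ j ≤ ‖(s : k)‖ := by
  rcases Nat.eq_zero_or_pos s with rfl | hs
  · simp
  obtain ⟨t, rfl⟩ := Nat.exists_eq_succ_of_ne_zero hs.ne'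
  have h1 := congrArg (fun m : ℕ => ‖(m : k)‖) (Nat.add_one_mul_choose_eq t j)
  simp only [Nat.cast_mul, norm_mul] at h1
  calc ‖((t + 1).choose (j + 1) : k)‖ * δ ^ j
      ≤ ‖((t + 1).choose (j + 1) : k)‖ * ‖((j + 1 : ℕ) : k)‖ :=
        mul_le_mul_of_nonneg_left (h j) (norm_nonneg _)
    _ = ‖((t + 1 : ℕ) : k)‖ * ‖(t.choose j : k)‖ := h1.symm
    _ ≤ ‖((t + 1 : ℕ) : k)‖ :=
        mul_le_of_le_one_right (norm_nonneg _) (IsUltrametricDist.norm_natCast_le_one k _)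

lemma one_add_pow_sub_one {A : Type*} [CommRing A] (t : A) (l : ℕ) :
    (1 + t) ^ l - 1 = ∑ j ∈ Finset.range l, (l.choose (j + 1) : A) * t ^ (j + 1) := by
  rw [add_comm, add_pow, Finset.sum_range_succ']
  simp [mul_comm]

/-- For `‖t‖ < δ` the linear term `l t` of the binomial expansion strictly dominates the others. If
it is zero, nothing is strictly smaller, and all terms vanish together. -/
lemma norm_one_add_pow_sub_one {δ : ℝ} (h : ∀ j : ℕ, δ ^ j ≤ ‖((j + 1 : ℕ) : k)‖) {t : k}
    (ht : ‖t‖ < δ) (l : ℕ) : ‖(1 + t) ^ l - 1‖ = ‖(l : k)‖ * ‖t‖ := by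
  have hδ : 0 < δ := (norm_nonneg t).trans_lt ht
  by_cases h0 : ‖(l : k)‖ * ‖t‖ = 0
  · have hterm : ∀ j, ‖(l.choose (j + 1) : k) * t ^ (j + 1)‖ ≤ ‖(l : k)‖ * ‖t‖ := fun j => by
      rw [norm_mul, norm_pow, pow_succ, ← mul_assoc]
      refine mul_le_mul_of_nonneg_right (le_trans ?_ (norm_choose_mul_le (j := j) h))
        (norm_nonneg _)
      exact mul_le_mul_of_nonneg_left (pow_le_pow_left₀ (norm_nonneg _) ht.le _) (norm_nonneg _)
    refine le_antisymm ?_ (h0 ▸ norm_nonneg _)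
    rw [one_add_pow_sub_one]
    exact IsUltrametricDist.norm_sum_le_of_forall_le_of_nonneg h0.ge fun j _ => hterm j
  · have hpos : 0 < ‖(l : k)‖ * ‖t‖ := lt_of_le_of_ne (by positivity) (Ne.symm h0)
    have ht0 : 0 < ‖t‖ := pos_of_mul_pos_right hpos (norm_nonneg _)
    have hl0 : 0 < ‖(l : k)‖ := pos_of_mul_pos_left hpos (norm_nonneg _)
    have hl : 0 < l := by
      rcases Nat.eq_zero_or_pos l with rfl | hl
      · simp at hl0
      · exact hl
    obtain ⟨m, rfl⟩ := Nat.exists_eq_succ_of_ne_zero hl.ne'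
    rw [one_add_pow_sub_one, Finset.sum_range_succ']
    have hrest : ‖∑ j ∈ Finset.range m, ((m + 1).choose (j + 1 + 1) : k) * t ^ (j + 1 + 1)‖ <
        ‖((m + 1 : ℕ) : k)‖ * ‖t‖ := by
      rcases (Finset.range m).eq_empty_or_nonempty with he | hne
      · rw [he, Finset.sum_empty, norm_zero]; exact hpos
      obtain ⟨j, _, hj⟩ := IsUltrametricDist.exists_norm_finsetSum_le_of_nonempty hne
        fun j => ((m + 1).choose (j + 1 + 1) : k) * t ^ (j + 1 + 1)
      refine hj.trans_lt ?_
      rw [norm_mul, norm_pow, pow_succ, ← mul_assoc]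
      refine mul_lt_mul_of_pos_right ?_ ht0
      by_cases hc : ‖((m + 1).choose (j + 1 + 1) : k)‖ = 0
      · rw [hc, zero_mul]; exact hl0
      · refine lt_of_lt_of_le (mul_lt_mul_of_pos_left (pow_lt_pow_left₀ ht (norm_nonneg _)
          (Nat.succ_ne_zero j)) (lt_of_le_of_ne (norm_nonneg _) (Ne.symm hc)))
          (norm_choose_mul_le h)
    have hmain : ‖((m + 1).choose (0 + 1) : k) * t ^ (0 + 1)‖ = ‖((m + 1 : ℕ) : k)‖ * ‖t‖ := by
      simp
    rw [add_comm, IsUltrametricDist.norm_add_eq_max_of_norm_ne_norm (by rw [hmain]; exact hrest.ne'),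
      hmain, max_eq_left hrest.le]

/-- If `μ` is not a root of unity, then `μ ^ s - 1` is at least comparable to `s`. -/
lemma exists_norm_pow_sub_one_ge [CharZero k] {μ : k} (hμ : ∀ m : ℕ, 0 < m → μ ^ m ≠ 1) :
    ∃ c : ℝ, 0 < c ∧ ∀ s : ℕ, 1 ≤ s → c * ‖(s : k)‖ * max 1 ‖μ ^ s‖ ≤ ‖μ ^ s - 1‖ := by
  have hnat := IsUltrametricDist.norm_natCast_le_one k
  by_cases hμ1 : ‖μ‖ = 1
  · obtain ⟨δ, hδ, hδ1, h⟩ := exists_pow_le_norm_natCast (k := k)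
    have hpow : ∀ s : ℕ, ‖μ ^ s‖ = 1 := fun s => by rw [norm_pow, hμ1, one_pow]
    -- The exponents `s` with `‖μ ^ s - 1‖ < δ` are the multiples of the least positive one, `N`. On
    -- these the norm is `‖s / N‖ ‖μ ^ N - 1‖`, nonzero in characteristic `0` for `s > 0`.
    by_cases hex : ∃ N : ℕ, 0 < N ∧ ‖μ ^ N - 1‖ < δ
    · classical
      set N := Nat.find hex
      obtain ⟨hN, hNδ⟩ : 0 < N ∧ ‖μ ^ N - 1‖ < δ := Nat.find_spec hex
      have hmin : ∀ m < N, ¬ (0 < m ∧ ‖μ ^ m - 1‖ < δ) := fun m hm => Nat.find_min hex hm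
      set t := μ ^ N - 1 with ht
      have ht0 : 0 < ‖t‖ := norm_pos_iff.mpr (sub_ne_zero.mpr (hμ N hN))
      have hμN : ∀ l, ‖μ ^ (N * l) - 1‖ = ‖(l : k)‖ * ‖t‖ := fun l => by
        rw [← norm_one_add_pow_sub_one h hNδ, ht, add_sub_cancel, pow_mul]
      refine ⟨min δ ‖t‖, lt_min hδ ht0, fun s hs => ?_⟩
      rw [hpow, max_self, mul_one]
      by_cases hsδ : ‖μ ^ s - 1‖ < δ
      · have hdm := Nat.div_add_mod s N
        -- A nonzero remainder would be a smaller exponent with the same property, by the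
        -- ultrametric inequality and `‖μ‖ = 1`.
        have hr : s % N = 0 := by
          by_contra hr
          refine hmin _ (Nat.mod_lt s hN) ⟨Nat.pos_of_ne_zero hr, ?_⟩
          have e1 : μ ^ (N * (s / N)) * (μ ^ (s % N) - 1) =
              (μ ^ s - 1) - (μ ^ (N * (s / N)) - 1) := by
            rw [mul_sub, ← pow_add, hdm]; ring
          have e2 := congrArg norm e1
          rw [norm_mul, hpow, one_mul] at e2
          rw [e2, sub_eq_add_neg]
          refine (IsUltrametricDist.norm_add_le_max _ _).trans_lt (max_lt hsδ ?_)
          rw [norm_neg, hμN]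
          exact (mul_le_of_le_one_left (norm_nonneg _) (hnat _)).trans_lt hNδ
        rw [hr, add_zero] at hdm
        rw [← hdm, hμN, Nat.cast_mul, norm_mul]
        calc min δ ‖t‖ * (‖(N : k)‖ * ‖((s / N : ℕ) : k)‖)
            ≤ ‖t‖ * (1 * ‖((s / N : ℕ) : k)‖) := by
              gcongr
              · exact min_le_right _ _
              · exact hnat N
          _ = _ := by ring
      · calc min δ ‖t‖ * ‖(s : k)‖ ≤ δ * 1 := by
              gcongr
              · exact min_le_left _ _
              · exact hnat s
          _ ≤ _ := by rw [mul_one]; exact not_lt.mp hsδ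
    · push Not at hex
      refine ⟨δ, hδ, fun s hs => ?_⟩
      rw [hpow, max_self, mul_one]
      exact (mul_le_of_le_one_right hδ.le (hnat s)).trans (hex s hs)
  · refine ⟨1, one_pos, fun s hs => ?_⟩
    have hne : ‖μ ^ s‖ ≠ ‖(1 : k)‖ := by
      rw [norm_pow, norm_one]
      intro h
      exact hμ1 ((pow_eq_one_iff_of_nonneg (norm_nonneg _) (by omega)).mp h)
    rw [sub_eq_add_neg, IsUltrametricDist.norm_add_eq_max_of_norm_ne_norm (by rwa [norm_neg]),
      norm_neg, norm_one, one_mul, max_comm]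
    exact mul_le_of_le_one_left (by positivity) (hnat s)

end FieldEstimates

/-! ### Small divisor bounds in the two cases. -/

section SmallDivisors

open MvPowerSeries Finsupp Filter Topology

variable {σ : Type*} [Fintype σ] {k : Type*} [NontriviallyNormedField k] {y : σ → ℕ}
  {lam : σ → MvPowerSeries σ k}

lemma constantCoeff_lamPow (I : σ →₀ ℕ) :
    constantCoeff (lamPow lam I) = ∏ i, constantCoeff (lam i) ^ I i := by
  simp [lamPow, map_prod]

/-- A lower bound for the constant terms of the divisors yields a small divisor bound, provided that
the inverses of the divisors are dominated by their constant terms. -/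
lemma exists_smallDivisorBound {R C β : ℝ} (hC : 0 < C) (hβ : 0 ≤ β)
    (h1 : ∀ i I, y i + 1 ≤ weight y I →
      C * (weight y I : ℝ) ^ (-β) ≤ ‖constantCoeff (lamPow lam I - lam i)‖)
    (h2 : ∀ i I, y i + 1 ≤ weight y I →
      CoeffBound R ‖constantCoeff (lamPow lam I - lam i)‖⁻¹ (lamPow lam I - lam i)⁻¹) :
    ∃ K : ℝ, 1 ≤ K ∧ SmallDivisorBound y (fun _ => R) (fun i => ‖constantCoeff (lam i)‖) lam
      fun s => K * (s : ℝ) ^ β := by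
  set Λ := ∑ i, ‖constantCoeff (lam i)‖
  have hΛ0 : 0 ≤ Λ := Finset.sum_nonneg fun i _ => norm_nonneg _
  have hΛ : ∀ i, ‖constantCoeff (lam i)‖ ≤ Λ := fun i =>
    Finset.single_le_sum (f := fun i => ‖constantCoeff (lam i)‖) (fun j _ => norm_nonneg _)
      (Finset.mem_univ i)
  refine ⟨(1 + Λ) / C + 1, by have : 0 ≤ (1 + Λ) / C := by positivity
                              linarith, fun i I hI => ?_⟩
  set s : ℝ := (weight y I : ℝ) with hs
  have hs1 : 1 ≤ s := by rw [hs]; exact_mod_cast (by omega : 1 ≤ weight y I)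
  have hs0 : 0 < s := by linarith
  set c := constantCoeff (lamPow lam I - lam i) with hc
  have hlow : C * s ^ (-β) ≤ ‖c‖ := h1 i I hI
  have hcpos : 0 < ‖c‖ := lt_of_lt_of_le (by positivity) hlow
  have hsβ : 1 ≤ s ^ β := Real.one_le_rpow hs1 hβ
  have hinv : ‖c‖⁻¹ ≤ s ^ β / C := by
    rw [inv_le_comm₀ hcpos (by positivity), inv_div, div_eq_mul_inv, ← Real.rpow_neg hs0.le]
    exact hlow
  -- A large `L ^ I` is harmless: `L ^ I` is the norm of the constant term of `lam ^ I`, hence at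
  -- most the divisor plus `Λ`. After division by `‖c‖` this gives the constant `(1 + Λ) / C + 1`.
  have hpow : weightPow (fun i => ‖constantCoeff (lam i)‖) I ≤ ‖c‖ + Λ := by
    have e1 : weightPow (fun i => ‖constantCoeff (lam i)‖) I = ‖constantCoeff (lamPow lam I)‖ := by
      rw [constantCoeff_lamPow, norm_prod, weightPow]
      simp
    rw [e1]
    have e2 : constantCoeff (lamPow lam I) = c + constantCoeff (lam i) := by
      rw [hc, map_sub, sub_add_cancel]
    rw [e2]
    exact (norm_add_le _ _).trans (by linarith [hΛ i])
  refine ⟨norm_pos_iff.mp hcpos, fun e => ?_⟩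
  have hcoef : ‖coeff e (lamPow lam I - lam i)⁻¹‖ * weightPow (fun _ => R) e ≤ ‖c‖⁻¹ := by
    rw [weightPow_const]; exact h2 i I hI e
  calc _ ≤ ‖c‖⁻¹ * (1 + Λ + ‖c‖) := by
        refine mul_le_mul hcoef (max_le (by linarith) (by linarith)) (by positivity) (by positivity)
    _ = ‖c‖⁻¹ * (1 + Λ) + 1 := by field_simp
    _ ≤ s ^ β / C * (1 + Λ) + s ^ β := by gcongr
    _ = ((1 + Λ) / C + 1) * s ^ β := by ring

omit [Fintype σ] in
lemma coeffBound_C {R M : ℝ} {c : k} (hc : ‖c‖ ≤ M) :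
    CoeffBound R M (C c : MvPowerSeries σ k) := by
  classical
  intro I
  rw [coeff_C]
  split_ifs with h
  · simpa [h] using hc
  · simpa using (norm_nonneg c).trans hc

omit [Fintype σ] in
lemma C_mem_paramSubring (c : k) : (C c : MvPowerSeries σ k) ∈ paramSubring k y := by
  classical
  intro I hI
  rw [coeff_C, if_neg]
  rintro rfl
  simp at hI

/-- The small divisor bound for constant eigenvalues. -/
lemma exists_smallDivisorBound_const {c : σ → k} {C β : ℝ} (hC : 0 < C) (hβ : 0 ≤ β)
    (h : ∀ i (I : σ →₀ ℕ), y i + 1 ≤ weight y I →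
      C * (weight y I : ℝ) ^ (-β) ≤ ‖(∏ j, c j ^ I j) - c i‖) :
    ∃ K : ℝ, 1 ≤ K ∧ SmallDivisorBound y (fun _ => (1 : ℝ)) (fun i => ‖c i‖)
      (fun i => MvPowerSeries.C (c i)) fun s => K * (s : ℝ) ^ β := by
  have e1 : ∀ (I : σ →₀ ℕ) i, lamPow (fun i => MvPowerSeries.C (σ := σ) (c i)) I -
      MvPowerSeries.C (c i) = MvPowerSeries.C ((∏ j, c j ^ I j) - c i) := by
    intro I i
    simp [lamPow, map_prod]
  have := exists_smallDivisorBound (y := y) (lam := fun i => MvPowerSeries.C (c i)) (R := 1)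
    (C := C) (β := β) hC hβ (fun i I hI => ?_) (fun i I hI => ?_)
  · simpa using this
  · rw [e1, constantCoeff_C]; exact h i I hI
  · rw [e1, constantCoeff_C, MvPowerSeries.C_inv]
    exact coeffBound_C (norm_inv _).le

variable [IsUltrametricDist k]

/-- A series dominated by its constant term has an inverse dominated by its constant term. -/
lemma CoeffBound.inv {R : ℝ} (hR : 0 < R) {F : MvPowerSeries σ k}
    (h : CoeffBound R ‖constantCoeff F‖ F) : CoeffBound R ‖constantCoeff F‖⁻¹ F⁻¹ := by
  classical
  intro I
  induction I using WellFoundedLT.induction with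
  | ind I ih =>
    rw [coeff_inv]
    split_ifs with hI
    · simp [hI]
    · rw [norm_mul, norm_neg, norm_inv, mul_assoc]
      refine mul_le_of_le_one_right (by positivity) ?_
      rw [← le_div_iff₀ (by positivity)]
      refine IsUltrametricDist.norm_sum_le_of_forall_le_of_nonneg (by positivity) fun p hp => ?_
      split_ifs with hlt
      · rw [le_div_iff₀ (by positivity), ← Finset.HasAntidiagonal.mem_antidiagonal.mp hp, map_add,
          pow_add, norm_mul]
        calc _ = (‖coeff p.1 F‖ * R ^ p.1.degree) * (‖coeff p.2 F⁻¹‖ * R ^ p.2.degree) := by ring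
          _ ≤ ‖constantCoeff F‖ * ‖constantCoeff F‖⁻¹ :=
            mul_le_mul (h _) (ih _ hlt) (by positivity) (norm_nonneg _)
          _ ≤ 1 := mul_inv_le_one
      · rw [norm_zero]; positivity

omit [IsUltrametricDist k] in
lemma CoeffBound.C_mul {R M : ℝ} {F : MvPowerSeries σ k} (c : k) (h : CoeffBound R M F) :
    CoeffBound R (‖c‖ * M) (MvPowerSeries.C c * F) := by
  rw [coeffBound_iff_gaussLE] at *
  exact GaussLE.C_mul c h

lemma CoeffBound.pow {R M : ℝ} (hR : 0 < R) {F : MvPowerSeries σ k} (h : CoeffBound R M F) (n : ℕ) :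
    CoeffBound R (M ^ n) (F ^ n) := by
  induction n with
  | zero => simpa using coeffBound_one
  | succ n ih => rw [pow_succ, pow_succ]; exact ih.mul hR h

/-- The bound on binomial coefficients again, now for Gauss norms: one `δ` is kept and the remaining
`δ ^ j` absorbs the denominator. -/
lemma coeffBound_one_add_pow_sub_one {R δ : ℝ} (hR : 0 < R)
    (hδ : ∀ j : ℕ, δ ^ j ≤ ‖((j + 1 : ℕ) : k)‖) {ν : MvPowerSeries σ k} (hν : CoeffBound R δ ν)
    (l : ℕ) : CoeffBound R (‖(l : k)‖ * δ) ((1 + ν) ^ l - 1) := by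
  have hδ0 : 0 ≤ δ := hν.nonneg
  rw [one_add_pow_sub_one, coeffBound_iff_gaussLE]
  refine GaussLE.sum (fun _ => hR) (by positivity) fun j _ => ?_
  rw [← coeffBound_iff_gaussLE, ← map_natCast (MvPowerSeries.C (σ := σ) (R := k))]
  refine ((hν.pow hR (j + 1)).C_mul _).mono ?_
  rw [pow_succ, ← mul_assoc]
  exact mul_le_mul_of_nonneg_right (norm_choose_mul_le hδ) hδ0

/-- The small divisor bound for a single varying eigenvalue that is not a root of unity, in
characteristic zero. -/
lemma exists_smallDivisorBound_pow [CharZero k] {μ : k} (hμ0 : μ ≠ 0)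
    (hμ : ∀ m : ℕ, 0 < m → μ ^ m ≠ 1) :
    ∃ δ β : ℝ, 0 < δ ∧ δ ≤ 1 ∧ 0 ≤ β ∧ ∀ (y : σ → ℕ) (F : MvPowerSeries σ k) (R : ℝ), 0 < R →
      (∀ i, y i ≤ 1) → constantCoeff F = μ → CoeffBound R (δ * ‖μ‖) (F - C μ) →
      ∃ K : ℝ, 1 ≤ K ∧ SmallDivisorBound y (fun _ => R) (fun i => ‖constantCoeff (F ^ y i)‖)
        (fun i => F ^ y i) fun s => K * (s : ℝ) ^ β := by
  obtain ⟨c, hc, hcs⟩ := exists_norm_pow_sub_one_ge hμ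
  obtain ⟨δ₀, hδ₀, hδ₀1, hδ⟩ := exists_pow_le_norm_natCast (k := k)
  obtain ⟨β, hβ, hβj⟩ := exists_norm_natCast_ge (k := k)
  have hμn : 0 < ‖μ‖ := norm_pos_iff.mpr hμ0
  -- `δ` and `β` depend on `μ` only, so the radius on which `F` is close to `μ` can be chosen
  -- afterwards.
  refine ⟨min δ₀ c, β, lt_min hδ₀ hc, (min_le_left _ _).trans hδ₀1, hβ,
    fun y F R hR hy hF0 hFb => ?_⟩
  set δ := min δ₀ c with hδdef
  have hδpos : 0 < δ := lt_min hδ₀ hc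
  have hδj : ∀ j : ℕ, δ ^ j ≤ ‖((j + 1 : ℕ) : k)‖ := fun j =>
    (pow_le_pow_left₀ hδpos.le (min_le_left _ _) j).trans (hδ j)
  have hδ1 : δ ≤ 1 := (min_le_left _ _).trans hδ₀1
  set ν : MvPowerSeries σ k := C μ⁻¹ * (F - C μ) with hν
  have hνb : CoeffBound R δ ν := by
    refine (hFb.C_mul μ⁻¹).mono (le_of_eq ?_)
    rw [norm_inv]; field_simp
  have hCC : (C μ : MvPowerSeries σ k) * C μ⁻¹ = 1 := by
    rw [← map_mul, mul_inv_cancel₀ hμ0, map_one]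
  have hFν : F = C μ * (1 + ν) := by
    rw [hν, mul_add, ← mul_assoc, hCC]; ring
  have hFbound : CoeffBound R ‖μ‖ F := by
    have h1 := (hFb.mono (mul_le_of_le_one_left hμn.le hδ1)).add hR (coeffBound_C le_rfl)
    rwa [sub_add_cancel] at h1
  have hpowc : ∀ t : ℕ, constantCoeff (F ^ t - 1) = μ ^ t - 1 := fun t => by simp [hF0]
  -- Write `F = μ (1 + ν)`. Then `F ^ t - 1` is its constant term plus `μ ^ t ((1 + ν) ^ t - 1)`, of
  -- size at most `‖μ ^ t‖ ‖t‖ δ`. The choice `δ ≤ c` makes this no larger than `‖μ ^ t - 1‖`, for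
  -- all `t` on the same radius.
  have hpowb : ∀ t : ℕ, 1 ≤ t → CoeffBound R ‖constantCoeff (F ^ t - 1)‖ (F ^ t - 1) := by
    intro t ht
    have e1 : F ^ t - 1 = C (μ ^ t) * ((1 + ν) ^ t - 1) + C (μ ^ t - 1) := by
      rw [hFν, mul_pow, map_sub, map_pow, map_one]; ring
    rw [hpowc, e1]
    refine CoeffBound.add hR (((coeffBound_one_add_pow_sub_one hR hδj hνb t).C_mul _).mono ?_)
      (coeffBound_C le_rfl)
    calc ‖μ ^ t‖ * (‖(t : k)‖ * δ) ≤ max 1 ‖μ ^ t‖ * (‖(t : k)‖ * c) := by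
          gcongr
          · exact le_max_right _ _
          · exact min_le_right _ _
      _ = c * ‖(t : k)‖ * max 1 ‖μ ^ t‖ := by ring
      _ ≤ _ := hcs t ht
  have hlamPow : ∀ I : σ →₀ ℕ, lamPow (fun i => F ^ y i) I = F ^ weight y I := by
    intro I
    simp only [lamPow, ← pow_mul]
    rw [Finset.prod_pow_eq_pow_sum, weight_eq_sum_mul]
    simp only [mul_comm]
  have hdivisor : ∀ i (I : σ →₀ ℕ), y i + 1 ≤ weight y I →
      lamPow (fun i => F ^ y i) I - F ^ y i = F ^ y i * (F ^ (weight y I - y i) - 1) := by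
    intro i I hI
    rw [hlamPow, mul_sub, ← pow_add, Nat.add_sub_cancel' (by omega), mul_one]
  refine exists_smallDivisorBound (C := min 1 ‖μ‖ * c) (by positivity) hβ ?_ ?_
  · intro i I hI
    rw [hdivisor i I hI, map_mul, hpowc, norm_mul, map_pow, hF0, norm_pow]
    set t := weight y I - y i
    have ht : 1 ≤ t := by omega
    have h1 : min 1 ‖μ‖ ≤ ‖μ‖ ^ y i := by
      rcases (show y i = 0 ∨ y i = 1 by have := hy i; omega) with h | h
      · rw [h, pow_zero]; exact min_le_left _ _
      · rw [h, pow_one]; exact min_le_right _ _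
    have h2 : ((weight y I : ℕ) : ℝ) ^ (-β) ≤ (t : ℝ) ^ (-β) :=
      Real.rpow_le_rpow_of_nonpos (by exact_mod_cast ht)
        (by exact_mod_cast Nat.sub_le _ _) (by linarith)
    have h3 : c * (t : ℝ) ^ (-β) ≤ ‖μ ^ t - 1‖ := by
      refine le_trans ?_ (hcs t ht)
      calc c * (t : ℝ) ^ (-β) ≤ c * ‖(t : k)‖ := mul_le_mul_of_nonneg_left (hβj t ht) hc.le
        _ ≤ _ := le_mul_of_one_le_right (by positivity) (le_max_left _ _)
    calc min 1 ‖μ‖ * c * ((weight y I : ℕ) : ℝ) ^ (-β) ≤ min 1 ‖μ‖ * (c * (t : ℝ) ^ (-β)) := by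
          rw [mul_assoc]; gcongr
      _ ≤ _ := mul_le_mul h1 h3 (by positivity) (by positivity)
  · intro i I hI
    rw [hdivisor i I hI, MvPowerSeries.mul_inv_rev, map_mul, norm_mul, mul_inv_rev]
    refine CoeffBound.mul hR ((hpowb _ (by omega)).inv hR) (CoeffBound.inv hR ?_)
    rw [map_pow, hF0, norm_pow]
    exact hFbound.pow hR _

end SmallDivisors

/-! ### Diagonalization of semisimple endomorphisms with split characteristic polynomial. -/

section SemisimpleLinearAlgebra

open Polynomial

variable {k : Type*} [Field k] {M : Type*} [AddCommGroup M] [Module k M]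

/-- A semisimple endomorphism is annihilated by the product of the distinct linear factors of its
characteristic polynomial. -/
lemma aeval_prod_X_sub_C_eq_zero [FiniteDimensional k M] {ι κ : Type*} [Fintype ι] [Fintype κ]
    {A : Module.End k M} (hA : A.IsSemisimple) {e : κ → k} {a : ι → κ}
    (hch : LinearMap.charpoly A = ∏ i, (X - C (e (a i)))) :
    aeval A (∏ b, (X - C (e b))) = 0 := by
  have h1 : minpoly k A ∣ (∏ b, (X - C (e b))) ^ Fintype.card ι := by
    refine (LinearMap.minpoly_dvd_charpoly A).trans ?_
    rw [hch, ← Finset.card_univ, ← Finset.prod_const]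
    exact Finset.prod_dvd_prod_of_dvd _ _ fun i _ => Finset.dvd_prod_of_mem _ (Finset.mem_univ _)
  have h2 : minpoly k A ∣ ∏ b, (X - C (e b)) := by
    rcases eq_or_ne (Fintype.card ι) 0 with h0 | h0
    · rw [h0, pow_zero] at h1
      exact h1.trans (one_dvd _)
    · exact (hA.minpoly_squarefree.dvd_pow_iff_dvd h0).mp h1
  obtain ⟨c, hc⟩ := h2
  rw [hc, map_mul, minpoly.aeval, zero_mul]

lemma ker_aeval_prod_le_iSup_eigenspace {κ : Type*} (A : Module.End k M) {e : κ → k}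
    (he : Function.Injective e) (s : Finset κ) :
    LinearMap.ker (aeval A (∏ b ∈ s, (X - C (e b)))) ≤ ⨆ b, A.eigenspace (e b) := by
  classical
  induction s using Finset.induction_on with
  | empty => simp [Module.End.one_eq_id]
  | insert b s hb ih =>
    rw [Finset.prod_insert hb, ← sup_ker_aeval_eq_ker_aeval_mul_of_coprime A
      (IsCoprime.prod_right fun c hc => isCoprime_X_sub_C_of_isUnit_sub
        (sub_ne_zero.mpr fun h => hb (by rwa [he h])).isUnit)]
    refine sup_le (le_iSup_of_le b fun x hx => ?_) ih
    rw [Module.End.mem_eigenspace_iff]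
    simpa [sub_eq_zero, Module.algebraMap_end_apply] using hx

/-- An endomorphism annihilated by a split squarefree polynomial has an eigenbasis. -/
lemma exists_eigenbasis [FiniteDimensional k M] {κ ι : Type*} [Fintype κ] [Fintype ι]
    (A : Module.End k M) {e : κ → k} (he : Function.Injective e)
    (hA : aeval A (∏ b, (X - C (e b))) = 0) (hι : Module.finrank k M = Fintype.card ι) :
    ∃ (b : Module.Basis ι k M) (d : ι → k), ∀ i, A (b i) = d i • b i := by
  classical
  have htop : ⨆ b, A.eigenspace (e b) = ⊤ := by
    refine top_le_iff.mp (le_trans ?_ (ker_aeval_prod_le_iSup_eigenspace A he Finset.univ))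
    rw [hA, LinearMap.ker_zero]
  have hint : DirectSum.IsInternal fun b => A.eigenspace (e b) :=
    DirectSum.isInternal_submodule_of_iSupIndep_of_iSup_eq_top
      (A.eigenspaces_iSupIndep.comp he) htop
  let B := hint.collectedBasis fun b => Module.finBasis k (A.eigenspace (e b))
  have hcard : Fintype.card (Σ b, Fin (Module.finrank k (A.eigenspace (e b)))) =
      Fintype.card ι := by
    rw [← hι, Module.finrank_eq_card_basis B]
  let E := Fintype.equivOfCardEq hcard
  refine ⟨B.reindex E, fun i => e (E.symm i).1, fun i => ?_⟩
  rw [Module.Basis.reindex_apply]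
  exact Module.End.mem_eigenspace_iff.mp (hint.collectedBasis_mem _ _)

lemma roots_prod_X_sub_C_univ {ι : Type*} [Fintype ι] (c : ι → k) :
    (∏ i, (X - C (c i))).roots = Finset.univ.val.map c := by
  rw [← Polynomial.roots_multiset_prod_X_sub_C (Finset.univ.val.map c), Multiset.map_map]
  rfl

lemma trace_eq_sum_of_charpoly_eq [FiniteDimensional k M] {ι : Type*} [Fintype ι]
    {A : Module.End k M} {c : ι → k} (h : LinearMap.charpoly A = ∏ i, (X - C (c i))) :
    LinearMap.trace k M A = ∑ i, c i := by
  rw [Module.End.trace_eq_sum_roots_charpoly_of_splits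
    (h ▸ Splits.prod fun i _ => Splits.X_sub_C (c i)), h, roots_prod_X_sub_C_univ]
  rfl

/-- Equal root multisets have fibres of equal size. This reorders an eigenbasis so that its
eigenvalues appear in a prescribed order. -/
lemma exists_perm_of_prod_X_sub_C_eq {ι : Type*} [Fintype ι] {c d : ι → k}
    (h : ∏ i, (X - C (c i)) = ∏ i, (X - C (d i))) : ∃ p : Equiv.Perm ι, ∀ i, d (p i) = c i := by
  classical
  have h2 : Finset.univ.val.map c = Finset.univ.val.map d := by
    rw [← roots_prod_X_sub_C_univ, ← roots_prod_X_sub_C_univ, h]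
  have h3 : ∀ (c : ι → k) (x : k), Fintype.card {i // c i = x} =
      (Finset.univ.val.map c).count x := fun c x => by
    rw [Multiset.count_map, Fintype.card_subtype]
    simp only [eq_comm]
    rfl
  have h4 : ∀ x, Nonempty ({i // c i = x} ≃ {i // d i = x}) := fun x =>
    Fintype.card_eq.mp (by rw [h3, h3, h2])
  let E := fun x => (h4 x).some
  refine ⟨Equiv.ofFiberEquiv E, fun i => Equiv.ofFiberEquiv_map E i⟩

lemma charpoly_of_eigenbasis [FiniteDimensional k M] {ι : Type*} [Fintype ι] {A : Module.End k M}
    (b : Module.Basis ι k M) {d : ι → k} (h : ∀ i, A (b i) = d i • b i) :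
    LinearMap.charpoly A = ∏ i, (X - C (d i)) := by
  classical
  rw [← LinearMap.charpoly_toMatrix A b]
  have : LinearMap.toMatrix b b A = Matrix.diagonal d := by
    ext i j
    rw [LinearMap.toMatrix_apply, h, map_smul, Module.Basis.repr_self, Finsupp.smul_apply,
      Finsupp.single_apply, Matrix.diagonal_apply, smul_eq_mul]
    by_cases hij : i = j
    · subst hij; simp
    · simp [hij, Ne.symm hij]
  rw [this, Matrix.charpoly_diagonal]

/-- Diagonalization of a semisimple endomorphism of `k^ι` which preserves the coordinate subspace
on which the endomorphism is the identity. -/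
lemma exists_diagonalization {ι : Type*} [Fintype ι]
    {A : Module.End k (ι → k)} (hA : A.IsSemisimple) {c : ι → k} {s : Set ι}
    (hch : LinearMap.charpoly A = ∏ i, (X - C (c i))) (hc : ∀ i ∈ s, c i ≠ 1)
    (hfix : ∀ v : ι → k, (∀ i ∈ s, v i = 0) → A v = v) :
    ∃ L : (ι → k) ≃ₗ[k] (ι → k), (∀ v i, L (A v) i = c i * L v i) ∧
      ∀ v : ι → k, (∀ i ∈ s, v i = 0) → ∀ i ∈ s, L.symm v i = 0 := by
  classical
  let a : ι → Set.range c := fun i => ⟨c i, i, rfl⟩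
  have hfin : Fintype (Set.range c) := Fintype.ofFinite _
  have hann := aeval_prod_X_sub_C_eq_zero (e := fun x : Set.range c => (x : k)) (a := a) hA hch
  obtain ⟨b, d, hb⟩ := exists_eigenbasis (ι := ι) A Subtype.val_injective hann (by simp)
  have hcd := charpoly_of_eigenbasis b hb
  obtain ⟨p, hp⟩ := exists_perm_of_prod_X_sub_C_eq (hch.symm.trans hcd)
  let b' := b.reindex p.symm
  have hb' : ∀ i, A (b' i) = c i • b' i := fun i => by
    simp only [b', Module.Basis.reindex_apply, Equiv.symm_symm, hb, hp]
  have hL : ∀ v i, b'.equivFun (A v) i = c i * b'.equivFun v i := by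
    intro v i
    have h1 : (b'.equivFun : (ι → k) →ₗ[k] ι → k) ∘ₗ A =
        LinearMap.pi (fun i => c i • LinearMap.proj i) ∘ₗ (b'.equivFun : (ι → k) →ₗ[k] ι → k) := by
      refine b'.ext fun j => ?_
      ext i
      simp only [LinearMap.comp_apply, hb', map_smul, LinearEquiv.coe_coe,
        Module.Basis.equivFun_self, Pi.smul_apply, LinearMap.pi_apply, LinearMap.smul_apply,
        LinearMap.proj_apply, smul_eq_mul]
      by_cases hij : j = i
      · subst hij; rfl
      · simp [hij]
    exact congr_fun (LinearMap.congr_fun h1 v) i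
  refine ⟨b'.equivFun, hL, ?_⟩
  let V : Submodule k (ι → k) := ⨅ i : s, LinearMap.ker (LinearMap.proj (R := k) (φ := fun _ : ι => k) i.1)
  have hV : ∀ v, v ∈ V ↔ ∀ i ∈ s, v i = 0 := fun v => by
    simp [V, Submodule.mem_iInf]
  -- A fixed vector `v` satisfies `(c_i - 1) (L v)_i = 0`, so `L` maps the subspace `V` into itself,
  -- hence onto itself by dimension. Only the latter gives the statement for `L.symm`.
  have hle : V.map (b'.equivFun : (ι → k) →ₗ[k] ι → k) ≤ V := by
    rintro _ ⟨v, hv, rfl⟩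
    rw [hV]
    intro i hi
    have h1 := hL v i
    rw [hfix v ((hV v).mp hv)] at h1
    have h2 : (c i - 1) * b'.equivFun v i = 0 := by rw [sub_mul, ← h1, one_mul, sub_self]
    exact (mul_eq_zero.mp h2).resolve_left (sub_ne_zero.mpr (hc i hi))
  have heq := Submodule.eq_of_le_of_finrank_eq hle (LinearEquiv.finrank_map_eq b'.equivFun V)
  intro v hv
  have hv' := (hV v).mpr hv
  rw [← heq] at hv'
  obtain ⟨u, hu, rfl⟩ := hv'
  rw [LinearEquiv.coe_coe, LinearEquiv.symm_apply_apply]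
  exact (hV u).mp hu

end SemisimpleLinearAlgebra

/-! ### Germs of analytic charts and conjugation of derivatives. -/

section CenteredChart

open Filter Topology

variable {k : Type*} [NontriviallyNormedField k] {E : Type*} [NormedAddCommGroup E]
  [NormedSpace k E]

/-- The germ at `q` of an analytic coordinate system `θ` centred at `q`, with inverse `ψ`. -/
structure IsCenteredChart (k : Type*) [NontriviallyNormedField k] {E : Type*}
    [NormedAddCommGroup E] [NormedSpace k E] (θ ψ : E → E) (q : E) : Prop where
  analyticAt : AnalyticAt k θ q
  analyticAt_inv : AnalyticAt k ψ 0
  map_center : θ q = 0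
  inv_zero : ψ 0 = q
  left_inv : ∀ᶠ x in 𝓝 q, ψ (θ x) = x
  right_inv : ∀ᶠ z in 𝓝 0, θ (ψ z) = z

namespace IsCenteredChart

variable {θ ψ : E → E} {q : E}

lemma tendsto (h : IsCenteredChart k θ ψ q) : Tendsto θ (𝓝 q) (𝓝 0) := by
  simpa [h.map_center] using h.analyticAt.continuousAt.tendsto

lemma tendsto_inv (h : IsCenteredChart k θ ψ q) : Tendsto ψ (𝓝 0) (𝓝 q) := by
  simpa [h.inv_zero] using h.analyticAt_inv.continuousAt.tendsto

lemma comp {χ ω : E → E} (h : IsCenteredChart k θ ψ q) (h' : IsCenteredChart k χ ω 0) :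
    IsCenteredChart k (χ ∘ θ) (ψ ∘ ω) q where
  analyticAt := AnalyticAt.comp_of_eq h'.analyticAt h.analyticAt h.map_center
  analyticAt_inv := AnalyticAt.comp_of_eq h.analyticAt_inv h'.analyticAt_inv h'.inv_zero
  map_center := by simp [h.map_center, h'.map_center]
  inv_zero := by simp [h.inv_zero, h'.inv_zero]
  left_inv := by
    filter_upwards [h.left_inv, h.tendsto.eventually h'.left_inv] with x h1 h2
    simp [h1, h2]
  right_inv := by
    filter_upwards [h'.right_inv, h'.tendsto_inv.eventually h.right_inv] with x h1 h2
    simp [h1, h2]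

lemma of_continuousLinearEquiv (L : E ≃L[k] E) : IsCenteredChart k L L.symm 0 where
  analyticAt := L.toContinuousLinearMap.analyticAt 0
  analyticAt_inv := L.symm.toContinuousLinearMap.analyticAt 0
  map_center := map_zero L
  inv_zero := map_zero L.symm
  left_inv := Eventually.of_forall L.symm_apply_apply
  right_inv := Eventually.of_forall L.apply_symm_apply

/-- Near a fixed point, the derivative of a map in a chart is conjugate to its derivative. -/
lemma eventually_hasFDerivAt_conj [CompleteSpace E] (h : IsCenteredChart k θ ψ q) {f : E → E}
    (hf : AnalyticAt k f q) :
    ∀ᶠ z in 𝓝 0, f (ψ z) = ψ z → ∃ e : E ≃L[k] E, HasFDerivAt θ (e : E →L[k] E) (ψ z) ∧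
      HasFDerivAt (θ ∘ f ∘ ψ) ((e : E →L[k] E) ∘L fderiv k f (ψ z) ∘L (e.symm : E →L[k] E)) z := by
  filter_upwards [h.analyticAt_inv.eventually_analyticAt,
    h.tendsto_inv.eventually h.analyticAt.eventually_analyticAt,
    h.tendsto_inv.eventually hf.eventually_analyticAt,
    h.right_inv.eventually_nhds, h.tendsto_inv.eventually h.left_inv.eventually_nhds]
    with z h1 h2 h3 h4 h5 hz
  have d1 := h1.differentiableAt.hasFDerivAt
  have d2 := h2.differentiableAt.hasFDerivAt
  have d3 := h3.differentiableAt.hasFDerivAt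
  have hz4 : θ (ψ z) = z := h4.self_of_nhds
  have c1 : fderiv k θ (ψ z) ∘L fderiv k ψ z = ContinuousLinearMap.id k E :=
    (d2.comp z d1).unique ((hasFDerivAt_id z).congr_of_eventuallyEq h4)
  have c2 : fderiv k ψ z ∘L fderiv k θ (ψ z) = ContinuousLinearMap.id k E := by
    refine HasFDerivAt.unique (f := ψ ∘ θ) (x := ψ z) ?_
      ((hasFDerivAt_id (ψ z)).congr_of_eventuallyEq h5)
    refine HasFDerivAt.comp (ψ z) ?_ d2
    rwa [hz4]
  refine ⟨ContinuousLinearEquiv.equivOfInverse (fderiv k θ (ψ z)) (fderiv k ψ z)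
    (fun v => DFunLike.congr_fun c2 v) (fun v => DFunLike.congr_fun c1 v), d2, ?_⟩
  have d2' : HasFDerivAt θ (fderiv k θ (ψ z)) ((f ∘ ψ) z) := by
    rw [Function.comp_apply, hz]; exact d2
  exact HasFDerivAt.comp z d2' (HasFDerivAt.comp z d3 d1)

lemma analyticAt_conj (h : IsCenteredChart k θ ψ q) {f : E → E} (hf : AnalyticAt k f q)
    (hfq : f q = q) : AnalyticAt k (θ ∘ f ∘ ψ) 0 :=
  AnalyticAt.comp_of_eq h.analyticAt
    (AnalyticAt.comp_of_eq hf h.analyticAt_inv h.inv_zero) (by simp [h.inv_zero, hfq])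

end IsCenteredChart

/-- The inverse function theorem for analytic maps. -/
lemma AnalyticAt.exists_isCenteredChart [CompleteSpace k] [FiniteDimensional k E] {θ : E → E}
    {q : E} (h : AnalyticAt k θ q) (h0 : θ q = 0) (hinj : Function.Injective (fderiv k θ q)) :
    ∃ ψ, IsCenteredChart k θ ψ q := by
  have hE : CompleteSpace E := FiniteDimensional.complete k E
  let i : E ≃L[k] E :=
    (LinearEquiv.ofInjectiveEndo (fderiv k θ q : E →ₗ[k] E) hinj).toContinuousLinearEquiv
  have hi : (i : E →L[k] E) = fderiv k θ q := by ext; rfl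
  have hfd : HasStrictFDerivAt θ (i : E →L[k] E) q := hi ▸ h.hasStrictFDerivAt
  let R := hfd.toOpenPartialHomeomorph θ
  have hq : q ∈ R.source := hfd.mem_toOpenPartialHomeomorph_source
  have hRq : R q = 0 := h0
  have hRi : R.symm 0 = q := by rw [← hRq, R.left_inv hq]
  refine ⟨R.symm, h, ?_, h0, hRi, ?_, ?_⟩
  · rw [← hRq]
    exact R.analyticAt_symm' (i := i) hq h hi.symm
  · exact R.eventually_left_inverse hq
  · rw [← hRq]
    exact R.eventually_right_inverse' hq

/-- A centred chart restricts to an analytic diffeomorphism between open sets. -/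
lemma IsCenteredChart.exists_isAnalyticDiffeo [CompleteSpace k] {n : ℕ} {θ ψ : (Fin n → k) → (Fin n → k)}
    {q : Fin n → k} (h : IsCenteredChart k θ ψ q) :
    ∃ W V, IsAnalyticDiffeo k θ W V ∧ q ∈ W := by
  obtain ⟨A, hA, hAo, hqA⟩ := eventually_nhds_iff.mp
    (h.left_inv.and h.analyticAt.eventually_analyticAt)
  obtain ⟨B, hB, hBo, h0B⟩ := eventually_nhds_iff.mp
    (h.right_inv.and h.analyticAt_inv.eventually_analyticAt)
  have hθA : ContinuousOn θ A := fun x hx => (hA x hx).2.continuousAt.continuousWithinAt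
  have hψB : ContinuousOn ψ B := fun x hx => (hB x hx).2.continuousAt.continuousWithinAt
  refine ⟨A ∩ θ ⁻¹' B, B ∩ ψ ⁻¹' A, ⟨hθA.isOpen_inter_preimage hAo hBo,
    hψB.isOpen_inter_preimage hBo hAo, ?_, fun x hx => (hA x hx.1).2, ψ, ?_,
    fun x hx => (hB x hx.1).2⟩, hqA, by simpa [h.map_center] using h0B⟩
  · refine Set.InvOn.bijOn (f' := ψ) ⟨fun x hx => (hA x hx.1).1, fun x hx => (hB x hx.1).1⟩
      (fun x hx => ⟨hx.2, ?_⟩) fun x hx => ⟨hx.2, ?_⟩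
    · simpa [(hA x hx.1).1] using hx.1
    · simpa [(hB x hx.1).1] using hx.1
  · exact ⟨fun x hx => (hA x hx.1).1, fun x hx => (hB x hx.1).1⟩

/-- An analytic diffeomorphism, translated, is a centred chart at each point. -/
lemma IsAnalyticDiffeo.isCenteredChart {n : ℕ} {φ : (Fin n → k) → (Fin n → k)}
    {W V : Set (Fin n → k)} (h : IsAnalyticDiffeo k φ W V) {q : Fin n → k} (hq : q ∈ W) :
    ∃ ψ, IsCenteredChart k (fun x => φ x - φ q) ψ q ∧
      ∀ᶠ z in 𝓝 0, ψ z ∈ W ∧ φ (ψ z) = z + φ q := by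
  obtain ⟨hW, hV, hbij, hφ, ψ, hinv, hψ⟩ := h
  have hqV : φ q ∈ V := hbij.mapsTo hq
  have ht : Tendsto (fun z : Fin n → k => z + φ q) (𝓝 0) (𝓝 (φ q)) := by
    simpa using (continuous_add_const (φ q)).tendsto (0 : Fin n → k)
  have hev : ∀ᶠ z : Fin n → k in 𝓝 0, z + φ q ∈ V := ht.eventually (hV.mem_nhds hqV)
  refine ⟨fun z => ψ (z + φ q), ⟨(hφ q hq).sub analyticAt_const, ?_, sub_self _,
    by simpa using hinv.1 hq, ?_, ?_⟩, ?_⟩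
  · exact AnalyticAt.comp_of_eq (hψ _ hqV) (analyticAt_id.add analyticAt_const) (by simp)
  · filter_upwards [hW.mem_nhds hq] with x hx
    simpa using hinv.1 hx
  · filter_upwards [hev] with z hz
    simp [hinv.2 hz]
  · filter_upwards [hev] with z hz
    obtain ⟨x, hx, hxz⟩ := hbij.surjOn hz
    rw [← hxz, hinv.1 hx]
    exact ⟨hx, rfl⟩

end CenteredChart

/-! ### Polynomials in an endomorphism that depend analytically on a parameter. -/

section AevalAnalytic

open Filter Topology Polynomial

variable {k : Type*} [NontriviallyNormedField k] {E : Type*} [NormedAddCommGroup E]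
  [NormedSpace k E]

lemma ContinuousLinearMap.map_aeval_of_comp_eq_smul {A : E →L[k] E} {c : k} (ℓ : E →ₗ[k] k)
    (h : ∀ v, ℓ (A v) = c * ℓ v) (p : k[X]) (v : E) : ℓ (aeval A p v) = p.eval c * ℓ v := by
  induction p using Polynomial.induction_on generalizing v with
  | C a => simp [Algebra.algebraMap_eq_smul_one]
  | add p q hp hq => simp [hp, hq, add_mul]
  | monomial n a ih =>
    rw [pow_succ, ← mul_assoc, map_mul, mul_apply_eq_comp, ih, aeval_X, h]
    simp; ring

lemma ContinuousLinearMap.aeval_apply_of_eq_smul {A : E →L[k] E} {c : k} {v : E}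
    (h : A v = c • v) (p : k[X]) : aeval A p v = p.eval c • v := by
  induction p using Polynomial.induction_on with
  | C a => simp [Algebra.algebraMap_eq_smul_one]
  | add p q hp hq => simp [hp, hq, add_smul]
  | monomial n a ih =>
    rw [pow_succ, ← mul_assoc, map_mul, mul_apply_eq_comp, aeval_X, h, map_smul, ih,
      smul_smul]
    congr 1
    simp; ring

lemma ContinuousLinearMap.coe_aeval (A : E →L[k] E) (p : k[X]) :
    ((aeval A p : E →L[k] E) : E →ₗ[k] E) = aeval (A : Module.End k E) p := by
  induction p using Polynomial.induction_on with
  | C a => ext; simp [Algebra.algebraMap_eq_smul_one]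
  | add p q hp hq => simp [hp, hq]
  | monomial n a ih =>
    rw [pow_succ, ← mul_assoc, map_mul (aeval A) (C a * X ^ n), ContinuousLinearMap.toLinearMap_mul, ih,
      map_mul (aeval (A : Module.End k E)) (C a * X ^ n), aeval_X, aeval_X]

lemma analyticAt_aeval_prod {κ : Type*} {F : Type*} [NormedAddCommGroup F] [NormedSpace k F]
    {𝔸 : Type*} [NormedRing 𝔸] [NormedAlgebra k 𝔸] {A : F → 𝔸}
    {e : κ → F → k} {x₀ : F} (hA : AnalyticAt k A x₀) (he : ∀ b, AnalyticAt k (e b) x₀)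
    (s : Finset κ) :
    AnalyticAt k (fun x => aeval (A x) (∏ b ∈ s, (X - C (e b x)))) x₀ := by
  classical
  induction s using Finset.induction_on with
  | empty => simpa using analyticAt_const
  | insert b s hb ih =>
    simp only [Finset.prod_insert hb, map_mul, map_sub, aeval_X, aeval_C,
      Algebra.algebraMap_eq_smul_one]
    exact (hA.sub ((he b).smul analyticAt_const)).mul ih

end AevalAnalytic

/-! ### Simultaneous diagonalization of the derivatives along the fixed set. -/

section Diagonalize

open Filter Topology Polynomial

variable {σ : Type*} [Fintype σ] {k : Type*} [NontriviallyNormedField k] {y : σ → ℕ}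

/-- The linear projection `gradedScale y 0` onto the subspace of degree zero. -/
def gradedProj (k : Type*) [NontriviallyNormedField k] (y : σ → ℕ) : (σ → k) →L[k] (σ → k) :=
  ContinuousLinearMap.pi fun i => (0 : k) ^ y i • ContinuousLinearMap.proj i

omit [Fintype σ] in
lemma gradedScale_zero_apply (x : σ → k) (i : σ) :
    gradedScale y 0 x i = if y i = 0 then x i else 0 := by
  by_cases h : y i = 0 <;> simp [gradedScale, h]

omit [Fintype σ] in
lemma gradedScale_zero_idem (x : σ → k) :
    gradedScale y 0 (gradedScale y 0 x) = gradedScale y 0 x := by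
  ext i
  by_cases h : y i = 0 <;> simp [gradedScale_zero_apply, h]

omit [Fintype σ] in
lemma tendsto_gradedScale_zero_left (y : σ → ℕ) :
    Tendsto (gradedScale y (0 : k)) (𝓝 0) (𝓝 0) := by
  have h := (gradedProj k y).continuous.tendsto 0
  rwa [map_zero] at h

variable [CompleteSpace k]

/-- If the derivatives of `g` along a coordinate subspace of fixed points are simultaneously
annihilated by split squarefree polynomials with analytic roots, then analytic coordinates can be
chosen in which all these derivatives are diagonal. -/
theorem exists_diagonalizing_chart {g : (σ → k) → σ → k} (hg : AnalyticAt k g 0)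
    (hg0 : ∀ᶠ x in 𝓝 0, g (gradedScale y 0 x) = gradedScale y 0 x)
    {κ : Type*} [Fintype κ] {e : κ → (σ → k) → k} (he : ∀ b, AnalyticAt k (e b) 0)
    (hinj : Function.Injective fun b => e b 0) {a : σ → κ}
    (hone : ∀ i, y i = 0 → ∀ x, e (a i) x = 1)
    (hd : ∀ v i, fderiv k g 0 v i = e (a i) 0 * v i)
    (hann : ∀ᶠ x in 𝓝 0,
      aeval (fderiv k g (gradedScale y 0 x)) (∏ b, (X - C (e b (gradedScale y 0 x)))) = 0) :
    ∃ χ ω, IsCenteredChart k χ ω 0 ∧ (∀ᶠ x in 𝓝 0, ω (gradedScale y 0 x) = gradedScale y 0 x) ∧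
      ∀ᶠ x in 𝓝 0, HasFDerivAt (χ ∘ g ∘ ω) (ContinuousLinearMap.pi fun i =>
        e (a i) (gradedScale y 0 x) • ContinuousLinearMap.proj (R := k) (φ := fun _ => k) i)
        (gradedScale y 0 x) := by
  classical
  let S := gradedProj k y
  let Q : σ → (σ → k) → k[X] := fun i x => ∏ b ∈ Finset.univ.erase (a i), (X - C (e b x))
  let N : σ → (σ → k) → k := fun i x => (Q i x).eval (e (a i) x)
  let p : σ → (σ → k) →L[k] k := fun i => ContinuousLinearMap.proj i
  -- Row `i` of the Lagrange projector onto the eigenvalue `e (a i)`. The normalization by `N i`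
  -- makes it the `i`-th coordinate form at the origin, where the derivative is diagonal.
  let B : σ → (σ → k) → (σ → k) →L[k] k := fun i x => (N i x)⁻¹ • (p i ∘L aeval (fderiv k g x) (Q i x))
  let χ : (σ → k) → σ → k := fun x i => S x i + B i x (x - S x)
  have hN : ∀ i, AnalyticAt k (N i) 0 := fun i => by
    have := analyticAt_aeval_prod (he (a i)) he (Finset.univ.erase (a i))
    simpa only [coe_aeval_eq_eval] using this
  have hN0 : ∀ i, N i 0 ≠ 0 := fun i => by
    simp only [N, Q, eval_prod, eval_sub, eval_X, eval_C]
    exact Finset.prod_ne_zero_iff.mpr fun b hb => sub_ne_zero.mpr fun h =>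
      Finset.ne_of_mem_erase hb (hinj h.symm)
  have hB : ∀ i, AnalyticAt k (B i) 0 := fun i =>
    ((hN i).inv (hN0 i)).smul ((ContinuousLinearMap.compL k (σ → k) (σ → k) k (p i)).analyticAt _
      |>.comp (analyticAt_aeval_prod hg.fderiv he (Finset.univ.erase (a i))))
  have hχ : AnalyticAt k χ 0 := analyticAt_pi_iff.mpr fun i =>
    ((p i).comp S |>.analyticAt 0).add (((ContinuousLinearMap.id k ((σ → k) →L[k] k)).analyticAt_bilinear _).comp₂ (hB i)
      (analyticAt_id.sub (S.analyticAt 0)))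
  have hS : Tendsto (gradedScale y (0 : k)) (𝓝 0) (𝓝 0) := tendsto_gradedScale_zero_left y
  have hχS : ∀ x, χ (gradedScale y 0 x) = gradedScale y 0 x := fun x => by
    have h1 : S (gradedScale y 0 x) = gradedScale y 0 x := gradedScale_zero_idem x
    ext i
    simp only [χ, h1, sub_self, map_zero, add_zero]
  have hχ0 : χ 0 = 0 := by
    ext i; simp [χ]
  -- the rows of the derivative of `χ`
  have hBS : ∀ᶠ x in 𝓝 (0 : σ → k), ∀ i v, B i (gradedScale y 0 x) (S v) = S v i := by
    have hev : ∀ i, ∀ᶠ x in 𝓝 (0 : σ → k), N i (gradedScale y 0 x) ≠ 0 := fun i =>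
      hS.eventually ((hN i).continuousAt.eventually_ne (hN0 i))
    filter_upwards [eventually_all.mpr hev, hg0.eventually_nhds,
      hS.eventually hg.eventually_analyticAt] with x hx1 hx2 hx3 i v
    have h1 : fderiv k g (gradedScale y 0 x) (S v) = S v := by
      have d1 : HasFDerivAt (g ∘ S) (fderiv k g (gradedScale y 0 x) ∘L S) x :=
        HasFDerivAt.comp x hx3.differentiableAt.hasFDerivAt S.hasFDerivAt
      exact DFunLike.congr_fun (d1.unique (S.hasFDerivAt.congr_of_eventuallyEq hx2)) v
    have h5 := ContinuousLinearMap.aeval_apply_of_eq_smul (h1.trans (one_smul k _).symm)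
    simp only [B, smul_apply, ContinuousLinearMap.comp_apply, h5, map_smul]
    by_cases hi : y i = 0
    · have h2 := hone i hi (gradedScale y 0 x)
      have h3 := hx1 i
      simp only [N, h2] at h3 ⊢
      simp only [smul_eq_mul, inv_mul_cancel_left₀ h3]
      rfl
    · have : S v i = 0 := by simp [S, gradedProj, hi]
      have h4 : p i (S v) = 0 := this
      rw [h4, this, smul_zero, smul_zero]
  -- The derivative of `B i` is evaluated on `x - S x = 0` along the subspace and drops out.
  have hdχ : ∀ᶠ x in 𝓝 (0 : σ → k), HasFDerivAt χ
      (ContinuousLinearMap.pi fun i => B i (gradedScale y 0 x)) (gradedScale y 0 x) := by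
    have hev := eventually_all.mpr fun i => hS.eventually (hB i).eventually_analyticAt
    filter_upwards [hBS, hev] with x hx1 hx2
    refine hasFDerivAt_pi'.mpr fun i => ?_
    have h1 : S (gradedScale y 0 x) = gradedScale y 0 x := gradedScale_zero_idem x
    have d1 := (((p i).comp S).hasFDerivAt (x := gradedScale y 0 x)).add
      ((hx2 i).differentiableAt.hasFDerivAt.clm_apply
        (((hasFDerivAt_id (gradedScale y 0 x)).sub (S.hasFDerivAt (x := gradedScale y 0 x)))))
    have h3 : ((id : (σ → k) → σ → k) - ⇑S) (gradedScale y 0 x) = 0 := by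
      rw [Pi.sub_apply, h1, id_eq, sub_self]
    refine d1.congr_fderiv ?_
    ext v
    have h2 := hx1 i v
    simp only [h3, add_apply, ContinuousLinearMap.comp_apply,
      map_zero, add_zero, map_sub, sub_apply,
      h2, ContinuousLinearMap.id_apply, ContinuousLinearMap.proj_apply,
      ContinuousLinearMap.pi_apply]
    exact add_sub_cancel (S v i) _
  have hinjχ : Function.Injective (fderiv k χ 0) := by
    have h0 : gradedScale y (0 : k) (0 : σ → k) = 0 := map_zero (gradedProj k y)
    have h1 := hdχ.self_of_nhds
    rw [h0] at h1
    rw [h1.fderiv]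
    have h2 : ∀ v, (ContinuousLinearMap.pi fun i => B i 0) v = v := fun v => by
      ext i
      have h3 := ContinuousLinearMap.map_aeval_of_comp_eq_smul (A := fderiv k g 0)
        (c := e (a i) 0) (p i) (fun v => hd v i) (Q i 0) v
      simp only [ContinuousLinearMap.pi_apply, B, smul_apply,
        ContinuousLinearMap.comp_apply]
      refine (congrArg _ h3).trans ?_
      exact inv_mul_cancel_left₀ (hN0 i) _
    intro v w hvw
    rwa [h2, h2] at hvw
  obtain ⟨ω, hω⟩ := hχ.exists_isCenteredChart hχ0 hinjχ
  have hωS : ∀ᶠ x in 𝓝 0, ω (gradedScale y 0 x) = gradedScale y 0 x := by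
    filter_upwards [hS.eventually hω.left_inv] with x hx
    rwa [hχS] at hx
  refine ⟨χ, ω, hω, hωS, ?_⟩
  filter_upwards [hωS, hdχ, hann, hg0, hS.eventually (hω.eventually_hasFDerivAt_conj hg)]
    with x hx1 hx2 hx3 hx4 hx5
  obtain ⟨E, hE, hder⟩ := hx5 (by rw [hx1, hx4])
  rw [hx1] at hE hder
  have hE2 := hE.unique hx2
  refine hder.congr_fderiv ?_
  ext1 v
  obtain ⟨u, rfl⟩ := E.surjective v
  have hEi : ∀ w i, E w i = B i (gradedScale y 0 x) w := fun w i =>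
    congr_fun (DFunLike.congr_fun hE2 w) i
  ext i
  simp only [ContinuousLinearMap.comp_apply, ContinuousLinearEquiv.coe_coe,
    ContinuousLinearEquiv.symm_apply_apply, ContinuousLinearMap.pi_apply,
    smul_apply, ContinuousLinearMap.proj_apply, hEi]
  -- The annihilating polynomial is `Q i` times the factor of `e (a i)`; hence the row `B i` is a
  -- left eigenvector of the derivative with eigenvalue `e (a i)`.
  rw [← Finset.mul_prod_erase _ _ (Finset.mem_univ (a i)), mul_comm, map_mul] at hx3
  have h1 := DFunLike.congr_fun hx3 u
  simp only [map_sub, aeval_X, aeval_C, mul_apply_eq_comp,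
    sub_apply, Algebra.algebraMap_eq_smul_one, smul_apply,
    one_apply_eq_self, map_smul, zero_apply, sub_eq_zero] at h1
  simp only [B, smul_apply, ContinuousLinearMap.comp_apply, Q, h1, map_smul]
  rw [smul_comm]

end Diagonalize

/-! ### Adapted charts at general fixed points and the assembly of the coordinates. -/

section Fixed

open MvPowerSeries Finsupp Filter Topology

variable {k : Type*} [NontriviallyNormedField k] [CompleteSpace k]

/-- The characteristic polynomial and semisimplicity of the derivative at a fixed point do not
depend on the chart. -/
lemma IsCenteredChart.eventually_charpoly_conj {E : Type*} [NormedAddCommGroup E]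
    [NormedSpace k E] [FiniteDimensional k E] {θ ψ : E → E} {q : E} (h : IsCenteredChart k θ ψ q)
    {f : E → E} (hf : AnalyticAt k f q) :
    ∀ᶠ z in 𝓝 0, f (ψ z) = ψ z →
      LinearMap.charpoly (fderiv k (θ ∘ f ∘ ψ) z : E →ₗ[k] E) =
        LinearMap.charpoly (fderiv k f (ψ z) : E →ₗ[k] E) ∧
      (Module.End.IsSemisimple (fderiv k f (ψ z) : E →ₗ[k] E) →
        Module.End.IsSemisimple (fderiv k (θ ∘ f ∘ ψ) z : E →ₗ[k] E)) := by
  have hE : CompleteSpace E := FiniteDimensional.complete k E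
  filter_upwards [h.eventually_hasFDerivAt_conj hf] with z hz hfz
  obtain ⟨e, -, he⟩ := hz hfz
  have h1 : (fderiv k (θ ∘ f ∘ ψ) z : E →ₗ[k] E) =
      e.toLinearEquiv.conj (fderiv k f (ψ z) : E →ₗ[k] E) := by
    rw [he.fderiv]; rfl
  rw [h1]
  refine ⟨LinearEquiv.charpoly_conj _ _, fun hs => ?_⟩
  refine (LinearEquiv.isSemisimple_iff _ _ e.toLinearEquiv ?_).mp hs
  ext v
  simp [LinearEquiv.conj_apply]

/-- The grading of `kⁿ` for which the first `r` coordinates have degree zero. -/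
def transverseGrading (n r : ℕ) (i : Fin n) : ℕ := if (i : ℕ) < r then 0 else 1

variable {n r : ℕ}

lemma transverseGrading_eq_zero {i : Fin n} : transverseGrading n r i = 0 ↔ (i : ℕ) < r := by
  simp [transverseGrading]

omit [CompleteSpace k] in
lemma gradedScale_transverseGrading (x : Fin n → k) (i : Fin n) :
    gradedScale (transverseGrading n r) 0 x i = if (i : ℕ) < r then x i else 0 := by
  by_cases h : (i : ℕ) < r <;> simp [gradedScale, transverseGrading, h]

omit [CompleteSpace k] in
/-- Near a general point the fixed set is straightened by a chart. -/
lemma IsGeneralSubset.exists_straightening {F G : Set (Fin n → k)} (hG : IsGeneralSubset k r F G)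
    {q : Fin n → k} (hq : q ∈ G) :
    ∃ θ ψ, IsCenteredChart k θ ψ q ∧
      ∀ᶠ z in 𝓝 0, ψ (gradedScale (transverseGrading n r) 0 z) ∈ G := by
  obtain ⟨hGs, ⟨O, hO, rfl⟩, -⟩ := hG
  obtain ⟨hqF, -, W, V, φ, hφ, hqW, hFW⟩ := hGs hq
  obtain ⟨ψ, hψ, hev⟩ := hφ.isCenteredChart hqW
  refine ⟨_, ψ, hψ, ?_⟩
  have hS := tendsto_gradedScale_zero_left (k := k) (transverseGrading n r)
  filter_upwards [hS.eventually hev, hS.eventually (hψ.tendsto_inv.eventually (hO.mem_nhds hq.1))]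
    with z h1 h2
  refine ⟨h2, (hFW _ h1.1).mpr fun i hi => ?_⟩
  -- Centring the chart subtracts `φ q`, whose last coordinates are already zero because `q` lies in
  -- the fixed set; so the equations of `F` are unchanged.
  rw [h1.2, Pi.add_apply, gradedScale_transverseGrading, if_neg hi.not_gt, zero_add]
  exact (hFW q hqW).mp hqF i hi

omit [CompleteSpace k] in
lemma eventually_conj_fixed {θ ψ f : (Fin n → k) → Fin n → k} {q : Fin n → k}
    {G : Set (Fin n → k)} (hfix : ∀ x ∈ G, f x = x) (h : IsCenteredChart k θ ψ q)
    (hψ : ∀ᶠ z in 𝓝 0, ψ (gradedScale (transverseGrading n r) 0 z) ∈ G) :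
    ∀ᶠ z in 𝓝 0, (θ ∘ f ∘ ψ) (gradedScale (transverseGrading n r) 0 z) =
      gradedScale (transverseGrading n r) 0 z := by
  filter_upwards [hψ, (tendsto_gradedScale_zero_left _).eventually h.right_inv] with z h1 h2
  rw [Function.comp_apply, Function.comp_apply, hfix _ h1, h2]

/-- Straightening of the fixed set in a chart in which moreover the derivative at the centre is
diagonal. -/
lemma IsGeneralSubset.exists_adapted_chart {F G : Set (Fin n → k)} (hG : IsGeneralSubset k r F G)
    {f : (Fin n → k) → Fin n → k} (hfix : ∀ x ∈ G, f x = x) {q : Fin n → k} (hq : q ∈ G)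
    (hf : AnalyticAt k f q)
    (hss : Module.End.IsSemisimple (fderiv k f q : (Fin n → k) →ₗ[k] (Fin n → k))) {c : Fin n → k}
    (hch : LinearMap.charpoly (fderiv k f q : (Fin n → k) →ₗ[k] (Fin n → k)) =
      ∏ i, (Polynomial.X - Polynomial.C (c i))) (hc : ∀ i : Fin n, r ≤ (i : ℕ) → c i ≠ 1) :
    ∃ θ ψ, IsCenteredChart k θ ψ q ∧
      (∀ᶠ z in 𝓝 0, ψ (gradedScale (transverseGrading n r) 0 z) ∈ G) ∧
      ∀ v i, fderiv k (θ ∘ f ∘ ψ) 0 v i = c i * v i := by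
  obtain ⟨θ, ψ, h, hψ⟩ := hG.exists_straightening hq
  have hg := h.analyticAt_conj hf (hfix q hq)
  have h0 := h.eventually_charpoly_conj hf |>.self_of_nhds
  rw [h.inv_zero] at h0
  obtain ⟨h1, h2⟩ := h0 (hfix q hq)
  have hS0 : ∀ v : Fin n → k, (∀ i ∈ {i : Fin n | r ≤ (i : ℕ)}, v i = 0) →
      gradedScale (transverseGrading n r) 0 v = v := fun v hv => by
    ext i
    rw [gradedScale_transverseGrading]
    split_ifs with hi
    · rfl
    · exact (hv i (not_lt.mp hi)).symm
  have hS1 : ∀ v : Fin n → k, ∀ i ∈ {i : Fin n | r ≤ (i : ℕ)},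
      gradedScale (transverseGrading n r) 0 v i = 0 := fun v i hi => by
    rw [gradedScale_transverseGrading, if_neg (not_lt.mpr hi)]
  obtain ⟨L, hL, hLs⟩ := exists_diagonalization (h2 hss) (c := c) (s := {i | r ≤ (i : ℕ)})
    (h1.trans hch) hc (fun v hv => by
      let S := gradedProj k (transverseGrading n r)
      have d1 : HasFDerivAt ((θ ∘ f ∘ ψ) ∘ S) (fderiv k (θ ∘ f ∘ ψ) 0 ∘L S) 0 := by
        refine HasFDerivAt.comp 0 ?_ S.hasFDerivAt
        rw [map_zero]
        exact hg.differentiableAt.hasFDerivAt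
      have d2 := DFunLike.congr_fun (d1.unique (S.hasFDerivAt.congr_of_eventuallyEq
        (eventually_conj_fixed hfix h hψ))) v
      have d3 : S v = v := hS0 v hv
      rwa [ContinuousLinearMap.comp_apply, d3] at d2)
  let L' : (Fin n → k) ≃L[k] (Fin n → k) := L.toContinuousLinearEquiv
  refine ⟨_, _, h.comp (IsCenteredChart.of_continuousLinearEquiv L'), ?_, ?_⟩
  · have ht : Tendsto (fun z => L'.symm (gradedScale (transverseGrading n r) 0 z)) (𝓝 0) (𝓝 0) := by
      have := (L'.symm.continuous.tendsto 0).comp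
        (tendsto_gradedScale_zero_left (transverseGrading n r))
      rwa [map_zero] at this
    filter_upwards [ht.eventually hψ] with z hz
    -- `L.symm` preserves the coordinate subspace, so the linear change keeps the fixed set
    -- straight.
    have h3 := hS0 (L'.symm (gradedScale (transverseGrading n r) 0 z)) (hLs _ (hS1 z))
    rwa [h3] at hz
  · intro v i
    have d1 : HasFDerivAt (L' ∘ (θ ∘ f ∘ ψ) ∘ L'.symm)
        ((L' : (Fin n → k) →L[k] (Fin n → k)) ∘L fderiv k (θ ∘ f ∘ ψ) 0 ∘L
          (L'.symm : (Fin n → k) →L[k] (Fin n → k))) 0 := by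
      refine L'.hasFDerivAt.comp 0 (HasFDerivAt.comp 0 ?_ L'.symm.hasFDerivAt)
      rw [map_zero]
      exact hg.differentiableAt.hasFDerivAt
    have d2 : fderiv k ((L' ∘ θ) ∘ f ∘ (ψ ∘ L'.symm)) 0 = _ := d1.fderiv
    rw [d2]
    refine (hL (L.symm v) i).trans ?_
    rw [LinearEquiv.apply_symm_apply]

/-- The inclusion of `kʳ` as the space of the first `r` coordinates of `kⁿ`. -/
def extendByZero (k : Type*) [NontriviallyNormedField k] (n r : ℕ) :
    (Fin r → k) →L[k] (Fin n → k) :=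
  ContinuousLinearMap.pi fun j =>
    if h : (j : ℕ) < r then ContinuousLinearMap.proj ⟨j, h⟩ else 0

omit [CompleteSpace k] in
lemma extendByZero_castLE (hr : r ≤ n) (x : Fin n → k) :
    extendByZero k n r (fun j => x (Fin.castLE hr j)) =
      gradedScale (transverseGrading n r) 0 x := by
  ext j
  rw [gradedScale_transverseGrading, extendByZero,
    ContinuousLinearMap.pi_apply]
  split_ifs with h <;> rfl

/-- Germs of charts suffice for `IsLinearizedBy`. -/
lemma IsCenteredChart.isLinearizedBy (hr : r ≤ n) {θ ψ f : (Fin n → k) → Fin n → k}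
    {q : Fin n → k} (h : IsCenteredChart k θ ψ q) (hf : ContinuousAt f q) (hfq : f q = q)
    {lam : Fin n → (Fin r → k) → k} (hlam : ∀ i, AnalyticAt k (lam i) 0)
    (hev : ∀ᶠ x in 𝓝 q, ∀ i, θ (f x) i = lam i (fun j => θ x (Fin.castLE hr j)) * θ x i) :
    IsLinearizedBy hr f q lam := by
  obtain ⟨W, V, hWV, hqW⟩ := h.exists_isAnalyticDiffeo
  have hf' : Tendsto f (𝓝 q) (𝓝 q) := by simpa [hfq] using hf.tendsto
  have hW : ∀ᶠ x in 𝓝 q, x ∈ W := hWV.1.mem_nhds hqW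
  obtain ⟨W₀, hW, hWo, hqW₀⟩ := eventually_nhds_iff.mp ((hW.and (hf'.eventually hW)).and hev)
  exact ⟨hlam, W, V, θ, hWV, hqW, h.map_center, W₀, hWo, hqW₀, fun x hx => (hW x hx).1.1,
    fun x hx => (hW x hx).1.2, fun x hx => (hW x hx).2⟩

omit [CompleteSpace k] in
lemma evalSeries_gradedScale_of_mem_paramSubring {y : Fin n → ℕ} {F : MvPowerSeries (Fin n) k}
    (hF : F ∈ paramSubring k y) (x : Fin n → k) :
    evalSeries F (gradedScale y 0 x) = evalSeries F x := by
  rw [evalSeries_gradedScale_zero]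
  congr 1
  ext I
  rw [coeff_weightPart]
  split_ifs with h
  · rfl
  · exact (mem_paramSubring.mp hF I h).symm

/-- Linearization at a general fixed point, under a small divisor condition on power series which
represent the eigenvalues along the fixed set. -/
theorem isLinearizedBy_of_smallDivisorBound [IsUltrametricDist k] (hr : r ≤ n)
    {G : Set (Fin n → k)} {f θ ψ : (Fin n → k) → Fin n → k} (hfix : ∀ x ∈ G, f x = x) {q : Fin n → k} (hq : q ∈ G)
    (hf : AnalyticAt k f q)
    (hss : ∀ x ∈ G, Module.End.IsSemisimple (fderiv k f x : (Fin n → k) →ₗ[k] (Fin n → k)))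
    (h : IsCenteredChart k θ ψ q)
    (hψ : ∀ᶠ z in 𝓝 0, ψ (gradedScale (transverseGrading n r) 0 z) ∈ G)
    {κ : Type*} [Fintype κ] {e : κ → (Fin n → k) → k} (he : ∀ b, AnalyticAt k (e b) 0)
    (hinj : Function.Injective fun b => e b 0) {a : Fin n → κ}
    (hone : ∀ i : Fin n, (i : ℕ) < r → ∀ x, e (a i) x = 1)
    (hd : ∀ v i, fderiv k (θ ∘ f ∘ ψ) 0 v i = e (a i) 0 * v i)
    (hch : ∀ᶠ z in 𝓝 0, LinearMap.charpoly
      (fderiv k f (ψ (gradedScale (transverseGrading n r) 0 z)) : (Fin n → k) →ₗ[k] (Fin n → k)) =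
        ∏ i, (Polynomial.X -
          Polynomial.C (e (a i) (gradedScale (transverseGrading n r) 0 z))))
    {R : ℝ} (hR : 0 < R) {L : Fin n → ℝ} {lam : Fin n → MvPowerSeries (Fin n) k}
    (hL : ∀ i, 0 < L i) (hlam : ∀ i, lam i ∈ paramSubring k (transverseGrading n r))
    (hlam1 : ∀ i : Fin n, (i : ℕ) < r → lam i = 1) (hlamL : ∀ i, CoeffBound R (L i) (lam i))
    (hlame : ∀ᶠ z in 𝓝 0, ∀ i, evalSeries (lam i) (gradedScale (transverseGrading n r) 0 z) =
      e (a i) (gradedScale (transverseGrading n r) 0 z))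
    {K β : ℝ} (hK : 1 ≤ K) (hβ : 0 ≤ β)
    (hdiv : SmallDivisorBound (transverseGrading n r) (fun _ => R) L lam fun s => K * (s : ℝ) ^ β) :
    IsLinearizedBy hr f q (fun i z => evalSeries (lam i) (extendByZero k n r z)) := by
  set y := transverseGrading n r
  have hy : ∀ i, y i ≤ 1 := fun i => by
    simp only [y, transverseGrading]; split_ifs <;> omega
  have hfq := hfix q hq
  have hg := h.analyticAt_conj hf hfq
  have hg0 := eventually_conj_fixed hfix h hψ
  have hS := tendsto_gradedScale_zero_left (k := k) y
  -- Semisimplicity at each nearby fixed point gives annihilation by the product over the index set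
  -- `κ`, in which each eigenvalue function occurs once; the chart transports both facts.
  have hann : ∀ᶠ x in 𝓝 0, Polynomial.aeval (fderiv k (θ ∘ f ∘ ψ) (gradedScale y 0 x))
      (∏ b, (Polynomial.X - Polynomial.C (e b (gradedScale y 0 x)))) = 0 := by
    filter_upwards [hS.eventually (h.eventually_charpoly_conj hf), hψ, hch] with x h1 h2 h3
    obtain ⟨h4, h5⟩ := h1 (hfix _ h2)
    refine ContinuousLinearMap.coe_injective ?_
    rw [ContinuousLinearMap.coe_aeval]
    exact aeval_prod_X_sub_C_eq_zero (h5 (hss _ h2)) (a := a)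
      (e := fun b => e b (gradedScale y 0 x)) (h4.trans h3)
  obtain ⟨χ, ω, hχ, hωS, hder⟩ := exists_diagonalizing_chart hg hg0 he hinj
    (fun i hi => hone i (transverseGrading_eq_zero.mp hi)) hd hann
  have hg00 : (θ ∘ f ∘ ψ) 0 = 0 := by
    simp only [Function.comp_apply, h.inv_zero, hfq, h.map_center]
  have hg3 : AnalyticAt k (χ ∘ (θ ∘ f ∘ ψ) ∘ ω) 0 := hχ.analyticAt_conj hg hg00
  have hg30 : ∀ᶠ x in 𝓝 0, (χ ∘ (θ ∘ f ∘ ψ) ∘ ω) (gradedScale y 0 x) = gradedScale y 0 x := by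
    filter_upwards [hωS, hg0, hS.eventually hχ.right_inv] with x h1 h2 h3
    rw [h1] at h3
    rw [Function.comp_apply, Function.comp_apply, h1, h2, h3]
  obtain ⟨Φ, hΦ, hΦ0, hΦinj, hΦev⟩ := exists_linearizing_germ hy hR hL hlam
    (fun i hi => hlam1 i (transverseGrading_eq_zero.mp hi)) hlamL hK hβ hdiv hg3 hg30 (by
      filter_upwards [hder, hlame] with x h1 h2
      refine h1.congr_fderiv ?_
      simp only [h2]
      rfl)
  obtain ⟨Ω, hΩ⟩ := hΦ.exists_isCenteredChart hΦ0 hΦinj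
  have hθχ := h.comp hχ
  refine (hθχ.comp hΩ).isLinearizedBy hr hf.continuousAt hfq (fun i => ?_) ?_
  · exact ((hlamL i).analyticAt hR).comp_of_eq ((extendByZero k n r).analyticAt 0) (map_zero _)
  · filter_upwards [hθχ.tendsto.eventually hΦev, hθχ.left_inv] with x h1 h2 i
    have h3 := h1 i
    have h4 : (χ ∘ (θ ∘ f ∘ ψ) ∘ ω) ((χ ∘ θ) x) = (χ ∘ θ) (f ((ψ ∘ ω) ((χ ∘ θ) x))) := rfl
    rw [h4, h2] at h3
    have h5 := extendByZero_castLE hr (Φ ((χ ∘ θ) x))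
    simp only [Function.comp_apply] at h3 h5 ⊢
    rw [h5, evalSeries_gradedScale_of_mem_paramSubring (hlam i), h3]

end Fixed

/-! ### The two cases of the theorem. -/

section Cases

open MvPowerSeries Finsupp Filter Topology

variable {k : Type*} [NontriviallyNormedField k] {n r : ℕ}

lemma weight_transverseGrading (I : Fin n →₀ ℕ) :
    weight (transverseGrading n r) I = ∑ i : Fin n, if (i : ℕ) < r then 0 else I i := by
  rw [weight_eq_sum_mul]
  refine Finset.sum_congr rfl fun i _ => ?_
  rw [transverseGrading]
  split_ifs <;> simp

lemma prod_pow_ite_of_eq_one {c : Fin n → k} (hc : ∀ i : Fin n, (i : ℕ) < r → c i = 1)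
    (I : Fin n → ℕ) : ∏ i, c i ^ (if (i : ℕ) < r then 0 else I i) = ∏ i, c i ^ I i := by
  refine Finset.prod_congr rfl fun i _ => ?_
  split_ifs with h
  · rw [hc i h, one_pow, one_pow]
  · rfl

/-- Badly approximable eigenvalues satisfy the small divisor inequality also for the tangential
coordinates, and the transverse ones are different from `0` and `1`. -/
lemma IsBadlyApproximable.exists_bound (hr : r < n) {c : Fin n → k}
    (hc : ∀ i : Fin n, (i : ℕ) < r → c i = 1) (h : IsBadlyApproximable r c) :
    (∀ i : Fin n, r ≤ (i : ℕ) → c i ≠ 0 ∧ c i ≠ 1) ∧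
    ∃ C β : ℝ, 0 < C ∧ 0 ≤ β ∧ ∀ (i : Fin n) (I : Fin n →₀ ℕ),
      transverseGrading n r i + 1 ≤ weight (transverseGrading n r) I →
      C * (weight (transverseGrading n r) I : ℝ) ^ (-β) ≤ ‖(∏ j, c j ^ I j) - c i‖ := by
  classical
  obtain ⟨C, β, hC, hβ, h⟩ := h
  have hne : ∀ i : Fin n, r ≤ (i : ℕ) → c i ≠ 0 ∧ c i ≠ 1 := by
    intro i hi
    -- The exponent `2` at `i` yields `c_i ^ 2 ≠ c_i`.
    have h1 := h (Pi.single i 2) (fun j hj => by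
      rw [Pi.single_eq_of_ne]; rintro rfl; omega) (by simp) i hi
    have h2 : ∏ j, c j ^ (Pi.single i 2 : Fin n → ℕ) j = c i ^ 2 := by
      rw [Finset.prod_eq_single i (fun j _ hj => by rw [Pi.single_eq_of_ne hj, pow_zero])
        (by simp), Pi.single_eq_same]
    rw [h2, Finset.sum_pi_single' i 2, if_pos (Finset.mem_univ i)] at h1
    have h3 : 0 < ‖c i ^ 2 - c i‖ := lt_of_lt_of_le (by positivity) h1
    rw [norm_pos_iff] at h3
    constructor <;> intro h4 <;> apply h3 <;> rw [h4] <;> ring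
  refine ⟨hne, ?_⟩
  let j : Fin n := ⟨r, hr⟩
  have hcj : 0 < ‖c j‖ := norm_pos_iff.mpr (hne j le_rfl).1
  -- The second constant serves the tangential `i`: multiplying `c ^ I - 1` by `c_j` turns it into
  -- an admissible divisor of degree `s + 1 ≤ 2 s`.
  refine ⟨min C (C * 2 ^ (-β) / ‖c j‖), β, by positivity, hβ, fun i I hI => ?_⟩
  let J : Fin n → ℕ := fun i => if (i : ℕ) < r then 0 else I i
  have hJ : ∑ i, J i = weight (transverseGrading n r) I := (weight_transverseGrading I).symm
  have hJ0 : ∀ i : Fin n, (i : ℕ) < r → J i = 0 := fun i hi => if_pos hi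
  have hp : ∏ i, c i ^ I i = ∏ i, c i ^ J i := (prod_pow_ite_of_eq_one hc I).symm
  rw [hp, ← hJ]
  rw [← hJ] at hI
  by_cases hi : (i : ℕ) < r
  · rw [transverseGrading, if_pos hi] at hI
    rw [hc i hi]
    have h1 := h (J + Pi.single j 1) (fun l hl => by
      rw [Pi.add_apply, hJ0 l hl, Pi.single_eq_of_ne, add_zero]
      exact fun hlj => absurd hl (by rw [hlj]; exact lt_irrefl r)) (by
      simp only [Pi.add_apply, Finset.sum_add_distrib, Finset.sum_pi_single', Finset.mem_univ,
        if_true]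
      omega) j le_rfl
    have h2 : ∏ l, c l ^ (J + Pi.single j 1 : Fin n → ℕ) l = c j * ∏ l, c l ^ J l := by
      simp only [Pi.add_apply, pow_add, Finset.prod_mul_distrib]
      rw [mul_comm]
      congr 1
      rw [Finset.prod_eq_single j (fun l _ hl => by rw [Pi.single_eq_of_ne hl, pow_zero])
        (by simp), Pi.single_eq_same, pow_one]
    have h3 : ∑ l, (J + Pi.single j 1 : Fin n → ℕ) l = (∑ l, J l) + 1 := by
      simp [Finset.sum_add_distrib]
    rw [h2, h3] at h1
    set s := ∑ l, J l
    have hs : (0 : ℝ) < s := by exact_mod_cast (by omega : 0 < s)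
    have h4 : (2 : ℝ) ^ (-β) * (s : ℝ) ^ (-β) ≤ ((s + 1 : ℕ) : ℝ) ^ (-β) := by
      rw [← Real.mul_rpow (by norm_num) hs.le]
      refine Real.rpow_le_rpow_of_nonpos (by positivity) ?_ (by linarith)
      have : (1 : ℝ) ≤ s := by exact_mod_cast (by omega : 1 ≤ s)
      push_cast; linarith
    have h5 : ‖c j * (∏ l, c l ^ J l) - c j‖ = ‖(∏ l, c l ^ J l) - 1‖ * ‖c j‖ := by
      rw [← norm_mul]; congr 1; ring
    rw [h5] at h1
    calc min C (C * 2 ^ (-β) / ‖c j‖) * (s : ℝ) ^ (-β)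
        ≤ C * 2 ^ (-β) / ‖c j‖ * (s : ℝ) ^ (-β) := by gcongr; exact min_le_right _ _
      _ = C * (2 ^ (-β) * (s : ℝ) ^ (-β)) / ‖c j‖ := by ring
      _ ≤ C * ((s + 1 : ℕ) : ℝ) ^ (-β) / ‖c j‖ := by gcongr
      _ ≤ ‖(∏ l, c l ^ J l) - 1‖ := by rwa [div_le_iff₀ hcj]
  · rw [transverseGrading, if_neg hi] at hI
    refine le_trans ?_ (h J hJ0 hI i (not_lt.mp hi))
    gcongr
    exact min_le_left _ _

lemma prod_X_sub_C_ite (hr : r ≤ n) (μ : k) :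
    ∏ i : Fin n, (Polynomial.X - Polynomial.C (if (i : ℕ) < r then 1 else μ)) =
      (Polynomial.X - 1) ^ r * (Polynomial.X - Polynomial.C μ) ^ (n - r) := by
  obtain ⟨d, rfl⟩ := Nat.exists_eq_add_of_le hr
  rw [Fin.prod_univ_eq_prod_range
    (fun i => Polynomial.X - Polynomial.C (if i < r then 1 else μ)), Finset.prod_range_add]
  congr 1
  · rw [Finset.prod_congr rfl (g := fun _ => Polynomial.X - 1)
      (fun i hi => by rw [if_pos (Finset.mem_range.mp hi), Polynomial.C_1])]
    simp
  · simp

lemma sum_ite_lt (hr : r ≤ n) (μ : k) :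
    ∑ i : Fin n, (if (i : ℕ) < r then 1 else μ) = r + ((n - r : ℕ) : k) * μ := by
  obtain ⟨d, rfl⟩ := Nat.exists_eq_add_of_le hr
  rw [Fin.sum_univ_eq_sum_range (fun i => if i < r then 1 else μ), Finset.sum_range_add]
  congr 1
  · rw [Finset.sum_congr rfl (g := fun _ => (1 : k))
      (fun i hi => by rw [if_pos (Finset.mem_range.mp hi)])]
    simp
  · simp

lemma IsCenteredChart.injective_fderiv {E : Type*} [NormedAddCommGroup E] [NormedSpace k E]
    {θ ψ : E → E} {q : E} (h : IsCenteredChart k θ ψ q) : Function.Injective (fderiv k θ q) := by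
  have d1 : HasFDerivAt ψ (fderiv k ψ 0) (θ q) := by
    rw [h.map_center]; exact h.analyticAt_inv.differentiableAt.hasFDerivAt
  have d2 := (d1.comp q h.analyticAt.differentiableAt.hasFDerivAt).unique
    ((hasFDerivAt_id q).congr_of_eventuallyEq h.left_inv)
  exact Function.LeftInverse.injective (g := fderiv k ψ 0) fun v => DFunLike.congr_fun d2 v

lemma IsAnalyticDiffeo.injective_fderiv {φ : (Fin n → k) → Fin n → k} {W V : Set (Fin n → k)}
    (h : IsAnalyticDiffeo k φ W V) {q : Fin n → k} (hq : q ∈ W) :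
    Function.Injective (fderiv k φ q) := by
  obtain ⟨ψ, hψ, -⟩ := h.isCenteredChart hq
  have := hψ.injective_fderiv
  rwa [fderiv_sub_const] at this

variable [IsUltrametricDist k] [CompleteSpace k]

/-- Linearization in the case of constant badly approximable eigenvalues. -/
theorem isLinearizedBy_of_isBadlyApproximable (hr : r < n) {F G : Set (Fin n → k)}
    (hG : IsGeneralSubset k r F G) {f : (Fin n → k) → Fin n → k} (hfix : ∀ x ∈ G, f x = x)
    (hf : ∀ x ∈ G, AnalyticAt k f x)
    (hss : ∀ x ∈ G, Module.End.IsSemisimple (fderiv k f x : (Fin n → k) →ₗ[k] (Fin n → k)))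
    {c : Fin n → k} (hc : ∀ i : Fin n, (i : ℕ) < r → c i = 1)
    (hch : ∀ x ∈ G, LinearMap.charpoly (fderiv k f x : (Fin n → k) →ₗ[k] (Fin n → k)) =
      ∏ i, (Polynomial.X - Polynomial.C (c i)))
    (hbad : IsBadlyApproximable r c) {q : Fin n → k} (hq : q ∈ G) :
    IsLinearizedBy hr.le f q (fun i _ => c i) := by
  obtain ⟨hne, C, β, hC, hβ, hdiv⟩ := hbad.exists_bound hr hc
  obtain ⟨K, hK, hKdiv⟩ := exists_smallDivisorBound_const hC hβ hdiv
  obtain ⟨θ, ψ, h, hψ, hd⟩ := hG.exists_adapted_chart hfix hq (hf q hq) (hss q hq) (hch q hq)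
    fun i hi => (hne i hi).2
  have hfin : Fintype (Set.range c) := Fintype.ofFinite _
  have hc0 : ∀ i, 0 < ‖c i‖ := fun i => norm_pos_iff.mpr (by
    by_cases hi : (i : ℕ) < r
    · rw [hc i hi]; exact one_ne_zero
    · exact (hne i (not_lt.mp hi)).1)
  have := isLinearizedBy_of_smallDivisorBound hr.le hfix hq (hf q hq) hss h hψ
    (e := fun (b : Set.range c) _ => (b : k)) (fun b => analyticAt_const) Subtype.val_injective
    (a := fun i => ⟨c i, i, rfl⟩) (fun i hi _ => hc i hi) hd
    (hψ.mono fun z hz => hch _ hz) one_pos (lam := fun i => MvPowerSeries.C (c i)) hc0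
    (fun i => C_mem_paramSubring (c i)) (fun i hi => by rw [hc i hi, map_one])
    (fun i => coeffBound_C le_rfl) (Eventually.of_forall fun z i => evalSeries_C _ _) hK hβ hKdiv
  simpa only [evalSeries_C] using this

/-- Along the fixed set, the transverse eigenvalue is given by a convergent power series. -/
lemma exists_transverse_eigenvalue_series [CharZero k] (hr : r < n) {g : (Fin n → k) → Fin n → k}
    (hg : AnalyticAt k g 0) {μ : (Fin n → k) → k}
    (hch : ∀ᶠ z in 𝓝 0, LinearMap.charpoly
      (fderiv k g (gradedScale (transverseGrading n r) 0 z) : (Fin n → k) →ₗ[k] (Fin n → k)) =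
        ∏ i : Fin n, (Polynomial.X - Polynomial.C (if (i : ℕ) < r then 1 else μ z))) :
    ∃ (m : (Fin n → k) → k) (P : MvPowerSeries (Fin n) k) (R M : ℝ), AnalyticAt k m 0 ∧ 0 < R ∧
      CoeffBound R M P ∧ P ∈ paramSubring k (transverseGrading n r) ∧
      (∀ᶠ z in 𝓝 0, m (gradedScale (transverseGrading n r) 0 z) = μ z) ∧
      ∀ᶠ z in 𝓝 0, evalSeries P (gradedScale (transverseGrading n r) 0 z) = μ z := by
  let tr : ((Fin n → k) →L[k] (Fin n → k)) →L[k] k :=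
    ((LinearMap.trace k (Fin n → k)) ∘ₗ (ContinuousLinearMap.coeLM k)).toContinuousLinearMap
  -- The trace along the fixed set is `r + (n - r) μ`; in characteristic `0` it determines `μ` as an
  -- analytic function.
  let m : (Fin n → k) → k := fun z => (tr (fderiv k g z) - r) / ((n - r : ℕ) : k)
  have hm : AnalyticAt k m 0 :=
    (((tr.analyticAt _).comp hg.fderiv).sub analyticAt_const).div_const
  have hmμ : ∀ᶠ z in 𝓝 0, m (gradedScale (transverseGrading n r) 0 z) = μ z := by
    filter_upwards [hch] with z hz
    have h1 : tr (fderiv k g (gradedScale (transverseGrading n r) 0 z)) = _ :=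
      trace_eq_sum_of_charpoly_eq hz
    have h2 : ((n - r : ℕ) : k) ≠ 0 := Nat.cast_ne_zero.mpr (by omega)
    simp only [m]
    rw [h1, sum_ite_lt hr.le, add_sub_cancel_left, mul_div_cancel_left₀ _ h2]
  obtain ⟨P, R, M, hR, hP, hPm⟩ := hm.exists_evalSeries
  -- Keeping only the part of weight `0` leaves the values on the subspace unchanged and removes the
  -- transverse variables.
  have hpar : weightPart (transverseGrading n r) 0 P ∈ paramSubring k (transverseGrading n r) :=
    mem_paramSubring.mpr fun I hI => by rw [coeff_weightPart, if_neg hI]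
  refine ⟨m, _, R, M, hm, hR, hP.weightPart _ _, hpar, hmμ, ?_⟩
  filter_upwards [hmμ, (tendsto_gradedScale_zero_left _).eventually hPm] with z h1 h2
  rw [evalSeries_gradedScale_of_mem_paramSubring hpar, ← evalSeries_gradedScale_zero, ← h2, h1]

/-- Linearization in the case of a single transverse eigenvalue, not a root of unity. -/
theorem exists_isLinearizedBy_of_not_rootOfUnity [CharZero k] (hr : r < n)
    {F G : Set (Fin n → k)} (hG : IsGeneralSubset k r F G) {f : (Fin n → k) → Fin n → k}
    (hfix : ∀ x ∈ G, f x = x) (hf : ∀ x ∈ G, AnalyticAt k f x)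
    (hinj : ∀ x ∈ G, Function.Injective (fderiv k f x))
    (hss : ∀ x ∈ G, Module.End.IsSemisimple (fderiv k f x : (Fin n → k) →ₗ[k] (Fin n → k)))
    (hμ : ∀ x ∈ G, ∃ μ : k, (∀ m : ℕ, 0 < m → μ ^ m ≠ 1) ∧
        LinearMap.charpoly (fderiv k f x : (Fin n → k) →ₗ[k] (Fin n → k)) =
          (Polynomial.X - 1) ^ r * (Polynomial.X - Polynomial.C μ) ^ (n - r))
    {q : Fin n → k} (hq : q ∈ G) :
    ∃ lam : Fin n → (Fin r → k) → k,
      (∀ i : Fin n, (i : ℕ) < r → lam i = fun _ => 1) ∧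
      (∀ i j : Fin n, r ≤ (i : ℕ) → r ≤ (j : ℕ) → lam i = lam j) ∧
      IsLinearizedBy hr.le f q lam := by
  have : ∀ x, ∃ μ : k, x ∈ G → (∀ m : ℕ, 0 < m → μ ^ m ≠ 1) ∧
      LinearMap.charpoly (fderiv k f x : (Fin n → k) →ₗ[k] (Fin n → k)) =
        ∏ i : Fin n, (Polynomial.X - Polynomial.C (if (i : ℕ) < r then 1 else μ)) := fun x => by
    by_cases hx : x ∈ G
    · obtain ⟨μ, h1, h2⟩ := hμ x hx
      exact ⟨μ, fun _ => ⟨h1, by rw [h2, prod_X_sub_C_ite hr.le]⟩⟩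
    · exact ⟨0, fun h => absurd h hx⟩
  choose μ hμ using this
  have hμ1 : μ q ≠ 1 := by simpa using (hμ q hq).1 1 one_pos
  have hμ0 : μ q ≠ 0 := by
    -- A zero eigenvalue is impossible because the derivative of a diffeomorphism is injective.
    intro h0
    have h1 : (LinearMap.charpoly (fderiv k f q : (Fin n → k) →ₗ[k] (Fin n → k))).IsRoot 0 := by
      rw [(hμ q hq).2, prod_X_sub_C_ite hr.le, h0]
      simp [Polynomial.IsRoot, Nat.sub_ne_zero_of_lt hr]
    rw [← Module.End.hasEigenvalue_iff_isRoot_charpoly] at h1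
    obtain ⟨v, hv, hv0⟩ := h1.exists_hasEigenvector
    rw [Module.End.mem_eigenspace_iff, zero_smul] at hv
    exact hv0 (hinj q hq (hv.trans (map_zero (fderiv k f q)).symm))
  obtain ⟨θ, ψ, h, hψ, hd⟩ := hG.exists_adapted_chart hfix hq (hf q hq) (hss q hq)
    (hμ q hq).2 fun i hi => by rwa [if_neg (not_lt.mpr hi)]
  set y := transverseGrading n r
  have hS := tendsto_gradedScale_zero_left (k := k) y
  obtain ⟨m, P, R, M, hm, hR, hP, hPpar, hmμ, hPμ⟩ := exists_transverse_eigenvalue_series hr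
    (h.analyticAt_conj (hf q hq) (hfix q hq)) (μ := fun z => μ (ψ (gradedScale y 0 z))) (by
      filter_upwards [hψ, hS.eventually (h.eventually_charpoly_conj (hf q hq))] with z h1 h2
      rw [(h2 (hfix _ h1)).1]
      exact (hμ _ h1).2)
  have hS0 : gradedScale y (0 : k) (0 : Fin n → k) = 0 := map_zero (gradedProj k y)
  have hS0' : gradedScale (transverseGrading n r) (0 : k) (0 : Fin n → k) = 0 := hS0
  have hm0 : m 0 = μ q := by
    simpa only [hS0, hS0', h.inv_zero] using hmμ.self_of_nhds
  have hP0 : constantCoeff P = μ q := by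
    rw [← evalSeries_zero_right]
    simpa only [hS0, hS0', h.inv_zero] using hPμ.self_of_nhds
  obtain ⟨δ, β, hδ, hδ1, hβ, hdiv⟩ :=
    exists_smallDivisorBound_pow (σ := Fin n) hμ0 (hμ q hq).1
  -- `P - μ q` has no constant term, so shrinking the radius makes it as small as needed.
  obtain ⟨ρ, hρ, hPρ⟩ : ∃ ρ, 0 < ρ ∧
      CoeffBound ρ (δ * ‖μ q‖) (P - MvPowerSeries.C (μ q)) := by
    have h1 : CoeffBound R (max M ‖μ q‖) (P - MvPowerSeries.C (μ q)) := by
      rw [sub_eq_add_neg, ← map_neg]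
      exact (hP.mono (le_max_left _ _)).add hR (coeffBound_C (by rw [norm_neg]; exact le_max_right _ _))
    have hM : 0 < max M ‖μ q‖ := lt_max_of_lt_right (norm_pos_iff.mpr hμ0)
    have hs : 0 < min 1 (δ * ‖μ q‖ / max M ‖μ q‖) := by
      have := norm_pos_iff.mpr hμ0
      positivity
    refine ⟨_, mul_pos hR hs, (h1.shrink (by simp [hP0]) hs (min_le_left _ _)).mono ?_⟩
    rw [mul_comm, ← le_div_iff₀ hM]
    exact min_le_right _ _
  have hy : ∀ i, y i ≤ 1 := fun i => by
    simp only [y, transverseGrading]; split_ifs <;> omega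
  obtain ⟨K, hK, hKdiv⟩ := hdiv y P ρ hρ hy hP0 hPρ
  have hPb : CoeffBound ρ ‖μ q‖ P := by
    have h1 := (hPρ.mono (mul_le_of_le_one_left (norm_nonneg _) hδ1)).add hρ
      (coeffBound_C (c := μ q) le_rfl)
    rwa [sub_add_cancel] at h1
  have hy0 : ∀ i : Fin n, (i : ℕ) < r → y i = 0 := fun i hi => transverseGrading_eq_zero.mpr hi
  have hy1 : ∀ i : Fin n, ¬ (i : ℕ) < r → y i = 1 := fun i hi => by
    simp only [y, transverseGrading, if_neg hi]
  have hlin := isLinearizedBy_of_smallDivisorBound hr.le hfix hq (hf q hq) hss h hψ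
    -- Two eigenvalue functions, `1` and `m`; they differ at the origin since `μ q ≠ 1`.
    (e := fun (b : Bool) z => if b then 1 else m z) (fun b => by
      cases b
      · simpa using hm
      · simpa using analyticAt_const) (fun b b' hb => by
        cases b <;> cases b' <;> simp_all) (a := fun i => decide ((i : ℕ) < r))
    (fun i hi _ => by simp [hi]) (fun v i => by rw [hd, hm0]; simp) (by
      filter_upwards [hψ, hmμ] with z h1 h2
      rw [(hμ _ h1).2]
      simp only [decide_eq_true_eq]
      rw [h2]) hρ (lam := fun i => P ^ y i) (fun i => by
        rw [map_pow, hP0]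
        exact norm_pos_iff.mpr (pow_ne_zero _ hμ0)) (fun i => pow_mem hPpar _)
    (fun i hi => by rw [hy0 i hi, pow_zero]) (fun i => by
      rw [map_pow, hP0, norm_pow]
      exact hPb.pow hρ _) (by
      filter_upwards [hmμ, hPμ] with z h1 h2 i
      by_cases hi : (i : ℕ) < r
      · simp only [hy0 i hi, pow_zero, hi, decide_true, if_true]
        exact evalSeries_C 1 _
      · simp [hy1 i hi, hi, h1, h2, y]) hK hβ hKdiv
  refine ⟨_, fun i hi => ?_, fun i j hi hj => ?_, hlin⟩
  · funext z
    rw [hy0 i hi, pow_zero]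
    exact evalSeries_C 1 _
  · funext z
    rw [hy1 i (not_lt.mpr hi), hy1 j (not_lt.mpr hj)]

end Cases

theorem mainTheorem4 {k : Type*} [NontriviallyNormedField k] [IsUltrametricDist k]
    [CompleteSpace k] {n r : ℕ} (hr : r < n)
    (U : Set (Fin n → k)) (f : (Fin n → k) → (Fin n → k))
    (hf : IsAnalyticDiffeo k f U U)
    (hdim : HasAnalyticDim k r (fixedSet f U))
    (hss : ∀ q ∈ fixedSet f U,
      Module.End.IsSemisimple (fderiv k f q : (Fin n → k) →ₗ[k] (Fin n → k)))
    (G : Set (Fin n → k)) (hG : IsGeneralSubset k r (fixedSet f U) G) :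
    -- case (1): the eigenvalues distinct from 1 are equal and not roots of unity
    (CharZero k →
      (∀ q ∈ G, ∃ μ : k, (∀ m : ℕ, 0 < m → μ ^ m ≠ 1) ∧
        LinearMap.charpoly (fderiv k f q : (Fin n → k) →ₗ[k] (Fin n → k)) =
          (Polynomial.X - 1) ^ r * (Polynomial.X - Polynomial.C μ) ^ (n - r)) →
      ∀ q ∈ G, ∃ lam : Fin n → (Fin r → k) → k,
        (∀ i : Fin n, (i : ℕ) < r → lam i = fun _ => 1) ∧
        (∀ i j : Fin n, r ≤ (i : ℕ) → r ≤ (j : ℕ) → lam i = lam j) ∧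
        IsLinearizedBy hr.le f q lam) ∧
    -- case (2): the eigenvalues are constant and badly approximable
    (∀ lam : Fin n → k, (∀ i : Fin n, (i : ℕ) < r → lam i = 1) →
      (∀ q ∈ G,
        LinearMap.charpoly (fderiv k f q : (Fin n → k) →ₗ[k] (Fin n → k)) =
          ∏ i, (Polynomial.X - Polynomial.C (lam i))) →
      IsBadlyApproximable r lam →
      ∀ q ∈ G, IsLinearizedBy hr.le f q (fun i _ => lam i)) := by
  have hfix : ∀ x ∈ G, f x = x := fun x hx => (hG.1 hx).1.2
  have hfa : ∀ x ∈ G, AnalyticAt k f x := fun x hx => hf.2.2.2.1 x (hG.1 hx).1.1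
  have hss' : ∀ x ∈ G, Module.End.IsSemisimple (fderiv k f x : (Fin n → k) →ₗ[k] (Fin n → k)) :=
    fun x hx => hss x (hG.1 hx).1
  refine ⟨fun _ hμ q hq => ?_, fun lam hlam hch hbad q hq => ?_⟩
  · exact exists_isLinearizedBy_of_not_rootOfUnity hr hG hfix hfa
      (fun x hx => hf.injective_fderiv (hG.1 hx).1.1) hss' hμ hq
  · exact isLinearizedBy_of_isBadlyApproximable hr hG hfix hfa hss' hlam hch hbad hq
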